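/- Let $d\ge 1$ and equip all Euclidean spaces with the Euclidean norm. A countable iterated function system (CIFS) on $X=[0,1]^n$ is a countable (possibly finite) family $\{\varphi_a\colon X\to X\}_{a\in\mathcal A}$ of maps for which there is $\rho\in(0,1)$ with $\|\varphi_a(x)-\varphi_a(y)\|\le\rho\|x-y\|$ for all $a\in\mathcal A$ and $x,y\in X$. Its attractor is $\bigcup_{(a_i)\in\mathcal A^{\mathbb N}}\bigcap_{n\ge1}(\varphi_{a_1}\circ\cdots\circ\varphi_{a_n})(X)$. Let $\{\psi_j\}_{j\in J}$ be a CIFS on $[0,1]^d$, and for each $j\in J$ let $\{\gamma_{l,j}\}_{l\in L_j}$ be a CIFS on $[0,1]$ of the form $\gamma_{l,j}(x)=r_{j,l}x+t_{j,l}$ with $0<|r_{j,l}|<1$ and $t_{j,l}\in\mathbb R$. Suppose that for some $j^*\in J$ the attractor of $\{\gamma_{l,j^*}\}_{l\in L_{j^*}}$ has at least two points, and that the maps $$\varphi_{j,l}(x_1,\dots,x_{d+1})=(\psi_j(x_1,\dots,x_d),\gamma_{l,j}(x_{d+1}))\qquad(j\in J,\ l\in L_j)$$ form a CIFS on $[0,1]^{d+1}$.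 Let $p_{j,l}>0$ satisfy $\sum_{j\in J}\sum_{l\in L_j}p_{j,l}=1$, and suppose that $\sum_{j\in J}\sum_{l\in L_j}p_{j,l}|r_{j,l}|^{-\tau}<\infty$ for some $\tau>0$. Let $\mu$ be the stationary measure, that is, the Borel probability measure on $[0,1]^{d+1}$ with $\mu=\sum_{j,l}p_{j,l}\,\varphi_{j,l}\mu$, where $\varphi_{j,l}\mu$ denotes the pushforward. For a $C^2$ function $F\colon[0,1]^{d+1}\to\mathbb R$ let $F\mu$ be the pushforward of $\mu$ under $F$, let $\widehat{F\mu}(\xi)=\int_{\mathbb R}e^{-2\pi i\xi y}\,d(F\mu)(y)$, and let $$\|F\|_{\infty,k}=\max_{[0,1]^{d+1}}\Big|\frac{\partial^kF}{\partial x_{d+1}^k}\Big|\quad(k=1,2),\qquad \|F\|_{\min,2}=\min_{[0,1]^{d+1}}\Big|\frac{\partial^2F}{\partial x_{d+1}^2}\Big|.$$ Then there exist $\eta,\kappa,C>0$ such that the following two statements hold. (1) For every $C^2$ function $F\colon[0,1]^{d+1}\to\mathbb R$ with $\frac{\partial^2F}{\partial x_{d+1}^2}(x)\ne0$ for all $x\in[0,1]^{d+1}$,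 and for all real $\xi\ne0$, $$|\widehat{F\mu}(\xi)|\le C\,(1+\|F\|_{\infty,1}+\|F\|_{\infty,1}^{-\kappa}+\|F\|_{\infty,2})\,(1+\|F\|_{\min,2}^{-\kappa})\,|\xi|^{-\eta}.$$ (2) For every $C^2$ function $F\colon[0,1]^{d+1}\to\mathbb R$ with $\frac{\partial^2F}{\partial x_{d+1}^2}(x)\ne0$ for all $x\in\mathrm{supp}(\mu)$ there is a constant $C_{F,\mu}>0$ such that $|\widehat{F\mu}(\xi)|\le C_{F,\mu}|\xi|^{-\eta}$ for all real $\xi\ne0$. -/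

import Mathlib

open MeasureTheory Set

noncomputable section

namespace FibreIFS

/-- The unit cube `[0,1]^n` in Euclidean space `ℝⁿ`. -/
def cube (n : ℕ) : Set (EuclideanSpace ℝ (Fin n)) :=
  {x | ∀ i, x i ∈ Icc (0 : ℝ) 1}

/-- The point `(x₁, …, x_d)` of `[0,1]^d` below the point `(x₁, …, x_{d+1})` of `[0,1]^{d+1}`. -/
def cubeInit {d : ℕ} (x : cube (d + 1)) : cube d :=
  ⟨WithLp.toLp 2 fun i => x.1 i.castSucc, fun i => x.2 i.castSucc⟩

/-- The last coordinate of a point of `[0,1]^{d+1}`. -/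
def cubeLast {d : ℕ} (x : cube (d + 1)) : unitInterval :=
  ⟨x.1 (Fin.last d), x.2 (Fin.last d)⟩

/-- The point `(y₁, …, y_d, s)` of `[0,1]^{d+1}`. -/
def cubeSnoc {d : ℕ} (y : cube d) (s : unitInterval) : cube (d + 1) :=
  ⟨WithLp.toLp 2 (Fin.snoc (α := fun _ => ℝ) (fun i => y.1 i) (s : ℝ)), fun i => by
    refine Fin.lastCases ?_ (fun j => ?_) i
    · simp
    · simpa using y.2 j⟩

/-- A countable iterated function system: a countable family of self-maps whose
Lipschitz constants are bounded by one common constant smaller than `1`. -/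
def IsCIFS {X A : Type*} [EMetricSpace X] (Φ : A → X → X) : Prop :=
  Countable A ∧ ∃ K : NNReal, ∀ a, ContractingWith K (Φ a)

/-- `wordMap Φ a n = Φ_{a₀} ∘ ⋯ ∘ Φ_{a_{n-1}}`. -/
def wordMap {X A : Type*} (Φ : A → X → X) (a : ℕ → A) : ℕ → X → X
  | 0 => id
  | n + 1 => wordMap Φ a n ∘ Φ (a n)

/-- The attractor of a CIFS: the union, over all infinite words in the alphabet, of the
intersections of the images of the whole space under the finite initial words. -/
def attractor {X A : Type*} (Φ : A → X → X) : Set X :=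
  ⋃ a : ℕ → A, ⋂ n : ℕ, range (wordMap Φ a (n + 1))

/-- `μ = ∑_a p_a · Φ_a μ`, where `Φ_a μ` is the pushforward. -/
def IsStationary {X A : Type*} [MeasurableSpace X] (Φ : A → X → X) (p : A → ℝ)
    (μ : Measure X) : Prop :=
  μ = Measure.sum fun a => ENNReal.ofReal (p a) • μ.map (Φ a)

/-- The maps `(x₁, …, x_{d+1}) ↦ (ψ_j (x₁, …, x_d), γ_{l,j} (x_{d+1}))`, indexed by pairs
`(j, l)` with `l ∈ L_j`. -/
def prodMaps {d : ℕ} {J : Type*} {L : J → Type*} (ψ : J → cube d → cube d)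
    (γ : (j : J) → L j → unitInterval → unitInterval) :
    (Σ j, L j) → cube (d + 1) → cube (d + 1) :=
  fun a x => cubeSnoc (ψ a.1 (cubeInit x)) (γ a.1 a.2 (cubeLast x))

/-- A fibre product CIFS on `[0,1]^{d+1}` with base index set `J` and fibre index sets `L j`. -/
structure FibreProductCIFS (d : ℕ) (J : Type*) (L : J → Type*) where
  /-- the base maps `ψ_j` -/
  base : J → cube d → cube d
  /-- the fibre maps `γ_{l,j}` -/
  fibre : (j : J) → L j → unitInterval → unitInterval
  /-- the signed contraction ratios `r_{l,j}` -/
  ratio : (j : J) → L j → ℝ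
  /-- the translations `t_{l,j}` -/
  trans : (j : J) → L j → ℝ
  base_isCIFS : IsCIFS base
  fibre_isCIFS : ∀ j, IsCIFS (fibre j)
  abs_ratio_mem : ∀ j l, |ratio j l| ∈ Ioo (0 : ℝ) 1
  fibre_eq : ∀ j l x, (fibre j l x : ℝ) = ratio j l * x + trans j l
  /-- the attractor of some fibre CIFS has at least two points -/
  exists_nontrivial : ∃ j, (attractor (fibre j)).Nontrivial
  prod_isCIFS : IsCIFS (prodMaps base fibre)

/-- The maps `φ_{j,l}` of a fibre product CIFS. -/
def FibreProductCIFS.maps {d : ℕ} {J : Type*} {L : J → Type*} (S : FibreProductCIFS d J L) :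
    (Σ j, L j) → cube (d + 1) → cube (d + 1) :=
  prodMaps S.base S.fibre

/-- The `k`-th partial derivative of `F` in the last variable, at a point `x` of `[0,1]^{d+1}`
(one-sided if the last coordinate of `x` is `0` or `1`). -/
def partialLast {d : ℕ} (k : ℕ) (F : EuclideanSpace ℝ (Fin (d + 1)) → ℝ)
    (x : EuclideanSpace ℝ (Fin (d + 1))) : ℝ :=
  iteratedDerivWithin k
    (fun s : ℝ => F (WithLp.toLp 2 (Function.update (fun i => x i) (Fin.last d) s)))
    (Icc 0 1) (x (Fin.last d))

/-- `‖F‖_{∞,k}`, the maximum over `[0,1]^{d+1}` of `|∂ᵏF/∂x_{d+1}ᵏ|`. -/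
def normSup {d : ℕ} (k : ℕ) (F : EuclideanSpace ℝ (Fin (d + 1)) → ℝ) : ℝ :=
  ⨆ x : cube (d + 1), |partialLast k F x|

/-- `‖F‖_{min,k}`, the minimum over `[0,1]^{d+1}` of `|∂ᵏF/∂x_{d+1}ᵏ|`. -/
def normMin {d : ℕ} (k : ℕ) (F : EuclideanSpace ℝ (Fin (d + 1)) → ℝ) : ℝ :=
  ⨅ x : cube (d + 1), |partialLast k F x|

/-- The Fourier transform `ξ ↦ ∫ e^{-2πiξy} dν(y)` of a measure on the line. -/
def fourierTransform (ν : Measure ℝ) (ξ : ℝ) : ℂ :=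
  ∫ y : ℝ, Complex.exp (-(2 * Real.pi * ξ * y : ℝ) * Complex.I) ∂ν

/-- The pushforward `Fμ` to the line of a measure `μ` on `[0,1]^n`, for `F` defined on `[0,1]^n`
(values of `F` off the cube play no role). -/
def pushforward {n : ℕ} (F : EuclideanSpace ℝ (Fin n) → ℝ) (μ : Measure (cube n)) : Measure ℝ :=
  μ.map fun x : cube n => F x

end FibreIFS

end

open scoped ENNReal

namespace FibreIFS

universe u

/-! The oscillation is produced inside the fibres. If all fibre maps over one index commuted, they
would share a fixed point and the attractor would be a single point; so over `j*` two of them do not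
commute (`exists_not_commute`). In the system of twofold compositions the two orders of this pair
are twins: same weight, base map and ratio, but different translations. Cut a random word at each
occurrence of a twin. Given everything except which twin occurs, each piece offers a fair choice
between two maps that agree on the base and differ in the fibre by a translation of `c` times the
ratio (`PairSystem`). Thus integrals against `μ` are controlled by averages over clouds `a + c ∑ εₖ
r₁⋯rₖ`, each inside one fibre, with random ratios; after iterating the system, `|rₖ| ≤ 1/4`.

For a fixed word, stop when `|r₁⋯rₙ|` first drops to a scale `h₀`, about `|ξ|^(-5/8)`. Below this
scale the function is replaced by its tangent, with error of order `|ξ| h₀²`, and the remaining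
letters give a product of cosines at the frequency `ξ r₁⋯rₙ f'(s)`. The second derivative bounds
differences of `f'` from below and the cloud is separated, so a unit interval of frequencies carries
mass at most `2⁻ⁱ` (`mean_indicator_le`). Such a flat distribution mostly sees small cosine products
(`sum_mul_cosProd_pow_le`): when the frequencies are rescaled by the ratio `R` of a block of
letters, flatness would deteriorate like `1/|R|`, but a power of one cosine discards nearly
everything not within `κ` of an integer, and the loss is only of order `1 + κ/|R|`. With long blocks
and then small `κ`, the total loss is at most `2^(i/2)` outside rare words.

Rare words (product too small too early, an overshoot at the stopping time, too large a loss) are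
handled by Markov's inequality, using a negative moment of the ratios; `exists_norm_integral_osc_le`
balances the terms. The moment passes to the cut words because a small enough negative power keeps
the series over words geometric (`Twins.exists_tsum_otherWeight_lt_one`).

This gives statement (1) directly. For (2), the second derivative is bounded away from zero on the
images of the cube under a fine enough iterate of the system, since each image contains a point of
the support; (1)-type decay is applied to `F` composed with each map and summed. -/

/-! ### Averages over the finite sums `c ∑ εₖ r₁ ⋯ rₖ` -/

/-- All sums `c ∑ₖ εₖ r₁ ⋯ rₖ` with `εₖ ∈ {0, 1}`. -/
noncomputable def cloud (c : ℝ) : List ℝ → List ℝ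
  | [] => [0]
  | r :: l => (cloud c l).map (fun z => r * z) ++ (cloud c l).map (fun z => r * z + r * c)

/-- The average of `f` over the points of `cloud c l`. -/
noncomputable def mean {V : Type*} [AddCommGroup V] [Module ℝ V] (c : ℝ) (l : List ℝ)
    (f : ℝ → V) : V :=
  ((2 : ℝ) ^ l.length)⁻¹ • ((cloud c l).map f).sum

section mean

variable {V : Type*} [AddCommGroup V] [Module ℝ V] {c : ℝ}

theorem length_cloud (l : List ℝ) : (cloud c l).length = 2 ^ l.length := by
  induction l with
  | nil => simp [cloud]
  | cons r l ih => simp [cloud, ih, pow_succ]; ring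

@[simp] theorem mean_nil (f : ℝ → V) : mean c [] f = f 0 := by simp [mean, cloud]

theorem mean_cons (r : ℝ) (l : List ℝ) (f : ℝ → V) :
    mean c (r :: l) f
      = (1 / 2 : ℝ) • (mean c l (fun z => f (r * z)) + mean c l fun z => f (r * z + r * c)) := by
  simp only [mean, cloud, List.map_append, List.map_map, List.sum_append, List.length_cons,
    smul_add, smul_smul, pow_succ, mul_inv, Function.comp_def]
  congr 2 <;> ring

theorem mean_append (l₁ l₂ : List ℝ) (f : ℝ → V) :
    mean c (l₁ ++ l₂) f = mean c l₁ fun z => mean c l₂ fun w => f (z + l₁.prod * w) := by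
  induction l₁ generalizing f with
  | nil => simp
  | cons r l ih =>
    simp only [List.cons_append, mean_cons, ih, List.prod_cons]
    congr 3 <;> funext z <;> congr 1 <;> funext w <;> congr 1 <;> ring

theorem mean_congr {l : List ℝ} {f g : ℝ → V} (h : ∀ z ∈ cloud c l, f z = g z) :
    mean c l f = mean c l g := by
  simp only [mean, List.map_congr_left h]

theorem mean_add (l : List ℝ) (f g : ℝ → V) :
    mean c l (fun z => f z + g z) = mean c l f + mean c l g := by
  simp only [mean, ← smul_add, List.sum_map_add]

theorem mean_smul (l : List ℝ) (a : ℝ) (f : ℝ → V) :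
    mean c l (fun z => a • f z) = a • mean c l f := by
  rw [mean, mean, smul_comm a, List.smul_sum (r := a), List.map_map]
  rfl

theorem mean_eq_sum (l : List ℝ) (f : ℝ → ℝ) :
    mean c l f = ∑ i : Fin (cloud c l).length, ((2 : ℝ) ^ l.length)⁻¹ * f (cloud c l)[i] := by
  rw [mean, ← Finset.mul_sum, smul_eq_mul]
  congr 1
  conv_lhs => rw [← List.ofFn_getElem (xs := cloud c l)]
  rw [List.map_ofFn, List.sum_ofFn]
  rfl

theorem mean_const (l : List ℝ) (a : ℝ) : mean c l (fun _ => a) = a := by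
  simp only [mean, List.map_const', List.sum_replicate, length_cloud, smul_eq_mul, nsmul_eq_mul]
  push_cast
  field_simp

theorem mean_mono {l : List ℝ} {f g : ℝ → ℝ} (h : ∀ z ∈ cloud c l, f z ≤ g z) :
    mean c l f ≤ mean c l g := by
  simp only [mean, smul_eq_mul]
  gcongr
  exact List.sum_le_sum h

theorem norm_mean_le (l : List ℝ) (f : ℝ → ℂ) : ‖mean c l f‖ ≤ mean c l fun z => ‖f z‖ := by
  induction l generalizing f with
  | nil => simp
  | cons r l ih =>
    simp only [mean_cons, norm_smul, smul_eq_mul]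
    norm_num
    exact (norm_add_le _ _).trans (add_le_add (ih _) (ih _))

theorem zero_mem_cloud (l : List ℝ) : (0 : ℝ) ∈ cloud c l := by
  induction l with
  | nil => simp [cloud]
  | cons r l ih => simp only [cloud, List.mem_append, List.mem_map]; exact Or.inl ⟨0, ih, by simp⟩

theorem mem_cloud_append {l₁ l₂ : List ℝ} {z w : ℝ} (hz : z ∈ cloud c l₁) (hw : w ∈ cloud c l₂) :
    z + l₁.prod * w ∈ cloud c (l₁ ++ l₂) := by
  induction l₁ generalizing z with
  | nil => simp_all [cloud]
  | cons r l ih =>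
    simp only [cloud, List.mem_append, List.mem_map, List.cons_append, List.prod_cons] at hz ⊢
    rcases hz with ⟨a, ha, rfl⟩ | ⟨a, ha, rfl⟩
    · exact Or.inl ⟨_, ih ha, by ring⟩
    · exact Or.inr ⟨_, ih ha, by ring⟩

/-- The geometric series with ratio `1/4` sums to `1/3`. Hence the two halves of a cloud, whose
centres are `|r c|` apart, keep a gap of `|r c| / 3`. -/
theorem abs_le_of_mem_cloud {l : List ℝ} (hl : ∀ r ∈ l, |r| ≤ 1 / 4) {z : ℝ}
    (hz : z ∈ cloud c l) : |z| ≤ |c| / 3 := by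
  induction l generalizing z with
  | nil => simp_all [cloud]; positivity
  | cons r l ih =>
    have hr := hl r (by simp)
    have ih' := fun z hz => ih (fun r hr => hl r (by simp [hr])) (z := z) hz
    simp only [cloud, List.mem_append, List.mem_map] at hz
    rcases hz with ⟨a, ha, rfl⟩ | ⟨a, ha, rfl⟩
    · rw [abs_mul]
      nlinarith [ih' a ha, abs_nonneg r, abs_nonneg a]
    · rw [← mul_add, abs_mul]
      nlinarith [ih' a ha, abs_nonneg r, abs_nonneg a, abs_add_le a c, abs_nonneg c,
        abs_nonneg (a + c)]

open Classical in
/-- A set of diameter less than `|c r₁ ⋯ rᵢ| / 3` carries at most a proportion `2⁻ⁱ` of the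
points `c ∑ εₖ r₁ ⋯ rₖ`. -/
theorem mean_indicator_le {l : List ℝ} (hl : ∀ r ∈ l, r ≠ 0 ∧ |r| ≤ 1 / 4) {i : ℕ}
    (hi : i ≤ l.length) (s : Set ℝ)
    (hs : ∀ x ∈ s, ∀ y ∈ s, |x - y| < |c| * |(l.take i).prod| / 3) :
    mean c l (s.indicator fun _ => (1 : ℝ)) ≤ (1 / 2) ^ i := by
  induction i generalizing l s with
  | zero =>
    calc _ ≤ mean c l (fun _ => (1 : ℝ)) :=
          mean_mono fun z _ => indicator_le_self' (fun _ _ => zero_le_one) z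
      _ = _ := by rw [mean_const]; simp
  | succ i ih =>
    rcases l with - | ⟨r, l⟩
    · simp at hi
    obtain ⟨hr0, hr⟩ := hl r (by simp)
    have hl' : ∀ r ∈ l, r ≠ 0 ∧ |r| ≤ 1 / 4 := fun r hr => hl r (by simp [hr])
    have hra : 0 < |r| := abs_pos.2 hr0
    have hprod : |(l.take i).prod| ≤ 1 := by
      have : ∀ m : List ℝ, (∀ r ∈ m, |r| ≤ 1) → |m.prod| ≤ 1 := by
        intro m hm
        induction m with
        | nil => simp
        | cons a m ihm =>
          rw [List.prod_cons, abs_mul]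
          exact mul_le_one₀ (hm a (by simp)) (abs_nonneg _) (ihm fun b hb => hm b (by simp [hb]))
      exact this _ fun b hb => (hl' b (List.mem_of_mem_take hb)).2.trans (by norm_num)
    simp only [List.take_succ_cons, List.prod_cons, abs_mul] at hs
    have hpre : ∀ b : ℝ, ∀ x ∈ {z | r * z + b ∈ s}, ∀ y ∈ {z | r * z + b ∈ s},
        |x - y| < |c| * |(l.take i).prod| / 3 := by
      intro b x hx y hy
      have := hs _ hx _ hy
      rw [show r * x + b - (r * y + b) = r * (x - y) by ring, abs_mul] at this
      have h2 : |r| * |x - y| < |r| * (|c| * |(l.take i).prod| / 3) := by linarith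
      exact lt_of_mul_lt_mul_left h2 hra.le
    have e1 := ih hl' (by simpa using hi) {z | r * z + 0 ∈ s} (hpre 0)
    have e2 := ih hl' (by simpa using hi) {z | r * z + r * c ∈ s} (hpre (r * c))
    have hind : ∀ b z, s.indicator (fun _ => (1 : ℝ)) (r * z + b)
        = ({z | r * z + b ∈ s} : Set ℝ).indicator (fun _ => 1) z := by
      intro b z; rfl
    -- The two halves of the cloud are `|r c| / 3` apart, more than the diameter of `s`, so `s`
    -- misses one of them; this is the factor `1/2` of each level.
    have key : mean c l (({z | r * z + 0 ∈ s} : Set ℝ).indicator fun _ => (1 : ℝ)) = 0 ∨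
        mean c l (({z | r * z + r * c ∈ s} : Set ℝ).indicator fun _ => (1 : ℝ)) = 0 := by
      have hzero : ∀ t : Set ℝ, (∀ z ∈ cloud c l, z ∉ t) →
          mean c l (t.indicator fun _ => (1 : ℝ)) = 0 := fun t ht => by
        rw [mean_congr (g := fun _ => (0 : ℝ)) fun z hz => indicator_of_notMem (ht z hz) _,
          mean_const]
      by_contra! hcon
      have h1 : ∃ z ∈ cloud c l, r * z + 0 ∈ s := by
        by_contra! h; exact hcon.1 (hzero _ h)
      have h2 : ∃ z ∈ cloud c l, r * z + r * c ∈ s := by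
        by_contra! h; exact hcon.2 (hzero _ h)
      obtain ⟨x, hx, hxs⟩ := h1
      obtain ⟨y, hy, hys⟩ := h2
      have bx := abs_le_of_mem_cloud (fun r hr => (hl' r hr).2) hx
      have bd := abs_le_of_mem_cloud (fun r hr => (hl' r hr).2) hy
      have := hs _ hxs _ hys
      rw [show r * x + 0 - (r * y + r * c) = r * (x - y - c) by ring, abs_mul] at this
      have h3 : |c| / 3 ≤ |x - y - c| := by
        have := abs_sub_abs_le_abs_sub c (x - y)
        have h4 := abs_sub x y
        rw [abs_sub_comm]; linarith
      nlinarith [mul_le_mul_of_nonneg_left hprod (mul_nonneg hra.le (abs_nonneg c)),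
        mul_le_mul_of_nonneg_left h3 hra.le]
    rw [mean_cons, smul_eq_mul, pow_succ]
    have h0 : (fun z => s.indicator (fun _ => (1 : ℝ)) (r * z))
        = ({z | r * z + 0 ∈ s} : Set ℝ).indicator fun _ => 1 := by
      funext z; rw [← hind, add_zero]
    rw [h0, show (fun z => s.indicator (fun _ => (1 : ℝ)) (r * z + r * c)) = _ from
      funext (hind (r * c))]
    rcases key with h | h <;> rw [h] <;> linarith

end mean

/-! ### Fourier transforms of the averages -/

/-- `e^{-2πix}`. -/
noncomputable def osc (x : ℝ) : ℂ := Complex.exp (-(2 * Real.pi * x : ℝ) * Complex.I)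

theorem osc_add (x y : ℝ) : osc (x + y) = osc x * osc y := by
  rw [osc, osc, osc, ← Complex.exp_add]; congr 1; push_cast; ring

theorem osc_eq (x : ℝ) : osc x = Complex.exp ((-(2 * Real.pi * x) : ℝ) * Complex.I) := by
  rw [osc]; push_cast; rfl

theorem norm_osc (x : ℝ) : ‖osc x‖ = 1 := by
  rw [osc_eq, Complex.norm_exp_ofReal_mul_I]

theorem continuous_osc : Continuous osc := by unfold osc; fun_prop

theorem norm_osc_sub_le (x y : ℝ) : ‖osc x - osc y‖ ≤ 2 * Real.pi * |x - y| := by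
  have h : osc x - osc y = osc y * (osc (x - y) - 1) := by
    rw [mul_sub, ← osc_add]; simp
  rw [h, norm_mul, norm_osc, one_mul, osc_eq, mul_comm _ Complex.I]
  refine (Real.norm_exp_I_mul_ofReal_sub_one_le).trans ?_
  rw [norm_neg, Real.norm_eq_abs, abs_mul, abs_of_pos (by positivity)]

theorem norm_one_add_osc (x : ℝ) : ‖1 + osc x‖ = 2 * |Real.cos (Real.pi * x)| := by
  have h : 1 + osc x = osc (x / 2) * (2 * Real.cos (Real.pi * x) : ℝ) := by
    have : (1 : ℂ) = osc (x / 2) * osc (-(x / 2)) := by rw [← osc_add]; simp [osc]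
    rw [show osc x = osc (x / 2) * osc (x / 2) by rw [← osc_add]; ring_nf, this, ← mul_add]
    congr 1
    push_cast
    rw [Complex.cos, osc, osc]
    push_cast
    rw [mul_div_cancel₀ _ two_ne_zero]
    congr 2 <;> ring_nf
  rw [h, norm_mul, norm_osc, one_mul, Complex.norm_real, Real.norm_eq_abs, abs_mul]
  simp

/-- `∏ₖ |cos (π c t r₁ ⋯ rₖ)|`. -/
noncomputable def cosProd (c : ℝ) : List ℝ → ℝ → ℝ
  | [], _ => 1
  | r :: l, t => |Real.cos (Real.pi * (c * (r * t)))| * cosProd c l (r * t)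

/-- The choices `εₖ` are independent, and each contributes a factor `(1 + osc) / 2` of modulus
`|cos|`; the offset `a` is only a phase. -/
theorem norm_mean_osc (c : ℝ) (l : List ℝ) (a t : ℝ) :
    ‖mean c l fun z => osc (a + t * z)‖ = cosProd c l t := by
  induction l generalizing a t with
  | nil => simp [cosProd, norm_osc]
  | cons r l ih =>
    have h1 : ∀ z, osc (a + t * (r * z + r * c)) = osc (c * (r * t)) * osc (a + (r * t) * z) := by
      intro z; rw [← osc_add]; ring_nf
    have h2 : ∀ z, osc (a + t * (r * z)) = osc (a + (r * t) * z) := by intro z; ring_nf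
    have h3 : ∀ b : ℂ, ∀ f : ℝ → ℂ, mean c l (fun z => b * f z) = b * mean c l f := by
      intro b f
      simp only [mean, List.sum_map_mul_left, mul_smul_comm]
    simp only [mean_cons, h1, h2, h3]
    rw [← one_add_mul, norm_smul, norm_mul, norm_one_add_osc, ih, cosProd]
    norm_num
    ring

theorem cosProd_nonneg (c : ℝ) (l : List ℝ) (t : ℝ) : 0 ≤ cosProd c l t := by
  rw [← norm_mean_osc c l 0]; exact norm_nonneg _

theorem cosProd_le_one (c : ℝ) (l : List ℝ) (t : ℝ) : cosProd c l t ≤ 1 := by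
  induction l generalizing t with
  | nil => simp [cosProd]
  | cons r l ih => exact mul_le_one₀ (Real.abs_cos_le_one _) (cosProd_nonneg _ _ _) (ih _)

/-- Of the cosines of the block `l₁` only the last one is kept, the others being at most `1`. -/
theorem cosProd_append_le (c : ℝ) {l₁ : List ℝ} (h : l₁ ≠ []) (l₂ : List ℝ) (t : ℝ) :
    cosProd c (l₁ ++ l₂) t
      ≤ |Real.cos (Real.pi * (c * (l₁.prod * t)))| * cosProd c l₂ (l₁.prod * t) := by
  induction l₁ generalizing t with
  | nil => exact absurd rfl h
  | cons r l ih =>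
    rcases l with - | ⟨r', l⟩
    · simp [cosProd]
    · have := ih (by simp) (r * t)
      rw [List.cons_append, cosProd, List.prod_cons]
      refine (mul_le_of_le_one_left (cosProd_nonneg _ _ _) (Real.abs_cos_le_one _)).trans ?_
      rwa [show (r' :: l).prod * (r * t) = r * (r' :: l).prod * t by ring] at this

/-- Linearisation: the oscillating average of a function with a quadratic remainder. -/
theorem norm_mean_osc_append_le {c : ℝ} {l₁ l₂ : List ℝ} (hl₂ : ∀ r ∈ l₂, |r| ≤ 1 / 4)
    {f g : ℝ → ℝ} {D : Set ℝ} {M a ξ : ℝ} (hM : 0 ≤ M)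
    (hD : ∀ z ∈ cloud c (l₁ ++ l₂), a + z ∈ D)
    (hf : ∀ s ∈ D, ∀ s' ∈ D, |f s' - f s - g s * (s' - s)| ≤ M * |s' - s| ^ 2) :
    ‖mean c (l₁ ++ l₂) fun z => osc (ξ * f (a + z))‖ ≤
      mean c l₁ (fun z => cosProd c l₂ (ξ * l₁.prod * g (a + z)))
        + 2 * Real.pi * |ξ| * M * (|l₁.prod| * (|c| / 3)) ^ 2 := by
  rw [mean_append]
  refine (norm_mean_le _ _).trans ?_
  rw [← mean_const (c := c) l₁ (2 * Real.pi * |ξ| * M * (|l₁.prod| * (|c| / 3)) ^ 2), ← mean_add]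
  refine mean_mono fun z hz => ?_
  -- Tangent at the cylinder point `a + z`, plus the remainder. The tangent part averages to
  -- `cosProd` over `l₂`.
  have hsplit : ∀ w, osc (ξ * f (a + (z + l₁.prod * w)))
      = osc (ξ * f (a + z) + (ξ * l₁.prod * g (a + z)) * w)
        + (osc (ξ * f (a + (z + l₁.prod * w)))
          - osc (ξ * f (a + z) + (ξ * l₁.prod * g (a + z)) * w)) := fun w => by ring
  rw [funext hsplit, mean_add]
  refine (norm_add_le _ _).trans (add_le_add (norm_mean_osc _ _ _ _).le ?_)
  refine (norm_mean_le _ _).trans ?_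
  conv_rhs => rw [← mean_const (c := c) l₂ (2 * Real.pi * |ξ| * M * (|l₁.prod| * (|c| / 3)) ^ 2)]
  refine mean_mono fun w hw => (norm_osc_sub_le _ _).trans ?_
  have h1 := hf (a + z) (by simpa using hD _ (mem_cloud_append hz (zero_mem_cloud l₂)))
    (a + (z + l₁.prod * w)) (hD _ (mem_cloud_append hz hw))
  have h2 : ξ * f (a + (z + l₁.prod * w)) - (ξ * f (a + z) + ξ * l₁.prod * g (a + z) * w)
      = ξ * (f (a + (z + l₁.prod * w)) - f (a + z)
        - g (a + z) * (a + (z + l₁.prod * w) - (a + z))) := by ring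
  rw [h2, abs_mul, mul_assoc (2 * Real.pi * |ξ|), mul_assoc (2 * Real.pi)]
  gcongr 2 * Real.pi * ?_
  gcongr |ξ| * ?_
  refine h1.trans ?_
  gcongr
  rw [show a + (z + l₁.prod * w) - (a + z) = l₁.prod * w by ring, abs_mul]
  gcongr
  exact abs_le_of_mem_cloud hl₂ hw

/-! ### Power means of products of cosines -/

theorem sum_filter_Icc_le {ι : Type*} {S : Finset ι} {w x : ι → ℝ} {D : ℝ}
    (hw : ∀ i ∈ S, 0 ≤ w i) (hD : ∀ a, ∑ i ∈ S with x i ∈ Icc a (a + 1), w i ≤ D)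
    (a : ℝ) {ℓ : ℝ} (hℓ : 0 ≤ ℓ) :
    ∑ i ∈ S with x i ∈ Icc a (a + ℓ), w i ≤ (ℓ + 1) * D := by
  classical
  have hD0 : 0 ≤ D :=
    (Finset.sum_nonneg fun i hi => hw i (Finset.mem_filter.1 hi).1).trans (hD 0)
  have key : ∀ n : ℕ, ∑ i ∈ S with x i ∈ Icc a (a + (n + 1 : ℕ)), w i ≤ (n + 1 : ℕ) * D := by
    intro n
    induction n with
    | zero => simpa using hD a
    | succ n ih =>
      have hsub : (S.filter fun i => x i ∈ Icc a (a + (n + 1 + 1 : ℕ))) ⊆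
          (S.filter fun i => x i ∈ Icc a (a + (n + 1 : ℕ))) ∪
            S.filter fun i => x i ∈ Icc (a + (n + 1 : ℕ)) (a + (n + 1 : ℕ) + 1) := by
        intro i hi
        simp only [Finset.mem_filter, Finset.mem_union, mem_Icc] at hi ⊢
        push_cast at hi ⊢
        rcases le_total (x i) (a + (n + 1)) with h | h
        · exact Or.inl ⟨hi.1, hi.2.1, h⟩
        · exact Or.inr ⟨hi.1, h, by linarith [hi.2.2]⟩
      refine (Finset.sum_le_sum_of_subset_of_nonneg hsub fun i hi _ => ?_).trans ?_
      · rcases Finset.mem_union.1 hi with h | h <;> exact hw i (Finset.mem_filter.1 h).1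
      · have hu := Finset.sum_union_inter (s₁ := S.filter fun i => x i ∈ Icc a (a + (n + 1 : ℕ)))
          (s₂ := S.filter fun i => x i ∈ Icc (a + (n + 1 : ℕ)) (a + (n + 1 : ℕ) + 1)) (f := w)
        have hn : 0 ≤ ∑ i ∈ (S.filter fun i => x i ∈ Icc a (a + (n + 1 : ℕ))) ∩
            S.filter fun i => x i ∈ Icc (a + (n + 1 : ℕ)) (a + (n + 1 : ℕ) + 1), w i :=
          Finset.sum_nonneg fun i hi =>
            hw i (Finset.mem_filter.1 (Finset.mem_inter.1 hi).1).1
        have h1 := hD (a + (n + 1 : ℕ))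
        push_cast at *
        linarith
  refine le_trans ?_ ((key ⌊ℓ⌋₊).trans ?_)
  · refine Finset.sum_le_sum_of_subset_of_nonneg (fun i hi => ?_)
      fun i hi _ => hw i (Finset.mem_filter.1 hi).1
    simp only [Finset.mem_filter, mem_Icc] at hi ⊢
    have := (Nat.lt_floor_add_one ℓ).le
    push_cast
    exact ⟨hi.1, hi.2.1, by linarith [hi.2.2]⟩
  · have := Nat.floor_le hℓ
    push_cast
    gcongr

theorem abs_cos_pi_mul_le {κ z : ℝ} (hκ : 0 ≤ κ) (h : κ < |z - round z|) :
    |Real.cos (Real.pi * z)| ≤ Real.cos (Real.pi * κ) := by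
  have hd : |z - round z| ≤ 1 / 2 := abs_sub_round z
  have h1 : |Real.cos (Real.pi * z)| = Real.cos (Real.pi * |z - round z|) := by
    have e1 : |Real.cos (Real.pi * z)| = |Real.cos (Real.pi * (z - round z))| := by
      rw [show Real.pi * (z - round z) = Real.pi * z - (round z : ℤ) * Real.pi by ring,
        Real.cos_sub_int_mul_pi]
      rcases Int.even_or_odd (round z) with he | he <;> simp [he.neg_one_zpow]
    have e2 : Real.cos (Real.pi * (z - round z)) = Real.cos (Real.pi * |z - round z|) := by
      rw [← Real.cos_abs, abs_mul, abs_of_pos Real.pi_pos]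
    rw [e1, e2, abs_of_nonneg]
    apply Real.cos_nonneg_of_mem_Icc
    constructor <;> nlinarith [Real.pi_pos, abs_nonneg (z - round z)]
  rw [h1]
  apply Real.cos_le_cos_of_nonneg_of_le_pi
  · positivity
  · nlinarith [Real.pi_pos]
  · gcongr

/-- The loss in the number of unit intervals when one rescales by a ratio `R`. -/
noncomputable def loss (c κ R : ℝ) : ℝ := (2 * |c| + 4) * (4 / |c| + 1) * (1 + κ / |R|)

theorem loss_nonneg (c : ℝ) {κ : ℝ} (hκ : 0 ≤ κ) (R : ℝ) : 0 ≤ loss c κ R := by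
  unfold loss; positivity

/-- If `R x` lies in a unit interval then `x` lies in an interval of length `1/|R|`, so mass could
grow like `1/|R|`. But the factor `|cos|^q` is at most `κ` unless `c R x` is within `κ` of an
integer. The number of candidate integers is bounded in terms of `|c|`, and each confines `x` to an
interval of length `2κ/(|c||R|)`. Hence `1/|R|` only enters multiplied by `κ`. -/
theorem sum_mul_cos_pow_le {ι : Type*} {S : Finset ι} {w x : ι → ℝ} {D c κ R : ℝ} {q : ℕ}
    (hc : c ≠ 0) (hR : R ≠ 0) (hκ : 0 < κ) (hκ1 : κ ≤ 1) (hq : |Real.cos (Real.pi * κ)| ^ q ≤ κ)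
    (hw : ∀ i ∈ S, 0 ≤ w i) (hD : ∀ a, ∑ i ∈ S with x i ∈ Icc a (a + 1), w i ≤ D) (a : ℝ) :
    ∑ i ∈ S with R * x i ∈ Icc a (a + 1), w i * |Real.cos (Real.pi * (c * (R * x i)))| ^ q
      ≤ loss c κ R * D := by
  classical
  have hD0 : 0 ≤ D :=
    (Finset.sum_nonneg fun i hi => hw i (Finset.mem_filter.1 hi).1).trans (hD 0)
  have hRp : 0 < |R| := abs_pos.2 hR
  have hcp : 0 < |c| := abs_pos.2 hc
  -- a set of bounded diameter has bounded mass
  have hdiam : ∀ (P : ι → Prop) [DecidablePred P] (ℓ : ℝ), 0 ≤ ℓ →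
      (∀ i ∈ S, ∀ j ∈ S, P i → P j → |x i - x j| ≤ ℓ) →
        ∑ i ∈ S with P i, w i ≤ (2 * ℓ + 1) * D := by
    intro P _ ℓ hℓ hP
    by_cases hex : ∃ i ∈ S, P i
    · obtain ⟨i₀, hi₀, hP₀⟩ := hex
      refine le_trans ?_ (sum_filter_Icc_le hw hD (x i₀ - ℓ) (ℓ := 2 * ℓ) (by positivity))
      refine Finset.sum_le_sum_of_subset_of_nonneg (fun i hi => ?_)
        fun i hi _ => hw i (Finset.mem_filter.1 hi).1
      obtain ⟨hiS, hPi⟩ := Finset.mem_filter.1 hi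
      have := abs_le.1 (hP i hiS i₀ hi₀ hPi hP₀)
      exact Finset.mem_filter.2 ⟨hiS, by linarith, by linarith⟩
    · push Not at hex
      rw [Finset.filter_false_of_mem hex]
      simp only [Finset.sum_empty]
      positivity
  set B : ℤ → Finset ι := fun n => S.filter fun i => |c * (R * x i) - n| ≤ κ with hB
  set Z : Finset ℤ := Finset.Icc ⌈c * a - |c| - 1⌉ ⌊c * a + |c| + 1⌋ with hZ
  have hZc : (Z.card : ℝ) ≤ 2 * |c| + 3 := by
    rw [hZ, Int.card_Icc]
    have h1 := Int.le_ceil (c * a - |c| - 1)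
    have h2 := Int.floor_le (c * a + |c| + 1)
    have h3 : ((⌊c * a + |c| + 1⌋ + 1 - ⌈c * a - |c| - 1⌉ : ℤ) : ℝ) ≤ 2 * |c| + 3 := by
      push_cast; linarith
    rcases le_total 0 (⌊c * a + |c| + 1⌋ + 1 - ⌈c * a - |c| - 1⌉) with h | h
    · calc ((Int.toNat (⌊c * a + |c| + 1⌋ + 1 - ⌈c * a - |c| - 1⌉) : ℕ) : ℝ)
          = (((Int.toNat (⌊c * a + |c| + 1⌋ + 1 - ⌈c * a - |c| - 1⌉) : ℕ) : ℤ) : ℝ) := by norm_cast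
        _ ≤ _ := by rw [Int.toNat_of_nonneg h]; exact h3
    · rw [Int.toNat_of_nonpos h]; simp; positivity
  have hfar : ∑ i ∈ S with R * x i ∈ Icc a (a + 1), κ * w i ≤ κ * ((2 / |R| + 1) * D) := by
    rw [← Finset.mul_sum]
    gcongr
    refine (hdiam _ (1 / |R|) (by positivity) fun i _ j _ hi hj => ?_).trans (by gcongr; rw [mul_one_div])
    rw [le_div_iff₀ hRp, ← abs_mul]
    rw [mem_Icc] at hi hj
    rw [abs_le]; constructor <;> linarith [hi.1, hi.2, hj.1, hj.2, mul_comm R (x i), mul_comm R (x j), sub_mul (x i) (x j) R]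
  have hnear : ∀ n ∈ Z, ∑ i ∈ B n, w i ≤ (2 * (2 * κ / (|c| * |R|)) + 1) * D := by
    intro n _
    refine hdiam _ _ (by positivity) fun i _ j _ hi hj => ?_
    rw [le_div_iff₀ (by positivity), ← abs_mul, ← abs_mul]
    have := abs_sub_le (c * (R * x i)) n (c * (R * x j))
    rw [abs_sub_comm (n : ℝ)] at this
    rw [show (x i - x j) * (c * R) = c * (R * x i) - c * (R * x j) by ring]
    linarith
  have hpt : ∀ i ∈ S.filter (fun i => R * x i ∈ Icc a (a + 1)),
      w i * |Real.cos (Real.pi * (c * (R * x i)))| ^ q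
        ≤ κ * w i + ∑ n ∈ Z, if |c * (R * x i) - n| ≤ κ then w i else 0 := by
    intro i hi
    obtain ⟨hiS, hi1, hi2⟩ := by simpa only [Finset.mem_filter, mem_Icc] using hi
    have hwi := hw i hiS
    have hsn : 0 ≤ ∑ n ∈ Z, if |c * (R * x i) - n| ≤ κ then w i else 0 :=
      Finset.sum_nonneg fun n _ => by split_ifs <;> simp [hwi]
    by_cases hcase : |c * (R * x i) - round (c * (R * x i))| ≤ κ
    · have hmem : round (c * (R * x i)) ∈ Z := by
        have h1 := abs_le.1 hcase
        have h2 : |c * (R * x i) - c * a| ≤ |c| := by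
          rw [← mul_sub, abs_mul]
          exact mul_le_of_le_one_right hcp.le (abs_le.2 ⟨by linarith, by linarith⟩)
        have h3 := abs_le.1 h2
        rw [hZ, Finset.mem_Icc, Int.ceil_le, Int.le_floor]
        constructor <;> linarith
      have h1 : w i ≤ ∑ n ∈ Z, if |c * (R * x i) - n| ≤ κ then w i else 0 := by
        refine le_trans (by simp [hcase]) (Finset.single_le_sum
          (f := fun n : ℤ => if |c * (R * x i) - n| ≤ κ then w i else 0) (fun n _ => by
            split_ifs <;> simp [hwi]) hmem)
      have h2 : |Real.cos (Real.pi * (c * (R * x i)))| ^ q ≤ 1 :=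
        pow_le_one₀ (abs_nonneg _) (Real.abs_cos_le_one _)
      nlinarith [mul_nonneg hκ.le hwi]
    · have h1 := abs_cos_pi_mul_le hκ.le (not_le.1 hcase)
      have h2 : |Real.cos (Real.pi * (c * (R * x i)))| ^ q ≤ κ :=
        (pow_le_pow_left₀ (abs_nonneg _) (h1.trans (le_abs_self _)) q).trans hq
      nlinarith [mul_le_mul_of_nonneg_left h2 hwi]
  have hswap : ∑ i ∈ S with R * x i ∈ Icc a (a + 1),
      ∑ n ∈ Z, (if |c * (R * x i) - n| ≤ κ then w i else 0) ≤ ∑ n ∈ Z, ∑ i ∈ B n, w i := by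
    rw [Finset.sum_comm]
    refine Finset.sum_le_sum fun n _ => ?_
    rw [hB, Finset.sum_filter (s := S) (p := fun i => |c * (R * x i) - n| ≤ κ)]
    refine Finset.sum_le_sum_of_subset_of_nonneg (Finset.filter_subset _ _) fun i hi _ => ?_
    split_ifs <;> simp [hw i hi]
  calc _ ≤ _ := Finset.sum_le_sum hpt
    _ = _ := Finset.sum_add_distrib
    _ ≤ κ * ((2 / |R| + 1) * D) + ∑ n ∈ Z, (2 * (2 * κ / (|c| * |R|)) + 1) * D :=
        add_le_add hfar (hswap.trans (Finset.sum_le_sum hnear))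
    _ = κ * ((2 / |R| + 1) * D) + Z.card * ((2 * (2 * κ / (|c| * |R|)) + 1) * D) := by
        rw [Finset.sum_const, nsmul_eq_mul]
    _ ≤ 1 * ((2 * (κ / |R|)) * D) + 1 * D
          + (2 * |c| + 3) * ((2 * (2 * κ / (|c| * |R|)) + 1) * D) := by
        have : κ * ((2 / |R| + 1) * D) = 1 * ((2 * (κ / |R|)) * D) + κ * D := by ring
        rw [this]; gcongr
    _ ≤ loss c κ R * D := by
        have e : 2 * (2 * κ / (|c| * |R|)) = (κ / |R|) * (4 / |c|) := by field_simp; ring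
        rw [e, loss]
        have hy : 0 ≤ κ / |R| := by positivity
        generalize κ / |R| = y at *
        have e2 : 1 * (2 * y * D) + 1 * D + (2 * |c| + 3) * ((y * (4 / |c|) + 1) * D)
          = ((2 + (2 * |c| + 3) * (4 / |c|)) * y + (2 * |c| + 4)) * D := by ring
        rw [e2]
        have e3 : |c| * (4 / |c|) = 4 := by field_simp
        have e4 : (2 * |c| + 4) * (4 / |c| + 1) = 12 + 2 * |c| + 4 * (4 / |c|) := by linarith
        have e5 : 2 + (2 * |c| + 3) * (4 / |c|) = 10 + 3 * (4 / |c|) := by linarith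
        have hv : 0 ≤ 4 / |c| := by positivity
        rw [e4, e5]
        gcongr
        nlinarith [mul_nonneg hy hv, mul_nonneg hy hcp.le]

/-- The product of the losses over the first `j` blocks of length `K`. -/
noncomputable def blockLoss (c κ : ℝ) (K : ℕ) : ℕ → List ℝ → ℝ
  | 0, _ => 1
  | j + 1, l => loss c κ (l.take K).prod * blockLoss c κ K j (l.drop K)

theorem blockLoss_nonneg (c : ℝ) {κ : ℝ} (hκ : 0 ≤ κ) (K j : ℕ) (l : List ℝ) :
    0 ≤ blockLoss c κ K j l := by
  induction j generalizing l with
  | zero => exact zero_le_one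
  | succ j ih => exact mul_nonneg (loss_nonneg c hκ _) (ih _)

/-- Weights that give mass at most `D` to unit intervals of `[-T, T]` see `cosProd` mostly
where it is small. -/
theorem sum_mul_cosProd_pow_le {c κ : ℝ} {q K : ℕ} (hc : c ≠ 0) (hκ : 0 < κ) (hκ1 : κ ≤ 1)
    (hq : |Real.cos (Real.pi * κ)| ^ q ≤ κ) (hK : 0 < K) {ι : Type*} (S : Finset ι) (j : ℕ)
    (l : List ℝ) (hl : ∀ r ∈ l, r ≠ 0) (hlen : j * K ≤ l.length) (w x : ι → ℝ) (D T : ℝ)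
    (hT : 0 ≤ T) (hw : ∀ i ∈ S, 0 ≤ w i) (hx : ∀ i ∈ S, |x i| ≤ T)
    (hD : ∀ a, ∑ i ∈ S with x i ∈ Icc a (a + 1), w i ≤ D) :
    ∑ i ∈ S, w i * cosProd c l (x i) ^ q
      ≤ D * (2 * T * |(l.take (j * K)).prod| + 1) * blockLoss c κ K j l := by
  induction j generalizing l w x D T with
  | zero =>
    have h1 := sum_filter_Icc_le hw hD (-T) (ℓ := 2 * T) (by positivity)
    rw [Finset.filter_true_of_mem fun i hi => by
      have := abs_le.1 (hx i hi); exact ⟨this.1, by linarith⟩] at h1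
    simp only [zero_mul, List.take_zero, List.prod_nil, abs_one, blockLoss, mul_one]
    rw [mul_comm D]
    refine le_trans (Finset.sum_le_sum fun i hi => ?_) h1
    exact mul_le_of_le_one_right (hw i hi)
      (pow_le_one₀ (cosProd_nonneg _ _ _) (cosProd_le_one _ _ _))
  | succ j ih =>
    have hKl : K ≤ l.length := le_trans (by nlinarith) hlen
    set R := (l.take K).prod with hRdef
    have hR : R ≠ 0 := by
      rw [hRdef]
      exact List.prod_ne_zero fun h => hl 0 (List.mem_of_mem_take h) rfl
    have hne : l.take K ≠ [] := by
      intro h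
      have := congrArg List.length h
      rw [List.length_take, min_eq_left hKl] at this
      simp at this; omega
    have hdlen : j * K ≤ (l.drop K).length := by
      rw [List.length_drop]; rw [add_mul] at hlen; omega
    -- The weights absorb the last cosine of the block and the points are rescaled by `R`; the new
    -- weights are flat with constant `loss c κ R * D`.
    have := ih (l.drop K) (fun r hr => hl r (List.mem_of_mem_drop hr)) hdlen
      (fun i => w i * |Real.cos (Real.pi * (c * (R * x i)))| ^ q) (fun i => R * x i)
      (loss c κ R * D) (|R| * T) (by positivity)
      (fun i hi => mul_nonneg (hw i hi) (by positivity))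
      (fun i hi => by rw [abs_mul]; gcongr; exact hx i hi)
      (sum_mul_cos_pow_le hc hR hκ hκ1 hq hw hD)
    have htake : l.take ((j + 1) * K) = l.take K ++ (l.drop K).take (j * K) := by
      rw [show (j + 1) * K = K + j * K by ring, List.take_add]
    rw [htake, List.prod_append, abs_mul, blockLoss, ← hRdef]
    refine le_trans (Finset.sum_le_sum fun i hi => ?_) (this.trans (le_of_eq (by ring)))
    rw [mul_assoc, ← mul_pow]
    gcongr
    · exact hw i hi
    · exact cosProd_nonneg _ _ _
    · have := cosProd_append_le c hne (l.drop K) (x i)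
      rwa [List.take_append_drop] at this

theorem abs_prod_le_pow {l : List ℝ} {ρ : ℝ} (hl : ∀ r ∈ l, |r| ≤ ρ) :
    |l.prod| ≤ ρ ^ l.length := by
  induction l with
  | nil => simp
  | cons r l ih =>
    have hr := hl r (by simp)
    rw [List.prod_cons, abs_mul, List.length_cons, pow_succ']
    exact mul_le_mul hr (ih fun b hb => hl b (by simp [hb])) (abs_nonneg _)
      ((abs_nonneg _).trans hr)

/-- Decay of an oscillating average when the products of the ratios are in a good position. -/
theorem norm_mean_osc_le {c κ : ℝ} {q K : ℕ} (hc : c ≠ 0) (hκ : 0 < κ) (hκ1 : κ ≤ 1)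
    (hq : |Real.cos (Real.pi * κ)| ^ q ≤ κ) (hq0 : q ≠ 0) (hK : 0 < K)
    {l : List ℝ} (hl : ∀ r ∈ l, r ≠ 0 ∧ |r| ≤ 1 / 4) {f g : ℝ → ℝ} {D : Set ℝ}
    {M₁ M₂ m a ξ : ℝ} (hM₁ : 0 ≤ M₁) (hM₂ : 0 ≤ M₂) (hm : 0 < m) (hξ : ξ ≠ 0)
    (hD : ∀ z ∈ cloud c l, a + z ∈ D)
    (hf : ∀ s ∈ D, ∀ s' ∈ D, |f s' - f s - g s * (s' - s)| ≤ M₂ * |s' - s| ^ 2)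
    (hg : ∀ s ∈ D, |g s| ≤ M₁) (hgm : ∀ s ∈ D, ∀ s' ∈ D, m * |s - s'| ≤ |g s - g s'|)
    {n i j : ℕ} (hin : i ≤ n) (hn : n ≤ l.length) (hjK : j * K ≤ l.length - n)
    (hgood : 3 < |c| * m * |ξ| * |(l.take i).prod| * |(l.take n).prod|)
    (hT : |ξ| * |(l.take n).prod| * |((l.drop n).take (j * K)).prod| ≤ 1)
    {B y : ℝ} (hB : blockLoss c κ K j (l.drop n) ≤ B) (hy : 0 ≤ y)
    (hyq : (1 / 2) ^ i * (2 * M₁ + 1) * B ≤ y ^ q) :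
    ‖mean c l fun z => osc (ξ * f (a + z))‖
      ≤ y + 2 * Real.pi * |ξ| * M₂ * (|(l.take n).prod| * (|c| / 3)) ^ 2 := by
  classical
  set l₁ := l.take n with hl₁
  set l₂ := l.drop n with hl₂
  have hl12 : l₁ ++ l₂ = l := List.take_append_drop n l
  have hm1 : ∀ r ∈ l₁, r ≠ 0 ∧ |r| ≤ 1 / 4 := fun r hr => hl r (List.mem_of_mem_take hr)
  have hm2 : ∀ r ∈ l₂, r ≠ 0 ∧ |r| ≤ 1 / 4 := fun r hr => hl r (List.mem_of_mem_drop hr)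
  have hlin := norm_mean_osc_append_le (c := c) (l₁ := l₁) (l₂ := l₂) (fun r hr => (hm2 r hr).2)
    (f := f) (g := g) (D := D) (M := M₂) (a := a) (ξ := ξ) hM₂ (by rwa [hl12]) hf
  rw [hl12] at hlin
  refine hlin.trans (add_le_add ?_ le_rfl)
  have hR1 : l₁.prod ≠ 0 := List.prod_ne_zero fun h => (hm1 0 h).1 rfl
  have hDz : ∀ z ∈ cloud c l₁, a + z ∈ D := fun z hz => by
    have := hD (z + l₁.prod * 0) (by rw [← hl12]; exact mem_cloud_append hz (zero_mem_cloud l₂))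
    simpa using this
  set W : ℝ := ((2 : ℝ) ^ l₁.length)⁻¹ with hW
  have hW0 : 0 ≤ W := by positivity
  set P : Fin (cloud c l₁).length → ℝ := fun k => (cloud c l₁)[k] with hP
  have hPm : ∀ k, P k ∈ cloud c l₁ := fun k => List.getElem_mem _
  set x : Fin (cloud c l₁).length → ℝ := fun k => ξ * l₁.prod * g (a + P k) with hx
  set T : ℝ := |ξ| * |l₁.prod| * M₁ with hTdef
  -- Flatness of the frequencies: `hgm` turns a unit interval of frequencies into a set of points of
  -- diameter at most `1 / (|ξ| |l₁.prod| m)`, which by `hgood` is below the separation of the cloud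
  -- at level `i`.
  have hmass : ∀ b, ∑ k ∈ Finset.univ with x k ∈ Icc b (b + 1), W ≤ (1 / 2 : ℝ) ^ i := by
    intro b
    have hlen1 : l₁.length = n := by rw [hl₁, List.length_take, min_eq_left hn]
    set s : Set ℝ := {z | a + z ∈ D ∧ ξ * l₁.prod * g (a + z) ∈ Icc b (b + 1)} with hs
    have hdi : ∀ z ∈ s, ∀ z' ∈ s, |z - z'| < |c| * |(l₁.take i).prod| / 3 := by
      intro z hz z' hz'
      have h1 := hgm _ hz.1 _ hz'.1
      rw [show a + z - (a + z') = z - z' by ring] at h1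
      have h2 : |ξ| * |l₁.prod| * |g (a + z) - g (a + z')| ≤ 1 := by
        rw [← abs_mul, ← abs_mul, mul_sub, abs_le]
        constructor <;> linarith [hz.2.1, hz.2.2, hz'.2.1, hz'.2.2]
      have htt : l₁.take i = l.take i := by rw [hl₁, List.take_take, min_eq_left hin]
      rw [htt]
      have hpos : 0 < |ξ| * |l₁.prod| := mul_pos (abs_pos.2 hξ) (abs_pos.2 hR1)
      have h3 : (|ξ| * |l₁.prod| * m) * |z - z'| ≤ 1 := by
        refine le_trans ?_ h2
        rw [mul_assoc]; gcongr
      have h4 : 1 < (|ξ| * |l₁.prod| * m) * (|c| * |(l.take i).prod| / 3) := by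
        linarith
      exact lt_of_mul_lt_mul_left (h3.trans_lt h4) (by positivity)
    have := mean_indicator_le (c := c) hm1 (i := i) (by rw [hlen1]; exact hin) s hdi
    rw [mean_eq_sum] at this
    refine le_trans (le_of_eq ?_) this
    rw [Finset.sum_filter]
    refine Finset.sum_congr rfl fun k _ => ?_
    have hk := hDz _ (hPm k)
    by_cases hk2 : x k ∈ Icc b (b + 1)
    · have : P k ∈ s := ⟨hk, hk2⟩
      rw [if_pos hk2]
      change W = W * s.indicator _ (P k)
      rw [indicator_of_mem this, mul_one]
    · have : P k ∉ s := fun h => hk2 h.2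
      rw [if_neg hk2]
      change 0 = W * s.indicator _ (P k)
      rw [indicator_of_notMem this, mul_zero]
  have hflat := sum_mul_cosProd_pow_le hc hκ hκ1 hq hK Finset.univ j l₂ (fun r hr => (hm2 r hr).1)
    (by rw [hl₂, List.length_drop]; exact hjK) (fun _ => W) x ((1 / 2) ^ i) T (by positivity)
    (fun _ _ => hW0) (fun k _ => by
      rw [hx, hTdef]; simp only [abs_mul]; gcongr; exact hg _ (hDz _ (hPm k))) hmass
  have hone : ∑ _k : Fin (cloud c l₁).length, W = 1 := by
    have := mean_eq_sum (c := c) l₁ fun _ => 1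
    rw [mean_const] at this
    simpa using this.symm
  rw [mean_eq_sum]
  -- Flatness controls the mean of the `q`-th power of `cosProd`; Jensen's inequality brings it back
  -- to the mean itself, at the price of a `q`-th root.
  have hjen := Real.pow_arith_mean_le_arith_mean_pow Finset.univ (fun _ => W)
    (fun k => cosProd c l₂ (x k)) (fun _ _ => hW0) hone (fun _ _ => cosProd_nonneg _ _ _) q
  refine le_of_pow_le_pow_left₀ hq0 hy (hjen.trans (hflat.trans (le_trans ?_ hyq)))
  have hB0 := blockLoss_nonneg c hκ.le K j l₂
  have hT1 : 2 * T * |(l₂.take (j * K)).prod| + 1 ≤ 2 * M₁ + 1 := by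
    have := mul_le_mul_of_nonneg_left hT hM₁
    rw [hTdef]; linarith
  gcongr

/-! ### Expectations over independent letters -/

section listMean

variable {B : Type*} {p : B → ℝ≥0∞}

/-- The expectation of a function of `n` independent letters with law `p`. -/
noncomputable def listMean (p : B → ℝ≥0∞) : ℕ → (List B → ℝ≥0∞) → ℝ≥0∞
  | 0, F => F []
  | n + 1, F => ∑' b, p b * listMean p n fun l => F (b :: l)

theorem listMean_mono {n : ℕ} {F G : List B → ℝ≥0∞} (h : ∀ l, l.length = n → F l ≤ G l) :
    listMean p n F ≤ listMean p n G := by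
  induction n generalizing F G with
  | zero => exact h [] rfl
  | succ n ih =>
    refine ENNReal.tsum_le_tsum fun b => ?_
    gcongr
    exact ih fun l hl => h _ (by simp [hl])

theorem listMean_add (n : ℕ) (F G : List B → ℝ≥0∞) :
    listMean p n (fun l => F l + G l) = listMean p n F + listMean p n G := by
  induction n generalizing F G with
  | zero => rfl
  | succ n ih => simp only [listMean, ih, mul_add, ENNReal.tsum_add]

theorem listMean_const_mul (n : ℕ) (a : ℝ≥0∞) (F : List B → ℝ≥0∞) :
    listMean p n (fun l => a * F l) = a * listMean p n F := by
  induction n generalizing F with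
  | zero => rfl
  | succ n ih => simp only [listMean, ih, mul_left_comm _ a, ENNReal.tsum_mul_left]

theorem listMean_const_le (hp : ∑' b, p b ≤ 1) (n : ℕ) (a : ℝ≥0∞) :
    listMean p n (fun _ => a) ≤ a := by
  induction n with
  | zero => exact le_rfl
  | succ n ih =>
    calc _ ≤ ∑' b, p b * a := ENNReal.tsum_le_tsum fun b => by gcongr
      _ = (∑' b, p b) * a := ENNReal.tsum_mul_right
      _ ≤ 1 * a := by gcongr
      _ = a := one_mul a

theorem listMean_sum {ι : Type*} (n : ℕ) (s : Finset ι) (F : ι → List B → ℝ≥0∞) :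
    listMean p n (fun l => ∑ i ∈ s, F i l) = ∑ i ∈ s, listMean p n (F i) := by
  classical
  induction s using Finset.induction_on with
  | empty => simpa using listMean_const_mul (p := p) n 0 fun _ => 0
  | insert i s hi ih => simp only [Finset.sum_insert hi, listMean_add, ih]

/-- Independence of disjoint groups of letters. -/
theorem listMean_mul_take_drop (a b : ℕ) (F G : List B → ℝ≥0∞) :
    listMean p (a + b) (fun l => F (l.take a) * G (l.drop a)) = listMean p a F * listMean p b G := by
  induction a generalizing F with
  | zero => simp [listMean, listMean_const_mul]
  | succ a ih =>
    rw [show a + 1 + b = (a + b) + 1 by ring]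
    have h := fun c => ih fun l => F (c :: l)
    simp only [listMean, List.take_succ_cons, List.drop_succ_cons, h, ← mul_assoc,
      ENNReal.tsum_mul_right]

theorem listMean_prod_map (v : B → ℝ≥0∞) (n : ℕ) :
    listMean p n (fun l => (l.map v).prod) = (∑' b, p b * v b) ^ n := by
  induction n with
  | zero => simp [listMean]
  | succ n ih =>
    simp only [listMean, List.map_cons, List.prod_cons, listMean_const_mul, ih, ← mul_assoc,
      ENNReal.tsum_mul_right, pow_succ']

theorem listMean_sum_map_le (hp : ∑' b, p b ≤ 1) (v : B → ℝ≥0∞) (n : ℕ) :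
    listMean p n (fun l => (l.map v).sum) ≤ n * ∑' b, p b * v b := by
  induction n with
  | zero => simp [listMean]
  | succ n ih =>
    simp only [listMean, List.map_cons, List.sum_cons, listMean_add, mul_add, ENNReal.tsum_add]
    calc _ ≤ ∑' b, p b * v b + ∑' b, p b * (n * ∑' b, p b * v b) :=
          add_le_add (ENNReal.tsum_le_tsum fun b => by gcongr; exact listMean_const_le hp _ _)
            (ENNReal.tsum_le_tsum fun b => by gcongr)
      _ ≤ ∑' b, p b * v b + 1 * (n * ∑' b, p b * v b) := by
          rw [ENNReal.tsum_mul_right]; gcongr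
      _ = _ := by push_cast; ring

theorem listMean_take_le (hp : ∑' b, p b ≤ 1) {a n : ℕ} (h : a ≤ n) (F : List B → ℝ≥0∞) :
    listMean p n (fun l => F (l.take a)) ≤ listMean p a F := by
  obtain ⟨b, rfl⟩ := Nat.exists_eq_add_of_le h
  have := listMean_mul_take_drop (p := p) a b F fun _ => 1
  simp only [mul_one] at this
  rw [this]
  exact mul_le_of_le_one_right' (listMean_const_le hp _ _)

theorem listMean_drop_le (hp : ∑' b, p b ≤ 1) {a n : ℕ} (h : a ≤ n) (F : List B → ℝ≥0∞) :
    listMean p n (fun l => F (l.drop a)) ≤ listMean p (n - a) F := by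
  obtain ⟨b, rfl⟩ := Nat.exists_eq_add_of_le h
  have := listMean_mul_take_drop (p := p) a b (fun _ => 1) F
  simp only [one_mul] at this
  rw [this, Nat.add_sub_cancel_left]
  exact mul_le_of_le_one_left' (listMean_const_le hp _ _)

/-- A multiplicative majorant of powers of `blockLoss`. -/
noncomputable def blockBound (C δ : ℝ≥0∞) (v : B → ℝ≥0∞) (K : ℕ) : ℕ → List B → ℝ≥0∞
  | 0, _ => 1
  | j + 1, l => C * (1 + δ * ((l.take K).map v).prod) * blockBound C δ v K j (l.drop K)

/-- The blocks are independent, and `hδ` makes the mean of each factor at most `C (1 + 1)`. -/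
theorem listMean_blockBound_le (hp : ∑' b, p b ≤ 1) {C δ : ℝ≥0∞} {v : B → ℝ≥0∞} {K : ℕ}
    (hδ : δ * (∑' b, p b * v b) ^ K ≤ 1) (j : ℕ) {n : ℕ} (h : j * K ≤ n) :
    listMean p n (blockBound C δ v K j) ≤ (2 * C) ^ j := by
  induction j generalizing n with
  | zero => simpa [blockBound] using listMean_const_le hp n 1
  | succ j ih =>
    obtain ⟨b, rfl⟩ := Nat.exists_eq_add_of_le (show K ≤ n from le_trans (by nlinarith) h)
    have := listMean_mul_take_drop (p := p) K b
      (fun l => C * (1 + δ * (l.map v).prod)) (blockBound C δ v K j)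
    simp only [blockBound]
    rw [this, pow_succ']
    gcongr
    · rw [listMean_const_mul, listMean_add, listMean_const_mul, listMean_prod_map, mul_comm 2 C]
      gcongr
      rw [← one_add_one_eq_two]
      exact add_le_add (listMean_const_le hp _ _) hδ
    · exact ih (by rw [add_mul] at h; omega)

end listMean

/-! ### Moments of the rescaling losses -/

section moments

variable {B : Type*} {r : B → ℝ} {θ : ℝ}

theorem prod_map_rpow (r : B → ℝ) (s : ℝ) (l : List B) :
    (l.map fun b => ENNReal.ofReal (|r b| ^ s)).prod = ENNReal.ofReal (|(l.map r).prod| ^ s) := by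
  induction l with
  | nil => simp
  | cons b l ih =>
    simp only [List.map_cons, List.prod_cons, ih, abs_mul]
    rw [Real.mul_rpow (abs_nonneg _) (abs_nonneg _), ENNReal.ofReal_mul (by positivity)]

/-- Raising to the power `θ ≤ 1` is subadditive, which splits `(1 + κ/|R|)^θ`. Since `|R| ≤ 1`, the
exponent `-θ` may be worsened to `-2θ`, so that a single moment serves throughout. -/
theorem rpow_blockLoss_le {c κ : ℝ} (hκ : 0 < κ) (hθ : 0 < θ) (hθ1 : θ ≤ 1)
    (hr : ∀ b, r b ≠ 0 ∧ |r b| ≤ 1 / 4) (K j : ℕ) (l : List B) :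
    ENNReal.ofReal (blockLoss c κ K j (l.map r) ^ θ) ≤
      blockBound (ENNReal.ofReal ((2 * |c| + 4) * (4 / |c| + 1))) (ENNReal.ofReal (κ ^ θ))
        (fun b => ENNReal.ofReal (|r b| ^ (-(2 * θ)))) K j l := by
  induction j generalizing l with
  | zero => simp [blockLoss, blockBound]
  | succ j ih =>
    rw [blockLoss, blockBound, Real.mul_rpow (loss_nonneg c hκ.le _) (blockLoss_nonneg c hκ.le _ _ _),
      ENNReal.ofReal_mul (Real.rpow_nonneg (loss_nonneg c hκ.le _) _), ← List.map_drop,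
      ← List.map_take]
    refine mul_le_mul' ?_ (ih _)
    rw [prod_map_rpow]
    set R := ((l.take K).map r).prod with hR
    have hR0 : R ≠ 0 := List.prod_ne_zero fun h => by
      obtain ⟨b, -, hb⟩ := List.mem_map.1 h; exact (hr b).1 hb
    have hR1 : |R| ≤ 1 := by
      refine (abs_prod_le_pow (ρ := 1) fun x hx => ?_).trans (by simp)
      obtain ⟨b, -, rfl⟩ := List.mem_map.1 hx
      exact (hr b).2.trans (by norm_num)
    have hRp := abs_pos.2 hR0
    rw [← ENNReal.ofReal_mul (by positivity), ← ENNReal.ofReal_one,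
      ← ENNReal.ofReal_add zero_le_one (by positivity), ← ENNReal.ofReal_mul (by positivity)]
    refine ENNReal.ofReal_le_ofReal ?_
    have hC : 1 ≤ (2 * |c| + 4) * (4 / |c| + 1) := by
      have : 0 ≤ 4 / |c| := by positivity
      nlinarith [abs_nonneg c]
    rw [loss, Real.mul_rpow (by positivity) (by positivity)]
    refine mul_le_mul ?_ ?_ (by positivity) (by positivity)
    · exact (Real.rpow_le_rpow_of_exponent_le hC hθ1).trans (Real.rpow_one _).le
    · refine (Real.rpow_add_le_add_rpow zero_le_one (by positivity) hθ.le hθ1).trans ?_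
      rw [Real.one_rpow, Real.div_rpow hκ.le hRp.le, div_eq_mul_inv, ← Real.rpow_neg hRp.le]
      gcongr _ + _ * ?_
      exact Real.rpow_le_rpow_of_exponent_ge hRp hR1 (by linarith)

end moments

/-! ### Systems of random pairs of maps with equal ratios -/

/-- A random system of pairs of maps `map b false`, `map b true` that act in the same way on the
base, and in the fibre by affine maps of the same ratio whose translations differ by `c` times
the ratio; every integral is bounded by the mean of the integrals along the pairs. -/
structure PairSystem {X Y : Type*} [MeasurableSpace X] (μ : Measure X) (π : X → Y) (h : X → ℝ)
    (c : ℝ) (B : Type*) where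
  map : B → Bool → X → X
  base : B → Y → Y
  ratio : B → ℝ
  trans : B → ℝ
  weight : B → ℝ≥0∞
  measurable_map : ∀ b e, Measurable (map b e)
  proj_map : ∀ b e x, π (map b e x) = base b (π x)
  height_false : ∀ b x, h (map b false x) = ratio b * h x + trans b
  height_true : ∀ b x, h (map b true x) = ratio b * h x + trans b + ratio b * c
  ratio_bound : ∀ b, ratio b ≠ 0 ∧ |ratio b| ≤ 1 / 4
  tsum_weight_le : ∑' b, weight b ≤ 1
  enorm_integral_le : ∀ H : X → ℂ, Measurable H → (∀ x, ‖H x‖ ≤ 1) → ‖∫ x, H x ∂μ‖ₑ ≤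
    ∑' b, weight b * ‖∫ x, (1 / 2 : ℝ) • (H (map b false x) + H (map b true x)) ∂μ‖ₑ

/-- `g` behaves on `[0,1]` like the derivative of a function `f` with `m ≤ |f''| ≤ M₂`
and `|f'| ≤ M₁`. -/
structure FibreRegular (f g : ℝ → ℝ) (M₁ M₂ m : ℝ) : Prop where
  abs_le : ∀ s ∈ Icc (0 : ℝ) 1, |g s| ≤ M₁
  remainder_le : ∀ s ∈ Icc (0 : ℝ) 1, ∀ s' ∈ Icc (0 : ℝ) 1,
    |f s' - f s - g s * (s' - s)| ≤ M₂ * |s' - s| ^ 2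
  le_abs_sub : ∀ s ∈ Icc (0 : ℝ) 1, ∀ s' ∈ Icc (0 : ℝ) 1, m * |s - s'| ≤ |g s - g s'|

namespace PairSystem

variable {X Y : Type*} [MeasurableSpace X] {μ : Measure X} {π : X → Y} {h : X → ℝ} {c : ℝ}
  {B : Type*} (S : PairSystem μ π h c B)

/-- The average of `H` over all choices of one map from each pair of a word. -/
noncomputable def avg : List B → (X → ℂ) → X → ℂ
  | [], H => H
  | b :: l, H => avg l fun x => (1 / 2 : ℝ) • (H (S.map b false x) + H (S.map b true x))

theorem measurable_avgStep (b : B) {H : X → ℂ} (hH : Measurable H) :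
    Measurable fun x => (1 / 2 : ℝ) • (H (S.map b false x) + H (S.map b true x)) :=
  ((hH.comp (S.measurable_map b false)).add (hH.comp (S.measurable_map b true))).const_smul (1 / 2 : ℝ)

theorem norm_avgStep_le (b : B) {H : X → ℂ} (hH : ∀ x, ‖H x‖ ≤ 1) (x : X) :
    ‖(1 / 2 : ℝ) • (H (S.map b false x) + H (S.map b true x))‖ ≤ 1 := by
  rw [norm_smul]
  have := (norm_add_le _ _).trans (add_le_add (hH (S.map b false x)) (hH (S.map b true x)))
  norm_num at this ⊢
  linarith

theorem enorm_integral_le_listMean (n : ℕ) {H : X → ℂ} (hm : Measurable H)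
    (hH : ∀ x, ‖H x‖ ≤ 1) :
    ‖∫ x, H x ∂μ‖ₑ ≤ listMean S.weight n fun l => ‖∫ x, S.avg l H x ∂μ‖ₑ := by
  induction n generalizing H with
  | zero => exact le_rfl
  | succ n ih =>
    refine (S.enorm_integral_le H hm hH).trans (ENNReal.tsum_le_tsum fun b => ?_)
    gcongr
    exact ih (S.measurable_avgStep b hm) (S.norm_avgStep_le b hH)

/-- Both maps of a pair act identically on the base, so all choices along a word lead to the same
base point `y`: the average is over a cloud in one fibre. The points `a + z` are actual heights,
hence stay in the range of `h`. -/
theorem exists_avg_eq_mean (l : List B) (x : X) :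
    ∃ (y : Y) (a : ℝ), (∀ k : Y → ℝ → ℂ, S.avg l (fun x => k (π x) (h x)) x
        = mean c (l.map S.ratio) fun z => k y (a + z)) ∧
      ∀ z ∈ cloud c (l.map S.ratio), ∃ x', h x' = a + z := by
  induction l with
  | nil => exact ⟨π x, h x, fun k => by simp [avg], fun z hz => ⟨x, by simp_all [cloud]⟩⟩
  | cons b l ih =>
    obtain ⟨y, a, hk, hz⟩ := ih
    refine ⟨S.base b y, S.ratio b * a + S.trans b, fun k => ?_, fun z hz' => ?_⟩
    · have := hk fun y s => (1 / 2 : ℝ) • (k (S.base b y) (S.ratio b * s + S.trans b)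
        + k (S.base b y) (S.ratio b * s + S.trans b + S.ratio b * c))
      simp only [avg, S.proj_map, S.height_false, S.height_true]
      rw [this, List.map_cons, mean_cons, ← mean_add, mean_smul]
      congr 2
      funext z
      congr 2 <;> ring
    · simp only [List.map_cons, cloud, List.mem_append, List.mem_map] at hz'
      rcases hz' with ⟨w, hw, rfl⟩ | ⟨w, hw, rfl⟩
      · obtain ⟨x', hx'⟩ := hz w hw
        exact ⟨S.map b false x', by rw [S.height_false, hx']; ring⟩
      · obtain ⟨x', hx'⟩ := hz w hw
        exact ⟨S.map b true x', by rw [S.height_true, hx']; ring⟩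

end PairSystem

theorem abs_prod_take_le {l : List ℝ} (hl : ∀ r ∈ l, |r| ≤ 1) {i j : ℕ} (hij : i ≤ j) :
    |(l.take j).prod| ≤ |(l.take i).prod| := by
  obtain ⟨k, rfl⟩ := Nat.exists_eq_add_of_le hij
  rw [List.take_add, List.prod_append, abs_mul]
  refine mul_le_of_le_one_right (abs_nonneg _) ((abs_prod_le_pow (ρ := 1) fun r hr => ?_).trans
    (by simp))
  exact hl r (List.mem_of_mem_drop (List.mem_of_mem_take hr))

/-- The bound for a word of letters: a main term, and three terms that are large only for
exceptional words. -/
theorem enorm_mean_osc_le {B : Type*} {r : B → ℝ} (hr : ∀ b, r b ≠ 0 ∧ |r b| ≤ 1 / 4)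
    {c κ θ β h₀ y : ℝ} {q K i : ℕ} (hc : c ≠ 0) (hκ : 0 < κ) (hκ1 : κ ≤ 1)
    (hq : |Real.cos (Real.pi * κ)| ^ q ≤ κ) (hq0 : q ≠ 0) (hK : 0 < K)
    (hθ : 0 < θ) (hθ1 : θ ≤ 1) (hβ : 0 < β) (hβ2 : β ^ 2 = 1 / 2) (hh₀ : 0 < h₀)
    {M₁ M₂ m a ξ : ℝ} (hM₁ : 0 ≤ M₁) (hM₂ : 0 ≤ M₂) (hm : 0 < m) (hξ : ξ ≠ 0)
    {f g : ℝ → ℝ} (hfg : FibreRegular f g M₁ M₂ m) {l : List B}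
    (hD : ∀ z ∈ cloud c (l.map r), a + z ∈ Icc (0 : ℝ) 1)
    (hlen : (1 / 4 : ℝ) ^ l.length ≤ h₀)
    (hlenK : |ξ| * (1 / 4 : ℝ) ^ (l.length - K) ≤ 1)
    (hy : 0 ≤ y) (hyq : (2 * M₁ + 1) * β ^ i ≤ y ^ q) :
    ‖mean c (l.map r) fun z => osc (ξ * f (a + z))‖ₑ ≤
      ENNReal.ofReal (y + 2 * Real.pi * |ξ| * M₂ * (h₀ * (|c| / 3)) ^ 2)
      + ENNReal.ofReal (h₀ ^ (2 * θ))
          * ((l.take i).map fun b => ENNReal.ofReal (|r b| ^ (-(2 * θ)))).prod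
      + ENNReal.ofReal ((3 / (|c| * m * |ξ| * h₀)) ^ θ)
          * (((l.take i).map fun b => ENNReal.ofReal (|r b| ^ (-(2 * θ)))).prod
            + (l.map fun b => ENNReal.ofReal (|r b| ^ (-(2 * θ)))).sum)
      + ∑ n ∈ Finset.range (l.length + 1), ENNReal.ofReal ((β ^ i) ^ θ)
          * blockBound (ENNReal.ofReal ((2 * |c| + 4) * (4 / |c| + 1))) (ENNReal.ofReal (κ ^ θ))
            (fun b => ENNReal.ofReal (|r b| ^ (-(2 * θ)))) K ((l.length - n) / K) (l.drop n) := by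
  set N := l.length with hN
  set rl := l.map r with hrl
  have hrlen : rl.length = N := by simp [hrl, hN]
  have hrl4 : ∀ x ∈ rl, x ≠ 0 ∧ |x| ≤ 1 / 4 := fun x hx => by
    obtain ⟨b, -, rfl⟩ := List.mem_map.1 hx; exact hr b
  have hrl1 : ∀ x ∈ rl, |x| ≤ 1 := fun x hx => (hrl4 x hx).2.trans (by norm_num)
  have hprod0 : ∀ k, 0 < |(rl.take k).prod| := fun k => abs_pos.2 <|
    List.prod_ne_zero fun h => (hrl4 0 (List.mem_of_mem_take h)).1 rfl
  have htriv : ‖mean c rl fun z => osc (ξ * f (a + z))‖ₑ ≤ 1 := by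
    rw [← ofReal_norm, ← ENNReal.ofReal_one]
    refine ENNReal.ofReal_le_ofReal ((norm_mean_le _ _).trans ?_)
    simp only [norm_osc, mean_const, le_refl]
  have hV : ((l.take i).map fun b => ENNReal.ofReal (|r b| ^ (-(2 * θ)))).prod
      = ENNReal.ofReal (|(rl.take i).prod| ^ (-(2 * θ))) := by
    rw [prod_map_rpow, List.map_take]
  rw [hV]
  -- First exceptional event: the first `i` letters already exhaust the scale. As in the two cases
  -- below, the trivial bound `1` is dominated by a positive power of a ratio that is at least `1`
  -- (Markov).
  by_cases hA : |(rl.take i).prod| ≤ h₀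
  · refine htriv.trans (le_trans ?_ (le_add_right (le_add_right le_add_self)))
    rw [← ENNReal.ofReal_mul (by positivity), ← ENNReal.ofReal_one]
    refine ENNReal.ofReal_le_ofReal ?_
    rw [Real.rpow_neg (abs_nonneg _), ← div_eq_mul_inv, ← Real.div_rpow hh₀.le (abs_nonneg _)]
    exact Real.one_le_rpow ((one_le_div (hprod0 i)).2 hA) (by positivity)
  push Not at hA
  have hex : ∃ n, |(rl.take n).prod| ≤ h₀ := ⟨N, by
    refine le_trans ?_ hlen
    rw [← hrlen, List.take_length]
    exact abs_prod_le_pow fun x hx => (hrl4 x hx).2⟩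
  classical
  -- Stopping index. One letter earlier the product still exceeds `h₀`, so the overshoot is
  -- controlled by the single ratio `r l[n']`.
  set n := Nat.find hex with hn
  have hnh : |(rl.take n).prod| ≤ h₀ := Nat.find_spec hex
  have hnN : n ≤ N := Nat.find_min' hex <| by
    refine le_trans ?_ hlen
    rw [← hrlen, List.take_length]
    exact abs_prod_le_pow fun x hx => (hrl4 x hx).2
  have hin : i < n := by
    by_contra hcon
    exact absurd ((abs_prod_take_le hrl1 (not_lt.1 hcon)).trans hnh) (not_le.2 hA)
  obtain ⟨n', hn'⟩ : ∃ n', n = n' + 1 := ⟨n - 1, by omega⟩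
  have hn'h : h₀ < |(rl.take n').prod| := not_le.1 (Nat.find_min hex (m := n') (by omega))
  have hn'l : n' < l.length := by omega
  have hstep : (rl.take n).prod = (rl.take n').prod * r l[n'] := by
    rw [hn', List.take_succ_eq_append_getElem (by omega), List.prod_append]
    simp [hrl]
  by_cases hgood : 3 < |c| * m * |ξ| * |(rl.take i).prod| * |(rl.take n).prod|
  swap
  · push Not at hgood
    refine htriv.trans (le_trans ?_ (le_add_right le_add_self))
    -- The position `n'` depends on the word, hence the sum over all letters.
    have hsum : ENNReal.ofReal (|r l[n']| ^ (-(2 * θ)))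
        ≤ (l.map fun b => ENNReal.ofReal (|r b| ^ (-(2 * θ)))).sum :=
      List.single_le_sum (fun _ _ => zero_le) _ (List.mem_map.2 ⟨l[n'], List.getElem_mem _, rfl⟩)
    refine le_trans ?_ (mul_le_mul_right (add_le_add_right hsum _) _)
    rw [← ENNReal.ofReal_add (by positivity) (by positivity),
      ← ENNReal.ofReal_mul (by positivity), ← ENNReal.ofReal_one]
    refine ENNReal.ofReal_le_ofReal ?_
    set u := |(rl.take i).prod|
    have hu : 0 < u := hprod0 i
    have hv : 0 < |r l[n']| := abs_pos.2 (hr _).1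
    set v := |r l[n']|
    -- Decouples the two possibly dependent factors, which is why moments of order `2θ` are needed.
    have huv : u ^ (-θ) * v ^ (-θ) ≤ u ^ (-(2 * θ)) + v ^ (-(2 * θ)) := by
      have e : ∀ w : ℝ, 0 < w → w ^ (-(2 * θ)) = (w ^ (-θ)) ^ 2 := fun w hw => by
        rw [← Real.rpow_natCast, ← Real.rpow_mul hw.le]; congr 1; push_cast; ring
      rw [e u hu, e v hv]
      nlinarith [sq_nonneg (u ^ (-θ) - v ^ (-θ)), sq_nonneg (u ^ (-θ)), sq_nonneg (v ^ (-θ))]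
    refine le_trans ?_ (mul_le_mul_of_nonneg_left huv (by positivity))
    have hcp := abs_pos.2 hc
    have hξp := abs_pos.2 hξ
    rw [← Real.mul_rpow hu.le hv.le, Real.rpow_neg (by positivity), ← div_eq_mul_inv,
      ← Real.div_rpow (by positivity) (by positivity)]
    refine Real.one_le_rpow ?_ hθ.le
    rw [div_div, one_le_div (by positivity)]
    refine le_trans ?_ hgood
    rw [hstep, abs_mul]
    calc |c| * m * |ξ| * h₀ * (u * v) = |c| * m * |ξ| * u * (h₀ * v) := by ring
      _ ≤ _ := by gcongr
  -- Only whole blocks after the stopping index are used; fewer than `K` letters are left over,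
  -- which is the reason for `l.length - K` in `hlenK`.
  set j := (N - n) / K with hj
  -- Half of the gain `2⁻ⁱ = β^(2i)` is reserved for the loss. The stopping index varies with the
  -- word, so the failure is bounded by a sum over all `n`.
  by_cases hloss : blockLoss c κ K j (rl.drop n) ≤ (β⁻¹) ^ i
  swap
  · push Not at hloss
    refine htriv.trans (le_trans ?_ le_add_self)
    refine le_trans ?_ (Finset.single_le_sum (fun _ _ => zero_le)
      (Finset.mem_range.2 (Nat.lt_succ_of_le hnN)))
    have hb := rpow_blockLoss_le (c := c) hκ hθ hθ1 hr K j (l.drop n)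
    refine le_trans ?_ (mul_le_mul_right hb _)
    rw [← ENNReal.ofReal_mul (by positivity), ← ENNReal.ofReal_one, List.map_drop]
    refine ENNReal.ofReal_le_ofReal ?_
    have hb0 := blockLoss_nonneg c hκ.le K j (rl.drop n)
    rw [← Real.mul_rpow (by positivity) hb0]
    refine Real.one_le_rpow ?_ hθ.le
    have : β ^ i * β⁻¹ ^ i = 1 := by rw [← mul_pow, mul_inv_cancel₀ hβ.ne', one_pow]
    rw [← this]
    gcongr
  refine le_trans ?_ (le_add_right (le_add_right le_self_add))
  rw [← ofReal_norm]
  refine ENNReal.ofReal_le_ofReal ?_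
  have hjK : j * K ≤ N - n := Nat.div_mul_le_self _ _
  refine (norm_mean_osc_le hc hκ hκ1 hq hq0 hK hrl4 hM₁ hM₂ hm hξ hD hfg.remainder_le hfg.abs_le
    hfg.le_abs_sub hin.le (by omega) (j := j) (by omega) hgood ?_ hloss hy ?_).trans ?_
  · rw [mul_assoc, ← abs_mul, ← List.prod_append, ← List.take_add]
    refine le_trans ?_ hlenK
    gcongr
    refine (abs_prod_le_pow fun x hx => (hrl4 x (List.mem_of_mem_take hx)).2).trans ?_
    refine pow_le_pow_of_le_one (by norm_num) (by norm_num) ?_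
    rw [List.length_take, hrlen]
    have := Nat.lt_div_mul_add (a := N - n) hK
    rw [← hj] at this
    omega
  · refine le_trans (le_of_eq ?_) hyq
    have : (1 / 2 : ℝ) ^ i * β⁻¹ ^ i = β ^ i := by
      rw [← mul_pow, ← hβ2]; congr 1; field_simp
    rw [← this]; ring
  · gcongr

/-! ### The error terms at the scales `|ξ| ≈ P^(8i)` and `h₀ = P^(-5i)` -/

section scales

variable {P t x V θ : ℝ}

/-- Here `|ξ| h₀²` is of order `P^(8i - 10i) = P^(-2i)`. -/
theorem linearisation_term_le {c ξ M₂ : ℝ} (i : ℕ) (hP : 0 < P) (hM₂ : 0 ≤ M₂)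
    (hξ : |ξ| ≤ P ^ (8 * i) * P ^ 8) (hx : P⁻¹ ^ 2 ≤ x) :
    2 * Real.pi * |ξ| * M₂ * (P⁻¹ ^ (5 * i) * (|c| / 3)) ^ 2
      ≤ 2 * Real.pi * (|c| / 3) ^ 2 * P ^ 8 * M₂ * x ^ i := by
  have e1 : |ξ| * (P⁻¹ ^ (5 * i)) ^ 2 ≤ P ^ 8 * x ^ i := by
    calc _ ≤ (P ^ (8 * i) * P ^ 8) * (P⁻¹ ^ (5 * i)) ^ 2 := by
          exact mul_le_mul_of_nonneg_right hξ (by positivity)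
      _ = P ^ 8 * ((P ^ (8 * i) * P⁻¹ ^ (8 * i)) * P⁻¹ ^ (2 * i)) := by ring
      _ = P ^ 8 * (P⁻¹ ^ 2) ^ i := by
          rw [← mul_pow, mul_inv_cancel₀ hP.ne', one_pow, one_mul, pow_mul]
      _ ≤ _ := by gcongr
  calc _ = 2 * Real.pi * (|c| / 3) ^ 2 * M₂ * (|ξ| * (P⁻¹ ^ (5 * i)) ^ 2) := by ring
    _ ≤ 2 * Real.pi * (|c| / 3) ^ 2 * M₂ * (P ^ 8 * x ^ i) :=
        mul_le_mul_of_nonneg_left e1 (by positivity)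
    _ = _ := by ring

theorem short_product_term_le (i : ℕ) (hP : 0 < P) (ht : t = P⁻¹ ^ θ) (ht1 : t ≤ 1) (hV : 0 ≤ V)
    (htV : t * V ≤ 1) (hx : t ≤ x) : (P⁻¹ ^ (5 * i)) ^ (2 * θ) * V ^ i ≤ x ^ i := by
  have ht0 : 0 ≤ t := by rw [ht]; positivity
  have htVi : t ^ i * V ^ i ≤ 1 := by
    rw [← mul_pow]; exact pow_le_one₀ (by positivity) htV
  rw [mul_comm 2 θ, Real.rpow_mul (by positivity), ← Real.rpow_pow_comm (by positivity), ← ht]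
  norm_cast
  calc _ = (t ^ i * V ^ i) * (t ^ i) ^ 8 * t ^ i := by ring
    _ ≤ 1 * 1 * x ^ i := by
        gcongr
        exact pow_le_one₀ (by positivity) (pow_le_one₀ ht0 ht1)
    _ = x ^ i := by ring

/-- Here `|ξ| h₀` is at least `P^(3i)`; one factor `t^i` cancels the moment `V^i` and another gives
the decay. -/
theorem separation_term_le {c m ξ E : ℝ} {N : ℕ} (i : ℕ) (hP : 0 < P) (ht : t = P⁻¹ ^ θ)
    (ht1 : t ≤ 1) (hV : 1 ≤ V) (htV : t * V ≤ 1) (hx : t ≤ x) (hθ : 0 < θ) (hc : c ≠ 0)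
    (hm : 0 < m) (hξ : P ^ (8 * i) ≤ |ξ|) (hN : (N : ℝ) + 1 ≤ E * (i + 1)) :
    (3 / (|c| * m * |ξ| * P⁻¹ ^ (5 * i))) ^ θ * (V ^ i + N * V)
      ≤ (3 / |c|) ^ θ * V * E * m ^ (-θ) * ((i + 1) * x ^ i) := by
  have hcp := abs_pos.2 hc
  have ht0 : 0 ≤ t := by rw [ht]; positivity
  have hE : 0 ≤ E := by
    have : 0 < E * (i + 1) := lt_of_lt_of_le (by positivity) hN
    exact (pos_of_mul_pos_left this (by positivity)).le
  have htVi : t ^ i * V ^ i ≤ 1 := by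
    rw [← mul_pow]; exact pow_le_one₀ (by positivity) htV
  have hξp : 0 < |ξ| := lt_of_lt_of_le (by positivity) hξ
  have e1 : 3 / (|c| * m * |ξ| * P⁻¹ ^ (5 * i)) ≤ (3 / |c|) * (m⁻¹ * P⁻¹ ^ (3 * i)) := by
    have e2 : P ^ (3 * i) ≤ |ξ| * P⁻¹ ^ (5 * i) := by
      calc P ^ (3 * i) = P ^ (3 * i) * (P ^ (5 * i) * P⁻¹ ^ (5 * i)) := by
            rw [← mul_pow, mul_inv_cancel₀ hP.ne', one_pow, mul_one]
        _ = P ^ (8 * i) * P⁻¹ ^ (5 * i) := by ring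
        _ ≤ _ := by gcongr
    calc _ = (3 / |c|) * (m⁻¹ * (|ξ| * P⁻¹ ^ (5 * i))⁻¹) := by field_simp
      _ ≤ (3 / |c|) * (m⁻¹ * (P ^ (3 * i))⁻¹) := by gcongr
      _ = _ := by rw [inv_pow P (3 * i)]
  have e3 : (3 / (|c| * m * |ξ| * P⁻¹ ^ (5 * i))) ^ θ
      ≤ (3 / |c|) ^ θ * (m ^ (-θ) * t ^ (3 * i)) := by
    refine (Real.rpow_le_rpow (by positivity) e1 hθ.le).trans (le_of_eq ?_)
    rw [Real.mul_rpow (by positivity) (by positivity), Real.mul_rpow (by positivity)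
      (by positivity), ht, Real.rpow_pow_comm (by positivity), Real.rpow_neg hm.le,
      Real.inv_rpow hm.le]
  have hV1 : 1 ≤ V ^ i := one_le_pow₀ hV
  have e4 : V ^ i + N * V ≤ V ^ i * V * (E * (i + 1)) := by
    calc V ^ i + N * V ≤ V ^ i * V + N * (V ^ i * V) := by
          gcongr
          · exact le_mul_of_one_le_right (by positivity) hV
          · exact le_mul_of_one_le_left (by linarith) hV1
      _ = V ^ i * V * (N + 1) := by ring
      _ ≤ _ := by gcongr
  calc _ ≤ ((3 / |c|) ^ θ * (m ^ (-θ) * t ^ (3 * i))) * (V ^ i * V * (E * (i + 1))) :=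
        mul_le_mul e3 e4 (by positivity) (by positivity)
    _ = (3 / |c|) ^ θ * V * E * m ^ (-θ) * ((i + 1) * ((t ^ i * V ^ i) * t ^ i * t ^ i)) := by
        ring
    _ ≤ (3 / |c|) ^ θ * V * E * m ^ (-θ) * ((i + 1) * (1 * 1 * x ^ i)) := by
        have : t ^ i ≤ 1 := pow_le_one₀ ht0 ht1
        gcongr
    _ = _ := by ring

/-- The gain is `β^(iθ) = b^(2i)`, while the `k` blocks cost at most `b^(-i)` up to a constant; a
factor `b^i` survives. -/
theorem loss_term_le {β b C E : ℝ} {K N : ℕ} (i k : ℕ) (hβ : 0 < β) (hb : b = β ^ (θ / 2))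
    (hb1 : b ≤ 1) (hx : b ≤ x) (hC : 0 ≤ C) (hCb : C ≤ b⁻¹ ^ K) (hk : K * k ≤ i + 1 + K)
    (hN : (N : ℝ) + 1 ≤ E * (i + 1)) :
    (N + 1) * ((β ^ i) ^ θ * C ^ k) ≤ E * b⁻¹ ^ (1 + K) * ((i + 1) * x ^ i) := by
  have hb0 : 0 < b := by rw [hb]; positivity
  have e1 : (β ^ i) ^ θ = b ^ i * b ^ i := by
    rw [hb, ← mul_pow, ← Real.rpow_add hβ, add_halves, Real.rpow_pow_comm hβ.le]
  have e3 : C ^ k ≤ b⁻¹ ^ (i + 1 + K) := by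
    calc _ ≤ (b⁻¹ ^ K) ^ k := pow_le_pow_left₀ hC hCb k
      _ = b⁻¹ ^ (K * k) := by rw [pow_mul]
      _ ≤ _ := pow_le_pow_right₀ ((one_le_inv₀ hb0).2 hb1) hk
  have hE : 0 ≤ E * (i + 1) := le_trans (by positivity) hN
  have hE0 : 0 ≤ E := nonneg_of_mul_nonneg_left hE (by positivity)
  calc _ ≤ (E * (i + 1)) * ((b ^ i * b ^ i) * b⁻¹ ^ (i + 1 + K)) := by
        rw [e1]
        exact mul_le_mul hN (mul_le_mul_of_nonneg_left e3 (by positivity)) (by positivity) hE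
    _ = E * b⁻¹ ^ (1 + K) * ((i + 1) * ((b * b⁻¹) ^ i * b ^ i)) := by ring
    _ ≤ E * b⁻¹ ^ (1 + K) * ((i + 1) * (1 * x ^ i)) := by
        rw [mul_inv_cancel₀ hb0.ne', one_pow]; gcongr
    _ = _ := by ring

theorem sum_terms_le {M₁ M₂ z Z C₁ C₃ C₄ : ℝ} (hM₁ : 0 ≤ M₁) (hM₂ : 0 ≤ M₂) (hz : 0 ≤ z)
    (hZ : 0 ≤ Z) (hC₁ : 0 ≤ C₁) (hC₃ : 0 ≤ C₃) (hC₄ : 0 ≤ C₄) :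
    (2 * M₁ + 1) * Z + C₁ * M₂ * Z + Z + C₃ * z * Z + C₄ * Z
      ≤ (3 + C₁ + C₃ + C₄) * (1 + M₁ + M₂) * (1 + z) * Z := by
  have h1 := mul_nonneg hM₁ hz
  have h2 := mul_nonneg hM₂ hz
  have a4 : (1 : ℝ) ≤ (1 + M₁ + M₂) * (1 + z) := by nlinarith
  have a2 : 2 * M₁ + 2 ≤ 3 * ((1 + M₁ + M₂) * (1 + z)) := by nlinarith
  have a3 : C₁ * M₂ ≤ C₁ * ((1 + M₁ + M₂) * (1 + z)) := by gcongr; nlinarith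
  have a5 : C₃ * z ≤ C₃ * ((1 + M₁ + M₂) * (1 + z)) := by gcongr; nlinarith
  have a6 : C₄ ≤ C₄ * ((1 + M₁ + M₂) * (1 + z)) := le_mul_of_one_le_right hC₄ a4
  calc _ = (2 * M₁ + 2 + C₁ * M₂ + C₃ * z + C₄) * Z := by ring
    _ ≤ _ := by gcongr; linarith

end scales

/-! ### Decay for a pair system -/

namespace PairSystem

variable {X Y : Type*} [MeasurableSpace X] {μ : Measure X} {π : X → Y} {h : X → ℝ} {c : ℝ}
  {B : Type*} (S : PairSystem μ π h c B)

/-- This is the expectation of `enorm_mean_osc_le` over words of `N` independent letters; the bound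
for a word holds for every starting point `x`, so `μ` enters only through its total mass. -/
theorem norm_integral_osc_le [IsProbabilityMeasure μ] (hh : ∀ x, h x ∈ Icc (0 : ℝ) 1)
    {κ θ β h₀ y V : ℝ} {q K i N : ℕ} (hc : c ≠ 0) (hκ : 0 < κ) (hκ1 : κ ≤ 1)
    (hq : |Real.cos (Real.pi * κ)| ^ q ≤ κ) (hq0 : q ≠ 0) (hK : 0 < K)
    (hθ : 0 < θ) (hθ1 : θ ≤ 1) (hβ : 0 < β) (hβ2 : β ^ 2 = 1 / 2) (hh₀ : 0 < h₀)
    (hV0 : 0 ≤ V)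
    (hV : ∑' b, S.weight b * ENNReal.ofReal (|S.ratio b| ^ (-(2 * θ))) ≤ ENNReal.ofReal V)
    (hκV : κ ^ θ * V ^ K ≤ 1)
    {M₁ M₂ m ξ : ℝ} (hM₁ : 0 ≤ M₁) (hM₂ : 0 ≤ M₂) (hm : 0 < m) (hξ : ξ ≠ 0)
    {G : X → ℝ} (hG : Measurable G) {f g : Y → ℝ → ℝ}
    (hfg : ∀ y, FibreRegular (f y) (g y) M₁ M₂ m) (hGf : ∀ x, G x = f (π x) (h x))
    (hi : i ≤ N) (hlen : (1 / 4 : ℝ) ^ N ≤ h₀)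
    (hlenK : |ξ| * (1 / 4 : ℝ) ^ (N - K) ≤ 1)
    (hy : 0 ≤ y) (hyq : (2 * M₁ + 1) * β ^ i ≤ y ^ q) :
    ‖∫ x, osc (ξ * G x) ∂μ‖ ≤
      y + 2 * Real.pi * |ξ| * M₂ * (h₀ * (|c| / 3)) ^ 2 + h₀ ^ (2 * θ) * V ^ i
      + (3 / (|c| * m * |ξ| * h₀)) ^ θ * (V ^ i + N * V)
      + (N + 1) * ((β ^ i) ^ θ * (2 * ((2 * |c| + 4) * (4 / |c| + 1))) ^ (N / K)) := by
  set C : ℝ := (2 * |c| + 4) * (4 / |c| + 1) with hC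
  have hC1 : 1 ≤ 2 * C := by
    have : 0 ≤ 4 / |c| := by positivity
    nlinarith [abs_nonneg c]
  have hC0 : 0 ≤ C := by positivity
  set v : B → ℝ≥0∞ := fun b => ENNReal.ofReal (|S.ratio b| ^ (-(2 * θ))) with hv
  have hp := S.tsum_weight_le
  have hδ : ENNReal.ofReal (κ ^ θ) * (∑' b, S.weight b * v b) ^ K ≤ 1 := by
    calc _ ≤ ENNReal.ofReal (κ ^ θ) * ENNReal.ofReal V ^ K := by gcongr
      _ = ENNReal.ofReal (κ ^ θ * V ^ K) := by
          rw [← ENNReal.ofReal_pow hV0, ENNReal.ofReal_mul (by positivity)]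
      _ ≤ ENNReal.ofReal 1 := ENNReal.ofReal_le_ofReal hκV
      _ = 1 := ENNReal.ofReal_one
  have hVi : listMean S.weight i (fun l => (l.map v).prod) ≤ ENNReal.ofReal (V ^ i) := by
    rw [listMean_prod_map, ENNReal.ofReal_pow hV0]
    gcongr
  have hVs : listMean S.weight N (fun l => (l.map v).sum) ≤ ENNReal.ofReal (N * V) := by
    refine (listMean_sum_map_le hp v N).trans ?_
    rw [ENNReal.ofReal_mul (by positivity), ENNReal.ofReal_natCast]
    gcongr
  have hloss : ∀ n ∈ Finset.range (N + 1), listMean S.weight N (fun l =>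
      blockBound (ENNReal.ofReal C) (ENNReal.ofReal (κ ^ θ)) v K ((N - n) / K) (l.drop n))
        ≤ ENNReal.ofReal ((2 * C) ^ (N / K)) := by
    intro n hn
    have hnN : n ≤ N := Nat.lt_succ_iff.1 (Finset.mem_range.1 hn)
    refine (listMean_drop_le hp hnN _).trans
      ((listMean_blockBound_le hp hδ _ (Nat.div_mul_le_self _ _)).trans ?_)
    have e : 2 * ENNReal.ofReal C = ENNReal.ofReal (2 * C) := by
      rw [ENNReal.ofReal_mul zero_le_two, ENNReal.ofReal_ofNat]
    rw [ENNReal.ofReal_pow (zero_le_one.trans hC1), e]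
    refine pow_le_pow_right₀ ?_ (Nat.div_le_div_right (Nat.sub_le _ _))
    rw [← ENNReal.ofReal_one]
    exact ENNReal.ofReal_le_ofReal hC1
  have hmeas : Measurable fun x => osc (ξ * G x) :=
    continuous_osc.measurable.comp (hG.const_mul ξ)
  have hY₀ : 0 ≤ y + 2 * Real.pi * |ξ| * M₂ * (h₀ * (|c| / 3)) ^ 2 := by positivity
  rw [← ENNReal.ofReal_le_ofReal_iff (by positivity), ofReal_norm]
  set Y₀ : ℝ := y + 2 * Real.pi * |ξ| * M₂ * (h₀ * (|c| / 3)) ^ 2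
  have key := S.enorm_integral_le_listMean N hmeas fun x => (norm_osc _).le
  refine key.trans ?_
  have hpt : ∀ l : List B, l.length = N → ‖∫ x, S.avg l (fun x => osc (ξ * G x)) x ∂μ‖ₑ ≤
      ENNReal.ofReal Y₀ + ENNReal.ofReal (h₀ ^ (2 * θ)) * ((l.take i).map v).prod
      + ENNReal.ofReal ((3 / (|c| * m * |ξ| * h₀)) ^ θ)
          * (((l.take i).map v).prod + (l.map v).sum)
      + ∑ n ∈ Finset.range (N + 1), ENNReal.ofReal ((β ^ i) ^ θ)
          * blockBound (ENNReal.ofReal C) (ENNReal.ofReal (κ ^ θ)) v K ((N - n) / K)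
            (l.drop n) := by
    intro l hl
    refine (enorm_integral_le_lintegral_enorm _).trans ?_
    refine (lintegral_mono (g := fun _ => _) fun x => ?_).trans
      (le_of_eq (by rw [lintegral_const, measure_univ, mul_one]))
    obtain ⟨y', a, hk, hz⟩ := S.exists_avg_eq_mean l x
    have := hk fun y s => osc (ξ * f y s)
    simp only [hGf]
    rw [this]
    have hb := enorm_mean_osc_le S.ratio_bound hc hκ hκ1 hq hq0 hK hθ hθ1 hβ hβ2 hh₀ hM₁ hM₂ hm hξ
      (hfg y') (l := l) (a := a) (i := i) (y := y) (fun z hzc => by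
        obtain ⟨x', hx'⟩ := hz z hzc
        rw [← hx']; exact hh x') (by rwa [hl]) (by rwa [hl]) hy hyq
    rwa [hl] at hb
  clear_value Y₀
  refine (listMean_mono hpt).trans ?_
  rw [listMean_add, listMean_add, listMean_add, listMean_sum]
  simp only [listMean_const_mul, listMean_add]
  have hVi' := (listMean_take_le hp hi fun l => (l.map v).prod).trans hVi
  rw [ENNReal.ofReal_add (by positivity) (by positivity),
    ENNReal.ofReal_add (by positivity) (by positivity),
    ENNReal.ofReal_add (by positivity) (by positivity)]
  refine add_le_add (add_le_add (add_le_add (listMean_const_le hp _ _) ?_) ?_) ?_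
  · rw [ENNReal.ofReal_mul (by positivity)]
    gcongr
  · rw [ENNReal.ofReal_mul (by positivity), ENNReal.ofReal_add (by positivity) (by positivity)]
    gcongr
  · refine (Finset.sum_le_sum fun n hn => mul_le_mul_right (hloss n hn) _).trans ?_
    rw [Finset.sum_const, Finset.card_range, nsmul_eq_mul, ← ENNReal.ofReal_mul (by positivity),
      ← ENNReal.ofReal_natCast, ← ENNReal.ofReal_mul (by positivity)]
    push_cast
    exact le_rfl

/-- Decay at the frequencies between consecutive powers of a fixed number. -/
theorem exists_norm_integral_osc_le [IsProbabilityMeasure μ] (hh : ∀ x, h x ∈ Icc (0 : ℝ) 1)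
    (hc : c ≠ 0) {θ : ℝ} (hθ : 0 < θ) (hθ1 : θ ≤ 1)
    (hV : ∑' b, S.weight b * ENNReal.ofReal (|S.ratio b| ^ (-(2 * θ))) ≠ ∞) :
    ∃ (x C : ℝ) (L : ℕ), 0 < x ∧ x < 1 ∧ 0 < C ∧ 0 < L ∧
      ∀ (G : X → ℝ) (f g : Y → ℝ → ℝ) (M₁ M₂ m : ℝ), Measurable G → 0 ≤ M₁ → 0 ≤ M₂ → 0 < m →
        (∀ y, FibreRegular (f y) (g y) M₁ M₂ m) → (∀ x, G x = f (π x) (h x)) →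
        ∀ (ξ : ℝ) (i : ℕ), (4 : ℝ) ^ (L * i) ≤ |ξ| → |ξ| ≤ 4 ^ (L * (i + 1)) →
          ‖∫ x, osc (ξ * G x) ∂μ‖
            ≤ C * (1 + M₁ + M₂) * (1 + m ^ (-θ)) * ((i + 1) * x ^ i) := by
  obtain ⟨V, hVdef⟩ : ∃ V : ℝ, V =
      (∑' b, S.weight b * ENNReal.ofReal (|S.ratio b| ^ (-(2 * θ)))).toReal + 2 := ⟨_, rfl⟩
  have hV2 : 2 ≤ V := by rw [hVdef]; linarith [ENNReal.toReal_nonneg (a :=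
    ∑' b, S.weight b * ENNReal.ofReal (|S.ratio b| ^ (-(2 * θ))))]
  have hVle : ∑' b, S.weight b * ENNReal.ofReal (|S.ratio b| ^ (-(2 * θ))) ≤ ENNReal.ofReal V := by
    rw [← ENNReal.ofReal_toReal hV]
    exact ENNReal.ofReal_le_ofReal (by rw [hVdef]; linarith)
  obtain ⟨C₀, hC₀⟩ : ∃ C₀, C₀ = 2 * ((2 * |c| + 4) * (4 / |c| + 1)) := ⟨_, rfl⟩
  have hC₀1 : 1 < C₀ := by
    have : 0 ≤ 4 / |c| := by positivity
    rw [hC₀]; nlinarith [abs_nonneg c]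
  -- the number of letters
  obtain ⟨L, hL⟩ : ∃ L : ℕ, V < ((4 : ℝ) ^ θ) ^ L :=
    pow_unbounded_of_one_lt V (Real.one_lt_rpow (by norm_num) hθ)
  have hL0 : 0 < L := by
    rcases Nat.eq_zero_or_pos L with h0 | h0
    · rw [h0, pow_zero] at hL; linarith
    · exact h0
  obtain ⟨P, hP⟩ : ∃ P : ℝ, P = 4 ^ L := ⟨_, rfl⟩
  have hP1 : 1 < P := hP ▸ one_lt_pow₀ (by norm_num) hL0.ne'
  have hP0 : 0 < P := by linarith
  obtain ⟨t, ht⟩ : ∃ t : ℝ, t = P⁻¹ ^ θ := ⟨_, rfl⟩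
  have ht0 : 0 < t := by rw [ht]; positivity
  have htV : t * V ≤ 1 := by
    rw [ht, Real.inv_rpow hP0.le, hP, ← Real.rpow_pow_comm (by norm_num), inv_mul_le_one₀ (by positivity)]
    exact hL.le
  have ht1 : t < 1 := by nlinarith
  -- the length of the blocks
  obtain ⟨β, hβ⟩ : ∃ β : ℝ, β = Real.sqrt (1 / 2) := ⟨_, rfl⟩
  have hβ0 : 0 < β := by rw [hβ]; positivity
  have hβ2 : β ^ 2 = 1 / 2 := hβ ▸ Real.sq_sqrt (by norm_num)
  have hβ1 : β < 1 := by nlinarith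
  obtain ⟨b, hb⟩ : ∃ b : ℝ, b = β ^ (θ / 2) := ⟨_, rfl⟩
  have hb0 : 0 < b := by rw [hb]; positivity
  have hb1 : b < 1 := hb ▸ Real.rpow_lt_one hβ0.le hβ1 (by positivity)
  have hbinv : 1 < b⁻¹ := (one_lt_inv₀ hb0).2 hb1
  obtain ⟨K', hK'⟩ : ∃ K' : ℕ, C₀ < b⁻¹ ^ K' := pow_unbounded_of_one_lt C₀ hbinv
  have hK'0 : 0 < K' := by
    rcases Nat.eq_zero_or_pos K' with h0 | h0
    · rw [h0, pow_zero] at hK'; linarith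
    · exact h0
  -- About `8 L i` letters form about `i / K'` blocks, so the constants `C₀` multiply to at most
  -- `b^(-i)` up to a constant.
  obtain ⟨K, hK⟩ : ∃ K : ℕ, K = 8 * L * K' := ⟨_, rfl⟩
  have hK0 : 0 < K := by rw [hK]; positivity
  -- the neighbourhood of the integers
  obtain ⟨κ, hκ⟩ : ∃ κ : ℝ, κ = (V ^ K)⁻¹ ^ θ⁻¹ := ⟨_, rfl⟩
  have hVK : 1 < V ^ K := one_lt_pow₀ (by linarith) hK0.ne'
  have hκ0 : 0 < κ := by rw [hκ]; positivity
  have hκ1 : κ < 1 := hκ ▸ Real.rpow_lt_one (by positivity) (inv_lt_one_of_one_lt₀ hVK) (by positivity)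
  have hκV : κ ^ θ * V ^ K ≤ 1 := by
    rw [hκ, Real.rpow_inv_rpow (by positivity) hθ.ne', inv_mul_cancel₀ (by positivity)]
  have hcos : |Real.cos (Real.pi * κ)| < 1 := by
    have hs : 0 < Real.sin (Real.pi * κ) :=
      Real.sin_pos_of_pos_of_lt_pi (by positivity) (by nlinarith [Real.pi_pos])
    rw [← sq_lt_one_iff_abs_lt_one]
    nlinarith [Real.sin_sq_add_cos_sq (Real.pi * κ)]
  obtain ⟨q, hq⟩ := exists_pow_lt_of_lt_one hκ0 hcos
  have hq0 : q ≠ 0 := by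
    rintro rfl
    rw [pow_zero] at hq; linarith
  -- The `q`-th root comes from Jensen's inequality in `norm_mean_osc_le`.
  obtain ⟨ϑ, hϑ⟩ : ∃ ϑ : ℝ, ϑ = β ^ (q : ℝ)⁻¹ := ⟨_, rfl⟩
  have hϑ0 : 0 < ϑ := by rw [hϑ]; positivity
  have hϑ1 : ϑ < 1 := hϑ ▸ Real.rpow_lt_one hβ0.le hβ1 (by positivity)
  have hϑq : ϑ ^ q = β := hϑ ▸ Real.rpow_inv_natCast_pow hβ0.le hq0
  have hPi1 : P⁻¹ ^ 2 < 1 := pow_lt_one₀ (by positivity) (inv_lt_one_of_one_lt₀ hP1) two_ne_zero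
  obtain ⟨x, hx⟩ : ∃ x : ℝ, x = max (max t (P⁻¹ ^ 2)) (max b ϑ) := ⟨_, rfl⟩
  have hxt : t ≤ x := hx ▸ (le_max_left _ _).trans (le_max_left _ _)
  have hxP : P⁻¹ ^ 2 ≤ x := hx ▸ (le_max_right _ _).trans (le_max_left _ _)
  have hxb : b ≤ x := hx ▸ (le_max_left _ _).trans (le_max_right _ _)
  have hxϑ : ϑ ≤ x := hx ▸ (le_max_right _ _).trans (le_max_right _ _)
  obtain ⟨E, hE⟩ : ∃ E : ℝ, E = ((8 * L + K + 1 : ℕ) : ℝ) := ⟨_, rfl⟩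
  have hx0 : 0 < x := ht0.trans_le hxt
  have hE0 : 0 ≤ E := by rw [hE]; positivity
  refine ⟨x, 3 + 2 * Real.pi * (|c| / 3) ^ 2 * P ^ 8 + (3 / |c|) ^ θ * V * E
    + E * b⁻¹ ^ (1 + K'), 8 * L, hx0,
    hx ▸ max_lt (max_lt ht1 hPi1) (max_lt hb1 hϑ1), by positivity, by positivity, ?_⟩
  intro G f g M₁ M₂ m hG hM₁ hM₂ hm hfg hGf ξ i hξl hξu
  have hξpos : 0 < |ξ| := lt_of_lt_of_le (by positivity) hξl
  have hξ0 : ξ ≠ 0 := abs_pos.1 hξpos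
  have hξl' : P ^ (8 * i) ≤ |ξ| := by
    rw [hP, ← pow_mul]; convert hξl using 2; ring
  have hξu' : |ξ| ≤ P ^ (8 * i) * P ^ 8 := by
    rw [hP, ← pow_mul, ← pow_mul, ← pow_add]; convert hξu using 2; ring
  -- `8 L (i + 1)` letters bring the product below `|ξ|⁻¹`; the `K` extra ones pay for an incomplete
  -- block.
  obtain ⟨N, hN⟩ : ∃ N : ℕ, N = 8 * L * (i + 1) + K := ⟨_, rfl⟩
  have hPinv : P⁻¹ = (1 / 4 : ℝ) ^ L := by rw [hP, one_div, inv_pow]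
  have hlen : (1 / 4 : ℝ) ^ N ≤ P⁻¹ ^ (5 * i) := by
    rw [hPinv, ← pow_mul]
    refine pow_le_pow_of_le_one (by norm_num) (by norm_num) ?_
    have e1 : L * (5 * i) = 5 * (L * i) := by ring
    have e2 : 8 * L * (i + 1) = 8 * (L * i) + 8 * L := by ring
    omega
  have hlenK : |ξ| * (1 / 4 : ℝ) ^ (N - K) ≤ 1 := by
    rw [hN, Nat.add_sub_cancel]
    calc _ ≤ (4 : ℝ) ^ (8 * L * (i + 1)) * (1 / 4 : ℝ) ^ (8 * L * (i + 1)) := by gcongr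
      _ = 1 := by rw [← mul_pow]; norm_num
  have hiN : i ≤ N := by
    have e1 : i ≤ L * i := Nat.le_mul_of_pos_left i hL0
    have e2 : 8 * L * (i + 1) = 8 * (L * i) + 8 * L := by ring
    omega
  have hmain := S.norm_integral_osc_le hh hc hκ0 hκ1.le hq.le hq0 hK0 hθ hθ1 hβ0 hβ2 (h₀ := P⁻¹ ^ (5 * i)) (by positivity)
    (by linarith) hVle hκV hM₁ hM₂ hm hξ0 hG hfg hGf hiN hlen hlenK
    (y := (2 * M₁ + 1) * ϑ ^ i) (by positivity) (by
      rw [mul_pow, ← pow_mul, mul_comm i q, pow_mul, hϑq]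
      gcongr
      exact le_self_pow₀ (by linarith) hq0)
  refine hmain.trans ?_
  rw [← hC₀]
  have hi1 : (1 : ℝ) ≤ i + 1 := by linarith [Nat.cast_nonneg (α := ℝ) i]
  have hZx : x ^ i ≤ (i + 1) * x ^ i := le_mul_of_one_le_left (by positivity) hi1
  have hNE : (N : ℝ) + 1 ≤ E * (i + 1) := by
    rw [hE, hN]
    norm_cast
    have e : (8 * L + K + 1) * (i + 1) = 8 * L * (i + 1) + K + 1 + (K + 1) * i := by ring
    omega
  have T0 : (2 * M₁ + 1) * ϑ ^ i ≤ (2 * M₁ + 1) * ((i + 1) * x ^ i) :=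
    mul_le_mul_of_nonneg_left ((pow_le_pow_left₀ hϑ0.le hxϑ i).trans hZx) (by positivity)
  have T1 := (linearisation_term_le (c := c) i hP0 hM₂ hξu' hxP).trans
    (mul_le_mul_of_nonneg_left hZx (by positivity))
  have T2 := (short_product_term_le i hP0 ht ht1.le (by linarith) htV hxt).trans hZx
  have T3 := separation_term_le i hP0 ht ht1.le (by linarith) htV hxt hθ hc hm hξl' hNE
  have e2 : K' * (N / K) ≤ i + 1 + K' := by
    have : N / K = (i + 1) / K' + 1 := by
      rw [hN, Nat.add_div_right _ hK0, hK, Nat.mul_div_mul_left _ _ (by positivity)]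
    rw [this, mul_add, mul_one]
    gcongr
    exact Nat.mul_div_le _ _
  have T4 := loss_term_le i (N / K) hβ0 hb hb1.le hxb (by linarith) hK'.le e2 hNE
  exact (add_le_add (add_le_add (add_le_add (add_le_add T0 T1) T2) T3) T4).trans
    (sum_terms_le hM₁ hM₂ (by positivity) (by positivity) (by positivity) (by positivity)
      (by positivity))

/-- Polynomial decay of the oscillating integrals of fibrewise regular functions. -/
theorem exists_norm_integral_osc_le_rpow [IsProbabilityMeasure μ]
    (hh : ∀ x, h x ∈ Icc (0 : ℝ) 1) (hc : c ≠ 0) {θ : ℝ} (hθ : 0 < θ) (hθ1 : θ ≤ 1)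
    (hV : ∑' b, S.weight b * ENNReal.ofReal (|S.ratio b| ^ (-(2 * θ))) ≠ ∞) :
    ∃ η C : ℝ, 0 < η ∧ 0 < C ∧
      ∀ (G : X → ℝ) (f g : Y → ℝ → ℝ) (M₁ M₂ m : ℝ), Measurable G → 0 ≤ M₁ → 0 ≤ M₂ → 0 < m →
        (∀ y, FibreRegular (f y) (g y) M₁ M₂ m) → (∀ x, G x = f (π x) (h x)) →
        ∀ ξ : ℝ, ξ ≠ 0 → ‖∫ x, osc (ξ * G x) ∂μ‖
          ≤ C * (1 + M₁ + M₂) * (1 + m ^ (-θ)) * |ξ| ^ (-η) := by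
  obtain ⟨x, C, L, hx0, hx1, hC, hL, hmain⟩ := S.exists_norm_integral_osc_le hh hc hθ hθ1 hV
  -- One factor `z^i` of `x^i = z^i z^i` absorbs the polynomial `i + 1`; the other becomes
  -- `|ξ|^(-η)`, with `η` defined by `w^(-η) = z`.
  set z : ℝ := Real.sqrt x with hz
  have hz0 : 0 < z := Real.sqrt_pos.2 hx0
  have hz1 : z < 1 := by rw [hz, Real.sqrt_lt' one_pos]; simpa using hx1
  have hzz : z * z = x := Real.mul_self_sqrt hx0.le
  obtain ⟨A, hA⟩ : ∃ A : ℝ, ∀ i : ℕ, (i + 1) * z ^ i ≤ A := by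
    have h1 := tendsto_self_mul_const_pow_of_lt_one hz0.le hz1
    have h2 := tendsto_pow_atTop_nhds_zero_of_lt_one hz0.le hz1
    obtain ⟨A, hA⟩ := (h1.add h2).bddAbove_range
    exact ⟨A, fun i => by
      have : i * z ^ i + z ^ i ≤ A := hA ⟨i, rfl⟩
      linarith⟩
  have hA1 : 1 ≤ A := by simpa using hA 0
  set w : ℝ := (4 : ℝ) ^ L with hw
  have hw1 : 1 < w := one_lt_pow₀ (by norm_num) hL.ne'
  set η : ℝ := -Real.logb w z with hη
  have hη0 : 0 < η := by
    rw [hη, neg_pos]; exact Real.logb_neg hw1 hz0 hz1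
  have hwη : w ^ (-η) = z := by
    rw [hη, neg_neg, Real.rpow_logb (by linarith) hw1.ne' hz0]
  have hscale : ∀ (ξ : ℝ) (i : ℕ), 0 < |ξ| → |ξ| ≤ w ^ (i + 1) → z ^ (i + 1) ≤ |ξ| ^ (-η) := by
    intro ξ i hξ hle
    have := Real.rpow_le_rpow_of_nonpos hξ hle (neg_nonpos.2 hη0.le)
    rwa [← Real.rpow_pow_comm (by positivity), hwη] at this
  refine ⟨η, z⁻¹ * (1 + C * A), hη0, by positivity, ?_⟩
  intro G f g M₁ M₂ m hG hM₁ hM₂ hm hfg hGf ξ hξ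
  have hξp := abs_pos.2 hξ
  have hm0 : 0 ≤ m ^ (-θ) := by positivity
  have hQ1 : 1 ≤ (1 + M₁ + M₂) * (1 + m ^ (-θ)) := by
    nlinarith [mul_nonneg hM₁ hm0, mul_nonneg hM₂ hm0]
  set Q := (1 + M₁ + M₂) * (1 + m ^ (-θ)) with hQ
  rw [mul_assoc (z⁻¹ * (1 + C * A)), ← hQ]
  have hξη : 0 ≤ |ξ| ^ (-η) := by positivity
  rcases lt_or_ge |ξ| 1 with hlt | hge
  · have h1 : ‖∫ x, osc (ξ * G x) ∂μ‖ ≤ 1 := by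
      refine (norm_integral_le_of_norm_le_const (C := 1)
        (Filter.Eventually.of_forall fun x => (norm_osc _).le)).trans ?_
      simp
    have h2 : z ≤ |ξ| ^ (-η) := by
      simpa using hscale ξ 0 hξp (by rw [zero_add, pow_one]; linarith)
    calc _ ≤ 1 := h1
      _ = z⁻¹ * 1 * 1 * z := by field_simp
      _ ≤ z⁻¹ * (1 + C * A) * Q * |ξ| ^ (-η) := by
          gcongr
          have : 0 ≤ C * A := by positivity
          linarith
  · obtain ⟨i, hi1, hi2⟩ := exists_nat_pow_near hge hw1
    have h1 := hmain G f g M₁ M₂ m hG hM₁ hM₂ hm hfg hGf ξ i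
      (by rwa [pow_mul]) (by rw [pow_mul]; exact hi2.le)
    rw [mul_assoc C, ← hQ] at h1
    have h2 := hscale ξ i hξp hi2.le
    calc _ ≤ _ := h1
      _ = C * Q * (((i + 1) * z ^ i) * z ^ i) := by rw [← hzz]; ring
      _ ≤ C * Q * (A * z ^ i) := by gcongr; exact hA i
      _ = z⁻¹ * (C * A) * Q * z ^ (i + 1) := by field_simp; ring
      _ ≤ z⁻¹ * (1 + C * A) * Q * |ξ| ^ (-η) := by gcongr; linarith

end PairSystem

/-! ### Sums over finite words -/

theorem tsum_list {A : Type*} (F : List A → ℝ≥0∞) :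
    ∑' l, F l = F [] + ∑' a, ∑' l, F (a :: l) := by
  classical
  rw [ENNReal.summable.tsum_eq_add_tsum_ite' [], ← ENNReal.tsum_prod (f := fun a l => F (a :: l))]
  congr 1
  have hinj : Function.Injective fun p : A × List A => p.1 :: p.2 := fun p p' h => by
    simpa [Prod.ext_iff] using h
  rw [← hinj.tsum_eq]
  · simp
  · intro l hl
    rcases l with - | ⟨a, l⟩
    · simp at hl
    · exact ⟨(a, l), rfl⟩

/-- Any `W` satisfying the renewal inequality dominates the geometric series, by induction on the
length of words. No convergence has to be known beforehand. -/
theorem tsum_list_prod_le {A : Type*} {x : A → ℝ≥0∞} {e W : ℝ≥0∞}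
    (h : e + (∑' a, x a) * W ≤ W) : ∑' l : List A, (l.map x).prod * e ≤ W := by
  have key : ∀ n : ℕ, ∑' l : List A, (if l.length < n then (l.map x).prod * e else 0) ≤ W := by
    intro n
    induction n with
    | zero => simp
    | succ n ih =>
      rw [tsum_list]
      refine le_trans ?_ h
      rw [← ENNReal.tsum_mul_right]
      refine add_le_add (by simp) (ENNReal.tsum_le_tsum fun a => ?_)
      refine le_trans (le_of_eq ?_) (mul_le_mul_right ih (x a))
      rw [← ENNReal.tsum_mul_left]
      refine tsum_congr fun l => ?_
      by_cases hl : l.length < n <;> simp [hl, mul_assoc]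
  rw [ENNReal.tsum_eq_iSup_sum]
  refine iSup_le fun s => ?_
  refine le_trans ?_ (key (s.sup List.length + 1))
  refine le_trans (le_of_eq ?_) (ENNReal.sum_le_tsum s)
  refine Finset.sum_congr rfl fun l hl => ?_
  rw [if_pos (Nat.lt_succ_of_le (Finset.le_sup (f := List.length) hl))]

/-! ### Iterated function systems that are affine in a height coordinate -/

/-- A stationary measure of a random system of maps of `X` that descend to `Y` under `π`, and act
on the height `h` by affine maps. -/
structure FibredSystem {X Y : Type*} [PseudoEMetricSpace X] [MeasurableSpace X] (μ : Measure X)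
    (π : X → Y) (h : X → ℝ) (A : Type*) (ρ : NNReal) (τ : ℝ) where
  map : A → X → X
  base : A → Y → Y
  ratio : A → ℝ
  trans : A → ℝ
  weight : A → ℝ≥0∞
  lipschitz : ∀ a, LipschitzWith ρ (map a)
  measurable_map : ∀ a, Measurable (map a)
  proj_map : ∀ a x, π (map a x) = base a (π x)
  height_map : ∀ a x, h (map a x) = ratio a * h x + trans a
  ratio_ne : ∀ a, ratio a ≠ 0
  abs_ratio_le : ∀ a, |ratio a| ≤ ρ
  weight_ne : ∀ a, weight a ≠ 0
  tsum_weight : ∑' a, weight a = 1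
  moment : ∑' a, weight a * ENNReal.ofReal (|ratio a| ^ (-τ)) ≠ ∞
  lintegral_eq : ∀ g : X → ℝ≥0∞, Measurable g →
    ∫⁻ x, g x ∂μ = ∑' a, weight a * ∫⁻ x, g (map a x) ∂μ

namespace FibredSystem

variable {X Y : Type*} [PseudoEMetricSpace X] [MeasurableSpace X] {μ : Measure X}
  {π : X → Y} {h : X → ℝ} {A : Type*} {ρ : NNReal} {τ : ℝ} (S : FibredSystem μ π h A ρ τ)

/-- The system of all compositions of two maps. -/
noncomputable def sq : FibredSystem μ π h (A × A) (ρ * ρ) τ where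
  map a := S.map a.1 ∘ S.map a.2
  base a := S.base a.1 ∘ S.base a.2
  ratio a := S.ratio a.1 * S.ratio a.2
  trans a := S.ratio a.1 * S.trans a.2 + S.trans a.1
  weight a := S.weight a.1 * S.weight a.2
  lipschitz a := (S.lipschitz a.1).comp (S.lipschitz a.2)
  measurable_map a := (S.measurable_map a.1).comp (S.measurable_map a.2)
  proj_map a x := by simp [S.proj_map]
  height_map a x := by simp [S.height_map]; ring
  ratio_ne a := mul_ne_zero (S.ratio_ne _) (S.ratio_ne _)
  abs_ratio_le a := by
    rw [abs_mul, NNReal.coe_mul]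
    exact mul_le_mul (S.abs_ratio_le _) (S.abs_ratio_le _) (abs_nonneg _) ρ.2
  weight_ne a := mul_ne_zero (S.weight_ne _) (S.weight_ne _)
  tsum_weight := by
    rw [ENNReal.tsum_prod (f := fun a b => S.weight a * S.weight b)]
    simp only [ENNReal.tsum_mul_left, S.tsum_weight, mul_one]
  moment := by
    rw [ENNReal.tsum_prod (f := fun a b => S.weight a * S.weight b *
      ENNReal.ofReal (|S.ratio a * S.ratio b| ^ (-τ)))]
    have : ∀ a b, S.weight a * S.weight b * ENNReal.ofReal (|S.ratio a * S.ratio b| ^ (-τ))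
        = (S.weight a * ENNReal.ofReal (|S.ratio a| ^ (-τ)))
          * (S.weight b * ENNReal.ofReal (|S.ratio b| ^ (-τ))) := fun a b => by
      rw [abs_mul, Real.mul_rpow (abs_nonneg _) (abs_nonneg _), ENNReal.ofReal_mul (by positivity)]
      ring
    simp only [this, ENNReal.tsum_mul_left, ENNReal.tsum_mul_right]
    exact ENNReal.mul_ne_top S.moment S.moment
  lintegral_eq g hg := by
    rw [ENNReal.tsum_prod (f := fun a b => S.weight a * S.weight b *
      ∫⁻ x, g ((S.map a ∘ S.map b) x) ∂μ), S.lintegral_eq g hg]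
    refine tsum_congr fun a => ?_
    rw [S.lintegral_eq (fun x => g (S.map a x)) (hg.comp (S.measurable_map a)),
      ← ENNReal.tsum_mul_left]
    simp [mul_assoc]

/-- Two distinct letters with the same weight, base map and ratio. -/
structure Twins (u v : A) : Prop where
  weight : S.weight u = S.weight v
  base : S.base u = S.base v
  ratio : S.ratio u = S.ratio v
  trans : S.trans u ≠ S.trans v

variable {S}

theorem Twins.sq {u v : A} (huv : S.Twins u v) : S.sq.Twins (u, u) (v, u) where
  weight := by simp [FibredSystem.sq, huv.weight]
  base := by simp [FibredSystem.sq, huv.base]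
  ratio := by simp [FibredSystem.sq, huv.ratio]
  trans := by simp [FibredSystem.sq, huv.ratio, huv.trans]

/-- The two orders of composition have equal weights and ratios by commutativity; `hfix` says that
the fibre maps do not commute. -/
theorem twins_sq_swap {u v : A} (hbase : S.base u = S.base v)
    (hfix : S.ratio u * S.trans v + S.trans u ≠ S.ratio v * S.trans u + S.trans v) :
    S.sq.Twins (u, v) (v, u) where
  weight := mul_comm _ _
  base := by simp [FibredSystem.sq, hbase]
  ratio := mul_comm _ _
  trans := hfix

variable (S)

theorem hasSum_integral [IsProbabilityMeasure μ] {H : X → ℂ} (hH : Measurable H)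
    (hH1 : ∀ x, ‖H x‖ ≤ 1) :
    HasSum (fun a => (S.weight a).toReal • ∫ x, H (S.map a x) ∂μ) (∫ x, H x ∂μ) := by
  have hμ : μ = Measure.sum fun a => S.weight a • μ.map (S.map a) := by
    refine Measure.ext_of_lintegral _ fun g hg => ?_
    rw [S.lintegral_eq g hg, lintegral_sum_measure]
    refine tsum_congr fun a => ?_
    rw [lintegral_smul_measure, lintegral_map hg (S.measurable_map a), smul_eq_mul]
  have hint : Integrable H μ :=
    Integrable.of_bound hH.aestronglyMeasurable 1 (Filter.Eventually.of_forall hH1)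
  have hs := hasSum_integral_measure (f := H)
    (μ := fun a => S.weight a • μ.map (S.map a)) (by rwa [← hμ])
  rw [← hμ] at hs
  have e : (fun a => (S.weight a).toReal • ∫ x, H (S.map a x) ∂μ)
      = fun a => ∫ x, H x ∂S.weight a • μ.map (S.map a) := by
    funext a
    rw [integral_smul_measure, integral_map (S.measurable_map a).aemeasurable
      hH.aestronglyMeasurable]
  rw [e]
  exact hs

theorem weight_ne_top (a : A) : S.weight a ≠ ∞ :=
  ne_top_of_le_ne_top ENNReal.one_ne_top ((ENNReal.le_tsum a).trans S.tsum_weight.le)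

theorem enorm_weight_smul (a : A) (z : ℂ) :
    ‖(S.weight a).toReal • z‖ₑ = S.weight a * ‖z‖ₑ := by
  rw [enorm_smul, Real.enorm_of_nonneg ENNReal.toReal_nonneg,
    ENNReal.ofReal_toReal (S.weight_ne_top a)]

theorem enorm_integral_le [IsProbabilityMeasure μ] {H : X → ℂ} (hH : Measurable H)
    (hH1 : ∀ x, ‖H x‖ ≤ 1) :
    ‖∫ x, H x ∂μ‖ₑ ≤ ∑' a, S.weight a * ‖∫ x, H (S.map a x) ∂μ‖ₑ := by
  rw [← (S.hasSum_integral hH hH1).tsum_eq]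
  exact enorm_tsum_le_tsum_enorm.trans (by simp only [S.enorm_weight_smul, le_refl])

open Classical in
/-- The weights of the letters different from `u` and `v`. -/
noncomputable def otherWeight (u v a : A) : ℝ≥0∞ := if a = u ∨ a = v then 0 else S.weight a

variable {u v : A}

theorem Twins.ne {S : FibredSystem μ π h A ρ τ} (huv : S.Twins u v) : u ≠ v :=
  fun h => huv.trans (by rw [h])

theorem Twins.tsum_otherWeight {S : FibredSystem μ π h A ρ τ} (huv : S.Twins u v) :
    2 * S.weight u + ∑' a, S.otherWeight u v a = 1 := by
  classical
  have e := S.tsum_weight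
  rw [ENNReal.summable.tsum_eq_add_tsum_ite' u, ENNReal.summable.tsum_eq_add_tsum_ite' v,
    if_neg huv.ne.symm, ← huv.weight] at e
  rw [← e, two_mul, add_assoc]
  congr 2
  refine tsum_congr fun a => ?_
  by_cases h1 : a = v <;> by_cases h2 : a = u <;> simp [otherWeight, h1, h2]

/-- The twins are grouped before taking absolute values, so that the cancellation between them is
kept; all other letters go through the triangle inequality. -/
theorem Twins.enorm_integral_le {S : FibredSystem μ π h A ρ τ} (huv : S.Twins u v)
    [IsProbabilityMeasure μ] {H : X → ℂ} (hH : Measurable H) (hH1 : ∀ x, ‖H x‖ ≤ 1) :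
    ‖∫ x, H x ∂μ‖ₑ ≤
      2 * S.weight u * ‖∫ x, (1 / 2 : ℝ) • (H (S.map u x) + H (S.map v x)) ∂μ‖ₑ
        + ∑' a, S.otherWeight u v a * ‖∫ x, H (S.map a x) ∂μ‖ₑ := by
  classical
  have hint : ∀ a, Integrable (fun x => H (S.map a x)) μ := fun a =>
    Integrable.of_bound (hH.comp (S.measurable_map a)).aestronglyMeasurable 1
      (Filter.Eventually.of_forall fun x => hH1 _)
  set F : A → ℂ := fun a => (S.weight a).toReal • ∫ x, H (S.map a x) ∂μ with hF
  have hs := S.hasSum_integral hH hH1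
  have hs2 := hs.sub (hasSum_sum_of_ne_finset_zero (s := {u, v})
    (f := fun a => if a = u ∨ a = v then F a else 0) (fun a ha => by simp_all))
  have hsum : ∑ a ∈ ({u, v} : Finset A), (if a = u ∨ a = v then F a else 0) =
      (2 * S.weight u).toReal • ∫ x, (1 / 2 : ℝ) • (H (S.map u x) + H (S.map v x)) ∂μ := by
    rw [Finset.sum_pair huv.ne, if_pos (Or.inl rfl), if_pos (Or.inr rfl), hF]
    simp only
    rw [← huv.weight, ← smul_add, integral_smul, integral_add (hint u) (hint v), smul_smul]
    congr 1
    rw [ENNReal.toReal_mul, ENNReal.toReal_ofNat]; ring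
  have hsplit : ∫ x, H x ∂μ
      = (2 * S.weight u).toReal • ∫ x, (1 / 2 : ℝ) • (H (S.map u x) + H (S.map v x)) ∂μ
        + ∑' a, (F a - if a = u ∨ a = v then F a else 0) := by
    rw [hs2.tsum_eq, hsum]; ring
  rw [hsplit]
  refine (enorm_add_le _ _).trans (add_le_add (le_of_eq ?_) ?_)
  · rw [enorm_smul, Real.enorm_of_nonneg ENNReal.toReal_nonneg,
      ENNReal.ofReal_toReal (ENNReal.mul_ne_top (by norm_num) (S.weight_ne_top u))]
  · refine enorm_tsum_le_tsum_enorm.trans (ENNReal.tsum_le_tsum fun a => ?_)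
    by_cases ha : a = u ∨ a = v
    · simp [ha]
    · rw [if_neg ha, sub_zero, hF, otherWeight, if_neg ha]
      exact (S.enorm_weight_smul _ _).le

/-! ### The system of first returns to a pair of twins -/

/-- The composition of the maps of a word. -/
def wordComp : List A → X → X
  | [] => id
  | a :: l => S.map a ∘ wordComp l

/-- The composition of the base maps of a word. -/
def wordBase : List A → Y → Y
  | [] => id
  | a :: l => S.base a ∘ wordBase l

/-- The translation part of the action of a word on the height. -/
noncomputable def wordTrans : List A → ℝ
  | [] => 0
  | a :: l => S.ratio a * wordTrans l + S.trans a

theorem measurable_wordComp (l : List A) : Measurable (S.wordComp l) := by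
  induction l with
  | nil => exact measurable_id
  | cons a l ih => exact (S.measurable_map a).comp ih

theorem proj_wordComp (l : List A) (x : X) : π (S.wordComp l x) = S.wordBase l (π x) := by
  induction l with
  | nil => rfl
  | cons a l ih => simp [wordComp, wordBase, S.proj_map, ih]

theorem height_wordComp (l : List A) (x : X) :
    h (S.wordComp l x) = (l.map S.ratio).prod * h x + S.wordTrans l := by
  induction l with
  | nil => simp [wordComp, wordTrans]
  | cons a l ih => simp [wordComp, wordTrans, S.height_map, ih]; ring

/-- Decomposition by the word `l` of letters preceding the first twin. The part where no twin has
appeared after `n` letters has weight `Q ^ n`, which tends to `0` because the twins have positive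
weight. -/
theorem Twins.enorm_integral_le_tsum {S : FibredSystem μ π h A ρ τ} (huv : S.Twins u v)
    [IsProbabilityMeasure μ] {H : X → ℂ} (hH : Measurable H) (hH1 : ∀ x, ‖H x‖ ≤ 1) :
    ‖∫ x, H x ∂μ‖ₑ ≤ ∑' l : List A, (l.map (S.otherWeight u v)).prod * (2 * S.weight u) *
      ‖∫ x, (1 / 2 : ℝ) • (H (S.wordComp l (S.map u x)) + H (S.wordComp l (S.map v x))) ∂μ‖ₑ := by
  set T : (X → ℂ) → ℝ≥0∞ := fun H =>
    ∑' l : List A, (l.map (S.otherWeight u v)).prod * (2 * S.weight u) *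
      ‖∫ x, (1 / 2 : ℝ) • (H (S.wordComp l (S.map u x)) + H (S.wordComp l (S.map v x))) ∂μ‖ₑ
    with hT
  have hTrec : ∀ H : X → ℂ, T H
      = 2 * S.weight u * ‖∫ x, (1 / 2 : ℝ) • (H (S.map u x) + H (S.map v x)) ∂μ‖ₑ
        + ∑' a, S.otherWeight u v a * T fun x => H (S.map a x) := by
    intro H
    rw [hT]
    simp only
    rw [tsum_list]
    congr 1
    · simp [wordComp]
    · refine tsum_congr fun a => ?_
      rw [← ENNReal.tsum_mul_left]
      refine tsum_congr fun l => ?_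
      simp [wordComp, mul_assoc]
  have hQ := huv.tsum_otherWeight
  set Q := ∑' a, S.otherWeight u v a with hQdef
  have key : ∀ (n : ℕ) (H : X → ℂ), Measurable H → (∀ x, ‖H x‖ ≤ 1) →
      ‖∫ x, H x ∂μ‖ₑ ≤ T H + Q ^ n := by
    intro n
    induction n with
    | zero =>
      intro H hH hH1
      rw [pow_zero]
      refine le_trans ?_ le_add_self
      refine (enorm_integral_le_lintegral_enorm _).trans ?_
      refine (lintegral_mono (g := fun _ => 1) fun x => ?_).trans (by simp)
      rw [← ofReal_norm, ← ENNReal.ofReal_one]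
      exact ENNReal.ofReal_le_ofReal (hH1 x)
    | succ n ih =>
      intro H hH hH1
      refine (huv.enorm_integral_le hH hH1).trans ?_
      rw [hTrec, add_assoc]
      gcongr
      rw [pow_succ', hQdef, ← ENNReal.tsum_mul_right, ← ENNReal.tsum_add]
      refine ENNReal.tsum_le_tsum fun a => ?_
      rw [← mul_add]
      gcongr
      exact ih _ (hH.comp (S.measurable_map a)) fun x => hH1 _
  have hQ1 : Q < 1 := by
    refine lt_of_le_of_ne (by rw [← hQ]; exact le_add_self) fun h => ?_
    rw [h] at hQ
    have : 2 * S.weight u = 0 := by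
      have h0 : 2 * S.weight u + 1 = 0 + 1 := by rw [hQ, zero_add]
      exact (ENNReal.add_left_inj ENNReal.one_ne_top).1 h0
    exact S.weight_ne u (by simpa using this)
  have hlim := (ENNReal.tendsto_pow_atTop_nhds_zero_of_lt_one hQ1).const_add (T H)
  rw [add_zero] at hlim
  exact ge_of_tendsto' hlim fun n => key n H hH hH1

/-- The system of first returns to a pair of twins. -/
noncomputable def Twins.pairSystem {S : FibredSystem μ π h A ρ τ} (huv : S.Twins u v)
    [IsProbabilityMeasure μ] (hρ : (ρ : ℝ) ≤ 1 / 4) :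
    PairSystem μ π h ((S.trans v - S.trans u) / S.ratio u) (List A) where
  map l e := S.wordComp l ∘ S.map (bif e then v else u)
  base l := S.wordBase l ∘ S.base u
  ratio l := (l.map S.ratio).prod * S.ratio u
  trans l := (l.map S.ratio).prod * S.trans u + S.wordTrans l
  weight l := (l.map (S.otherWeight u v)).prod * (2 * S.weight u)
  measurable_map l e := (S.measurable_wordComp l).comp (S.measurable_map _)
  proj_map l e x := by cases e <;> simp [S.proj_wordComp, S.proj_map, huv.base]
  height_false l x := by simp [S.height_wordComp, S.height_map]; ring
  height_true l x := by
    have := S.ratio_ne u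
    simp only [Function.comp_apply, cond_true, S.height_wordComp, S.height_map, ← huv.ratio]
    field_simp
    ring
  ratio_bound l := by
    have h4 : ∀ r ∈ l.map S.ratio, |r| ≤ 1 := fun r hr => by
      obtain ⟨a, -, rfl⟩ := List.mem_map.1 hr
      exact (S.abs_ratio_le a).trans (hρ.trans (by norm_num))
    refine ⟨mul_ne_zero (List.prod_ne_zero fun h => ?_) (S.ratio_ne u), ?_⟩
    · obtain ⟨a, -, ha⟩ := List.mem_map.1 h; exact S.ratio_ne a ha
    · rw [abs_mul]
      have h1 := (abs_prod_le_pow h4).trans (one_pow _).le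
      have h2 := (S.abs_ratio_le u).trans hρ
      nlinarith [abs_nonneg (S.ratio u)]
  tsum_weight_le := tsum_list_prod_le (by rw [mul_one, huv.tsum_otherWeight])
  enorm_integral_le H hH hH1 := by
    simpa using huv.enorm_integral_le_tsum hH hH1

/-- At `s = 0` the sum is `1` minus the weight of the twins. Convexity in the exponent, through the
weighted mean inequality, shows that a small `s` adds at most a small multiple of the moment of
order `τ`. -/
theorem Twins.exists_tsum_otherWeight_lt_one {S : FibredSystem μ π h A ρ τ} (huv : S.Twins u v)
    (hτ : 0 < τ) : ∃ s : ℝ, 0 < s ∧ s ≤ τ ∧ s ≤ 2 ∧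
      ∑' a, S.otherWeight u v a * ENNReal.ofReal (|S.ratio a| ^ (-s)) < 1 := by
  have hQ := huv.tsum_otherWeight
  set Q := ∑' a, S.otherWeight u v a with hQdef
  set m := ∑' a, S.weight a * ENNReal.ofReal (|S.ratio a| ^ (-τ)) with hm
  have hmtop : m ≠ ∞ := S.moment
  have hwpos : 0 < 2 * S.weight u := by
    have := S.weight_ne u
    simpa [pos_iff_ne_zero] using this
  have hwtop : 2 * S.weight u ≠ ∞ := ENNReal.mul_ne_top (by norm_num) (S.weight_ne_top u)
  have hQtop : Q ≠ ∞ := ne_top_of_le_ne_top ENNReal.one_ne_top (by rw [← hQ]; exact le_add_self)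
  set w := (2 * S.weight u).toReal with hw
  have hw0 : 0 < w := ENNReal.toReal_pos hwpos.ne' hwtop
  -- The three bounds serve, in turn, the weighted mean inequality, `s ≤ 2` (so that `θ = s / 2 ≤
  -- 1`), and keeping the increase below the weight `w` of the twins.
  obtain ⟨lam, hlam⟩ : ∃ lam, lam = min (min 1 (2 / τ)) (w / (2 * (m.toReal + 1))) := ⟨_, rfl⟩
  have hmr : 0 ≤ m.toReal := ENNReal.toReal_nonneg
  have hl0 : 0 < lam := by rw [hlam]; positivity
  have hl1 : lam ≤ 1 := hlam ▸ (min_le_left _ _).trans (min_le_left _ _)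
  have hl2 : lam ≤ 2 / τ := hlam ▸ (min_le_left _ _).trans (min_le_right _ _)
  have hl3 : lam ≤ w / (2 * (m.toReal + 1)) := hlam ▸ min_le_right _ _
  refine ⟨lam * τ, by positivity, mul_le_of_le_one_left hτ.le hl1, (le_div_iff₀ hτ).1 hl2, ?_⟩
  have hpt : ∀ a, S.otherWeight u v a * ENNReal.ofReal (|S.ratio a| ^ (-(lam * τ)))
      ≤ S.otherWeight u v a
        + ENNReal.ofReal lam * (S.weight a * ENNReal.ofReal (|S.ratio a| ^ (-τ))) := by
    intro a
    have hr : 0 < |S.ratio a| := abs_pos.2 (S.ratio_ne a)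
    have h1 : |S.ratio a| ^ (-(lam * τ)) ≤ 1 + lam * |S.ratio a| ^ (-τ) := by
      have := Real.geom_mean_le_arith_mean2_weighted (w₁ := 1 - lam) (w₂ := lam) (p₁ := 1)
        (p₂ := |S.ratio a| ^ (-τ)) (by linarith) hl0.le zero_le_one (by positivity) (by ring)
      rw [Real.one_rpow, one_mul, ← Real.rpow_mul hr.le] at this
      rw [show -(lam * τ) = -τ * lam by ring]
      linarith
    have h2 : S.otherWeight u v a ≤ S.weight a := by
      unfold otherWeight; split_ifs <;> simp
    calc _ ≤ S.otherWeight u v a * ENNReal.ofReal (1 + lam * |S.ratio a| ^ (-τ)) := by gcongr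
      _ = S.otherWeight u v a
          + ENNReal.ofReal lam * (S.otherWeight u v a * ENNReal.ofReal (|S.ratio a| ^ (-τ))) := by
          rw [ENNReal.ofReal_add zero_le_one (by positivity), ENNReal.ofReal_mul hl0.le,
            ENNReal.ofReal_one]
          ring
      _ ≤ _ := by gcongr
  refine (ENNReal.tsum_le_tsum hpt).trans_lt ?_
  rw [ENNReal.tsum_add, ENNReal.tsum_mul_left, ← hm, ← hQ, add_comm]
  refine ENNReal.add_lt_add_right hQtop ?_
  rw [← ENNReal.ofReal_toReal hmtop, ← ENNReal.ofReal_mul hl0.le, ← ENNReal.ofReal_toReal hwtop,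
    ← hw]
  refine (ENNReal.ofReal_lt_ofReal_iff hw0).2 ?_
  calc lam * m.toReal ≤ w / (2 * (m.toReal + 1)) * m.toReal := by gcongr
    _ < w := by
      rw [div_mul_eq_mul_div, div_lt_iff₀ (by positivity)]
      nlinarith

end FibredSystem

/-- Decay of the oscillating integrals of all fibrewise regular functions. -/
def FibreDecay {X Y : Type*} [MeasurableSpace X] (μ : Measure X) (π : X → Y) (h : X → ℝ)
    (θ η C : ℝ) : Prop :=
  ∀ (G : X → ℝ) (f g : Y → ℝ → ℝ) (M₁ M₂ m : ℝ), Measurable G → 0 ≤ M₁ → 0 ≤ M₂ → 0 < m →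
    (∀ y, FibreRegular (f y) (g y) M₁ M₂ m) → (∀ x, G x = f (π x) (h x)) →
    ∀ ξ : ℝ, ξ ≠ 0 → ‖∫ x, osc (ξ * G x) ∂μ‖
      ≤ C * (1 + M₁ + M₂) * (1 + m ^ (-θ)) * |ξ| ^ (-η)

/-! ### Decay for systems with twins -/

namespace FibredSystem

theorem Twins.exists_fibreDecay_of_le {X Y : Type*} [PseudoEMetricSpace X] [MeasurableSpace X]
    {μ : Measure X} [IsProbabilityMeasure μ] {π : X → Y} {h : X → ℝ} {A : Type*} {ρ : NNReal}
    {τ : ℝ} {S : FibredSystem μ π h A ρ τ} {u v : A} (huv : S.Twins u v)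
    (hh : ∀ x, h x ∈ Icc (0 : ℝ) 1) (hτ : 0 < τ) (hρ : (ρ : ℝ) ≤ 1 / 4) :
    ∃ θ η C : ℝ, 0 < θ ∧ 2 * θ ≤ τ ∧ 0 < η ∧ 0 < C ∧ FibreDecay μ π h θ η C := by
  obtain ⟨s, hs0, hsτ, hs2, hs⟩ := huv.exists_tsum_otherWeight_lt_one hτ
  have hc : (S.trans v - S.trans u) / S.ratio u ≠ 0 :=
    div_ne_zero (sub_ne_zero.2 huv.trans.symm) (S.ratio_ne u)
  have hmoment : ∑' l, (huv.pairSystem hρ).weight l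
      * ENNReal.ofReal (|(huv.pairSystem hρ).ratio l| ^ (-(2 * (s / 2)))) ≠ ∞ := by
    rw [mul_div_cancel₀ s two_ne_zero]
    set Q := ∑' a, S.otherWeight u v a * ENNReal.ofReal (|S.ratio a| ^ (-s)) with hQ
    set e := 2 * S.weight u * ENNReal.ofReal (|S.ratio u| ^ (-s)) with he
    -- The moment of the first-return words is a geometric series with ratio `Q < 1`.
    have hsub0 : 1 - Q ≠ 0 := (tsub_pos_of_lt hs).ne'
    have hsubt : 1 - Q ≠ ∞ := ENNReal.sub_ne_top ENNReal.one_ne_top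
    have hle := tsum_list_prod_le (A := A)
      (x := fun a => S.otherWeight u v a * ENNReal.ofReal (|S.ratio a| ^ (-s))) (e := e)
      (W := e * (1 - Q)⁻¹) (by
        rw [← hQ]
        refine le_of_eq ?_
        calc e + Q * (e * (1 - Q)⁻¹)
            = e * ((1 - Q) * (1 - Q)⁻¹) + Q * (e * (1 - Q)⁻¹) := by
              rw [ENNReal.mul_inv_cancel hsub0 hsubt, mul_one]
          _ = e * (1 - Q)⁻¹ * ((1 - Q) + Q) := by ring
          _ = e * (1 - Q)⁻¹ := by rw [tsub_add_cancel_of_le hs.le, mul_one])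
    refine ne_top_of_le_ne_top (ENNReal.mul_ne_top ?_ (ENNReal.inv_ne_top.2 hsub0))
      (le_trans (le_of_eq (tsum_congr fun l => ?_)) hle)
    · exact ENNReal.mul_ne_top (ENNReal.mul_ne_top (by norm_num) (S.weight_ne_top u))
        ENNReal.ofReal_ne_top
    · simp only [Twins.pairSystem, abs_mul]
      rw [Real.mul_rpow (abs_nonneg _) (abs_nonneg _), ENNReal.ofReal_mul (by positivity),
        ← prod_map_rpow, List.prod_map_mul, he]
      ring
  obtain ⟨η, C, hη, hC, hmain⟩ := (huv.pairSystem hρ).exists_norm_integral_osc_le_rpow hh hc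
    (θ := s / 2) (by positivity) (by linarith) hmoment
  exact ⟨s / 2, η, C, by positivity, by linarith, hη, hC, hmain⟩

/-- Passing to twofold compositions squares `ρ` and preserves twins, the measure and the moment
exponent, so one may assume `ρ ≤ 1/4`. -/
theorem Twins.exists_fibreDecay {X Y : Type*} [PseudoEMetricSpace X] [MeasurableSpace X]
    {μ : Measure X} [IsProbabilityMeasure μ] {π : X → Y} {h : X → ℝ} {A : Type*} {ρ : NNReal}
    {τ : ℝ} {S : FibredSystem μ π h A ρ τ} {u v : A} (huv : S.Twins u v)
    (hh : ∀ x, h x ∈ Icc (0 : ℝ) 1) (hτ : 0 < τ) (hρ : ρ < 1) :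
    ∃ θ η C : ℝ, 0 < θ ∧ 2 * θ ≤ τ ∧ 0 < η ∧ 0 < C ∧ FibreDecay μ π h θ η C := by
  obtain ⟨n, hn⟩ := exists_pow_lt_of_lt_one (show (0 : ℝ) < 1 / 4 by norm_num)
    (show (ρ : ℝ) < 1 from mod_cast hρ)
  have hn2 : (ρ : ℝ) ^ 2 ^ n ≤ 1 / 4 :=
    (pow_le_pow_of_le_one ρ.2 (by exact_mod_cast hρ.le) Nat.lt_two_pow_self.le).trans hn.le
  clear hn hρ
  induction n generalizing A ρ with
  | zero => exact huv.exists_fibreDecay_of_le hh hτ (by simpa using hn2)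
  | succ n ih =>
    refine ih huv.sq ?_
    rw [NNReal.coe_mul, ← pow_two, ← pow_mul, ← pow_succ']
    exact hn2

end FibredSystem

/-! ### Smooth functions on the unit interval -/

theorem exists_derivWithin_mul_eq {G : ℝ → ℝ} (hG : DifferentiableOn ℝ G (Icc 0 1)) {u w : ℝ}
    (hu : u ∈ Icc (0 : ℝ) 1) (hw : w ∈ Icc (0 : ℝ) 1) :
    ∃ z ∈ uIcc u w, G w - G u = derivWithin G (Icc 0 1) z * (w - u) := by
  have key : ∀ a b : ℝ, a ∈ Icc (0 : ℝ) 1 → b ∈ Icc (0 : ℝ) 1 → a < b →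
      ∃ z ∈ uIcc a b, G b - G a = derivWithin G (Icc 0 1) z * (b - a) := by
    intro a b ha hb hab
    have hsub : Icc a b ⊆ Icc (0 : ℝ) 1 := Icc_subset_Icc ha.1 hb.2
    obtain ⟨z, hz, hzeq⟩ := exists_hasDerivAt_eq_slope G (derivWithin G (Icc 0 1)) hab
      (hG.continuousOn.mono hsub) fun x hx =>
        ((hG x (hsub (Ioo_subset_Icc_self hx))).hasDerivWithinAt).hasDerivAt
          (Icc_mem_nhds (ha.1.trans_lt hx.1) (hx.2.trans_le hb.2))
    refine ⟨z, by rw [uIcc_of_le hab.le]; exact Ioo_subset_Icc_self hz, ?_⟩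
    rw [hzeq, div_mul_cancel₀ _ (sub_pos.2 hab).ne']
  rcases lt_trichotomy u w with h | h | h
  · exact key u w hu hw h
  · exact ⟨u, left_mem_uIcc, by rw [h]; ring⟩
  · obtain ⟨z, hz, hzeq⟩ := key w u hw hu h
    exact ⟨z, by rwa [uIcc_comm], by linarith⟩

/-- A `C²` function restricted to an affinely parametrised subinterval of `[0,1]`. -/
theorem fibreRegular_comp_affine {f : ℝ → ℝ} (hf : ContDiffOn ℝ 2 f (Icc 0 1)) {M₁ M₂ m r t : ℝ}
    (hM₁ : ∀ s ∈ Icc (0 : ℝ) 1, |iteratedDerivWithin 1 f (Icc 0 1) s| ≤ M₁)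
    (hM₂ : ∀ s ∈ Icc (0 : ℝ) 1, |iteratedDerivWithin 2 f (Icc 0 1) s| ≤ M₂)
    (hr : r ≠ 0) (hr1 : |r| ≤ 1) (hmaps : ∀ s ∈ Icc (0 : ℝ) 1, r * s + t ∈ Icc (0 : ℝ) 1)
    (hm : ∀ s ∈ Icc (0 : ℝ) 1, m ≤ |iteratedDerivWithin 2 f (Icc 0 1) (r * s + t)|) :
    FibreRegular (fun s => f (r * s + t))
      (fun s => r * iteratedDerivWithin 1 f (Icc 0 1) (r * s + t)) M₁ M₂ (r ^ 2 * m) := by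
  have hU : UniqueDiffOn ℝ (Icc (0 : ℝ) 1) := uniqueDiffOn_Icc_zero_one
  have hd0 : DifferentiableOn ℝ f (Icc 0 1) := hf.differentiableOn (by norm_num)
  have hd1 : DifferentiableOn ℝ (iteratedDerivWithin 1 f (Icc 0 1)) (Icc 0 1) :=
    hf.differentiableOn_iteratedDerivWithin (by norm_num) hU
  have hseg : ∀ {s s' z : ℝ}, s ∈ Icc (0 : ℝ) 1 → s' ∈ Icc (0 : ℝ) 1 →
      z ∈ uIcc (r * s + t) (r * s' + t) → ∃ s₀ ∈ uIcc s s', z = r * s₀ + t := by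
    intro s s' z hs hs' hz
    refine ⟨(z - t) / r, ?_, by field_simp; ring⟩
    rw [mem_uIcc] at hz ⊢
    rcases lt_or_gt_of_ne hr with h | h
    · rw [le_div_iff_of_neg h, div_le_iff_of_neg h, le_div_iff_of_neg h, div_le_iff_of_neg h]
      rcases hz with hz | hz
      · right; constructor <;> linarith [hz.1, hz.2]
      · left; constructor <;> linarith [hz.1, hz.2]
    · rw [le_div_iff₀ h, div_le_iff₀ h, le_div_iff₀ h, div_le_iff₀ h]
      rcases hz with hz | hz
      · left; constructor <;> linarith [hz.1, hz.2]
      · right; constructor <;> linarith [hz.1, hz.2]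
  have hinc : ∀ {s s' : ℝ}, s ∈ Icc (0 : ℝ) 1 → s' ∈ Icc (0 : ℝ) 1 → uIcc s s' ⊆ Icc 0 1 :=
    fun hs hs' => ordConnected_Icc.uIcc_subset hs hs'
  refine ⟨fun s hs => ?_, fun s hs s' hs' => ?_, fun s hs s' hs' => ?_⟩
  · rw [abs_mul]
    exact (mul_le_of_le_one_left (abs_nonneg _) hr1).trans (hM₁ _ (hmaps s hs))
  · obtain ⟨z, hz, hzeq⟩ := exists_derivWithin_mul_eq hd0 (hmaps s hs) (hmaps s' hs')
    have hzI := hinc (hmaps s hs) (hmaps s' hs') hz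
    obtain ⟨z', hz', hz'eq⟩ := exists_derivWithin_mul_eq hd1 (hmaps s hs) hzI
    have hz'I := hinc (hmaps s hs) hzI hz'
    rw [← iteratedDerivWithin_succ] at hz'eq
    rw [← iteratedDerivWithin_one] at hzeq
    have h1 : |z - (r * s + t)| ≤ |r * s' + t - (r * s + t)| :=
      abs_sub_left_of_mem_uIcc hz
    rw [hzeq, show iteratedDerivWithin 1 f (Icc 0 1) z * (r * s' + t - (r * s + t))
        - r * iteratedDerivWithin 1 f (Icc 0 1) (r * s + t) * (s' - s)
        = (iteratedDerivWithin 1 f (Icc 0 1) z - iteratedDerivWithin 1 f (Icc 0 1) (r * s + t))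
          * (r * s' + t - (r * s + t)) by ring, hz'eq, abs_mul, abs_mul]
    have h2 : |r * s' + t - (r * s + t)| ≤ |s' - s| := by
      rw [show r * s' + t - (r * s + t) = r * (s' - s) by ring, abs_mul]
      exact mul_le_of_le_one_left (abs_nonneg _) hr1
    have hM : 0 ≤ M₂ := (abs_nonneg _).trans (hM₂ z' hz'I)
    rw [pow_two, ← mul_assoc]
    have h3 := hM₂ z' hz'I
    exact mul_le_mul (mul_le_mul h3 (h1.trans h2) (abs_nonneg _) hM) h2 (abs_nonneg _)
      (by positivity)
  · obtain ⟨z, hz, hzeq⟩ := exists_derivWithin_mul_eq hd1 (hmaps s hs) (hmaps s' hs')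
    rw [← iteratedDerivWithin_succ] at hzeq
    -- The mean value point is pulled back to the parameter interval: the lower bound `m` is only
    -- assumed on the affine image.
    obtain ⟨s₀, hs₀, rfl⟩ := hseg hs hs' hz
    have h1 := hm s₀ (hinc hs hs' hs₀)
    rw [← mul_sub, abs_mul, abs_sub_comm (iteratedDerivWithin 1 f (Icc 0 1) (r * s + t)), hzeq,
      abs_mul, show r * s' + t - (r * s + t) = r * (s' - s) by ring, abs_mul, abs_sub_comm s s',
      ← sq_abs r]
    calc |r| ^ 2 * m * |s' - s| = |r| * (m * (|r| * |s' - s|)) := by ring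
      _ ≤ _ := mul_le_mul_of_nonneg_left
          (mul_le_mul_of_nonneg_right h1 (by positivity)) (abs_nonneg r)

/-! ### The unit cube -/

section cube

variable {d : ℕ}

theorem cube_eq_preimage (n : ℕ) :
    cube n = EuclideanSpace.equiv (Fin n) ℝ ⁻¹' (univ.pi fun _ => Icc (0 : ℝ) 1) := by
  ext x
  simp only [cube, mem_preimage, mem_univ_pi]
  rfl

theorem isCompact_cube (n : ℕ) : IsCompact (cube n) := by
  rw [cube_eq_preimage]
  exact (EuclideanSpace.equiv (Fin n) ℝ).toHomeomorph.isCompact_preimage.2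
    (isCompact_univ_pi fun _ => isCompact_Icc)

instance (n : ℕ) : CompactSpace (cube n) := isCompact_iff_compactSpace.1 (isCompact_cube n)

instance (n : ℕ) : Nonempty (cube n) := ⟨⟨0, fun i => by simp⟩⟩

theorem uniqueDiffOn_cube (n : ℕ) : UniqueDiffOn ℝ (cube n) := by
  rw [cube_eq_preimage]
  exact (EuclideanSpace.equiv (Fin n) ℝ).uniqueDiffOn_preimage_iff.2
    (UniqueDiffOn.univ_pi fun _ => uniqueDiffOn_Icc_zero_one)

@[simp] theorem cubeInit_cubeSnoc (y : cube d) (s : unitInterval) : cubeInit (cubeSnoc y s) = y := by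
  ext i; simp [cubeInit, cubeSnoc]

@[simp] theorem cubeLast_cubeSnoc (y : cube d) (s : unitInterval) : cubeLast (cubeSnoc y s) = s := by
  ext; simp [cubeLast, cubeSnoc]

@[simp] theorem cubeSnoc_init_last (x : cube (d + 1)) :
    cubeSnoc (cubeInit x) (cubeLast x) = x := by
  ext i
  refine Fin.lastCases ?_ (fun j => ?_) i <;> simp [cubeInit, cubeLast, cubeSnoc]

/-- The restriction of a function to the fibre above `y`. -/
noncomputable def onFibre (F : EuclideanSpace ℝ (Fin (d + 1)) → ℝ) (y : cube d) (s : ℝ) : ℝ :=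
  F (WithLp.toLp 2 (Fin.snoc (α := fun _ => ℝ) (fun i => y.1 i) s))

theorem apply_eq_onFibre (F : EuclideanSpace ℝ (Fin (d + 1)) → ℝ) (x : cube (d + 1)) :
    F x = onFibre F (cubeInit x) (cubeLast x) := by
  conv_lhs => rw [← cubeSnoc_init_last x]
  rfl

theorem partialLast_cubeSnoc (k : ℕ) (F : EuclideanSpace ℝ (Fin (d + 1)) → ℝ) (y : cube d)
    (s : unitInterval) :
    partialLast k F (cubeSnoc y s) = iteratedDerivWithin k (onFibre F y) (Icc 0 1) s := by
  have h1 : (cubeSnoc y s).1 (Fin.last d) = s := by simp [cubeSnoc]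
  have h2 : (fun i => (cubeSnoc y s).1 i) = Fin.snoc (α := fun _ => ℝ) (fun i => y.1 i) (s : ℝ) := rfl
  rw [partialLast, h1, h2]
  simp only [Fin.update_snoc_last]
  rfl

variable {F : EuclideanSpace ℝ (Fin (d + 1)) → ℝ}

theorem hasDerivAt_snoc (y : cube d) (s : ℝ) : HasDerivAt
    (fun s : ℝ => (WithLp.toLp 2 (Fin.snoc (α := fun _ => ℝ) (fun i => y.1 i) s) :
      EuclideanSpace ℝ (Fin (d + 1)))) (EuclideanSpace.single (Fin.last d) 1) s := by
  have h : (fun s : ℝ => (WithLp.toLp 2 (Fin.snoc (α := fun _ => ℝ) (fun i => y.1 i) s) :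
      EuclideanSpace ℝ (Fin (d + 1)))) = fun s =>
        WithLp.toLp 2 (Fin.snoc (α := fun _ => ℝ) (fun i => y.1 i) 0)
          + s • EuclideanSpace.single (Fin.last d) (1 : ℝ) := by
    funext s
    ext i
    refine Fin.lastCases ?_ (fun j => ?_) i
    · simp
    · simp [Fin.castSucc_ne_last]
  rw [h]
  simpa using ((hasDerivAt_id s).smul_const (EuclideanSpace.single (Fin.last d) (1 : ℝ))).const_add
    (WithLp.toLp 2 (Fin.snoc (α := fun _ => ℝ) (fun i => y.1 i) (0 : ℝ)) :
      EuclideanSpace ℝ (Fin (d + 1)))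

theorem mapsTo_snoc (y : cube d) : MapsTo
    (fun s : ℝ => (WithLp.toLp 2 (Fin.snoc (α := fun _ => ℝ) (fun i => y.1 i) s) :
      EuclideanSpace ℝ (Fin (d + 1)))) (Icc 0 1) (cube (d + 1)) :=
  fun s hs => (cubeSnoc y ⟨s, hs⟩).2

theorem derivWithin_onFibre (hF : DifferentiableOn ℝ F (cube (d + 1))) (y : cube d) {s : ℝ}
    (hs : s ∈ Icc (0 : ℝ) 1) : derivWithin (onFibre F y) (Icc 0 1) s =
      onFibre (fun x => fderivWithin ℝ F (cube (d + 1)) x (EuclideanSpace.single (Fin.last d) 1))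
        y s := by
  have h1 := (hF _ (mapsTo_snoc y hs)).hasFDerivWithinAt
  exact (h1.comp_hasDerivWithinAt s (hasDerivAt_snoc y s).hasDerivWithinAt
    (mapsTo_snoc y)).derivWithin (uniqueDiffOn_Icc_zero_one s hs)

theorem contDiffOn_onFibre (hF : ContDiffOn ℝ 2 F (cube (d + 1))) (y : cube d) :
    ContDiffOn ℝ 2 (onFibre F y) (Icc 0 1) := by
  have h : ContDiff ℝ 2 fun s : ℝ => (WithLp.toLp 2 (Fin.snoc (α := fun _ => ℝ)
      (fun i => y.1 i) s) : EuclideanSpace ℝ (Fin (d + 1))) := by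
    rw [contDiff_euclidean]
    intro i
    refine Fin.lastCases ?_ (fun j => ?_) i
    · simp only [Fin.snoc_last]
      exact contDiff_id
    · simp only [Fin.snoc_castSucc]
      exact contDiff_const
  exact hF.comp h.contDiffOn (mapsTo_snoc y)

theorem contDiffOn_fderivWithin_single (hF : ContDiffOn ℝ 2 F (cube (d + 1))) :
    ContDiffOn ℝ 1 (fun x => fderivWithin ℝ F (cube (d + 1)) x
      (EuclideanSpace.single (Fin.last d) 1)) (cube (d + 1)) :=
  (hF.fderivWithin (uniqueDiffOn_cube _) (by norm_num)).clm_apply contDiffOn_const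

theorem continuous_partialLast_one (hF : ContDiffOn ℝ 2 F (cube (d + 1))) :
    Continuous fun x : cube (d + 1) => partialLast 1 F x := by
  have h : (fun x : cube (d + 1) => partialLast 1 F x) = (cube (d + 1)).domRestrict fun x =>
      fderivWithin ℝ F (cube (d + 1)) x (EuclideanSpace.single (Fin.last d) 1) := by
    funext x
    conv_lhs => rw [← cubeSnoc_init_last x]
    rw [partialLast_cubeSnoc, iteratedDerivWithin_one,
      derivWithin_onFibre (hF.differentiableOn (by norm_num)) _ (cubeLast x).2, ← apply_eq_onFibre]
    rfl
  rw [h]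
  exact (contDiffOn_fderivWithin_single hF).continuousOn.domRestrict

/-- Fibrewise one-sided derivatives agree with derivatives within the cube in the last direction;
these are continuous because the cube has unique derivatives. -/
theorem continuous_partialLast_two (hF : ContDiffOn ℝ 2 F (cube (d + 1))) :
    Continuous fun x : cube (d + 1) => partialLast 2 F x := by
  have hG := contDiffOn_fderivWithin_single hF
  have h : (fun x : cube (d + 1) => partialLast 2 F x) = (cube (d + 1)).domRestrict fun x =>
      fderivWithin ℝ (fun x => fderivWithin ℝ F (cube (d + 1)) x
        (EuclideanSpace.single (Fin.last d) 1)) (cube (d + 1)) x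
        (EuclideanSpace.single (Fin.last d) 1) := by
    funext x
    conv_lhs => rw [← cubeSnoc_init_last x]
    rw [partialLast_cubeSnoc, iteratedDerivWithin_succ, iteratedDerivWithin_one,
      derivWithin_congr (fun s hs => derivWithin_onFibre (hF.differentiableOn (by norm_num)) _ hs)
        (derivWithin_onFibre (hF.differentiableOn (by norm_num)) _ (cubeLast x).2),
      derivWithin_onFibre (hG.differentiableOn (by norm_num)) _ (cubeLast x).2, ← apply_eq_onFibre]
    rfl
  rw [h]
  exact ((hG.continuousOn_fderivWithin (uniqueDiffOn_cube _) le_rfl).clm_apply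
    continuousOn_const).domRestrict

theorem abs_partialLast_le_normSup {k : ℕ}
    (hF : Continuous fun x : cube (d + 1) => partialLast k F x) (x : cube (d + 1)) :
    |partialLast k F x| ≤ normSup k F :=
  le_ciSup (f := fun x : cube (d + 1) => |partialLast k F x|)
    (isCompact_range hF.abs).bddAbove x

theorem normSup_nonneg (k : ℕ) (F : EuclideanSpace ℝ (Fin (d + 1)) → ℝ) : 0 ≤ normSup k F :=
  Real.iSup_nonneg fun _ => abs_nonneg _

theorem normMin_le_abs_partialLast (k : ℕ) (F : EuclideanSpace ℝ (Fin (d + 1)) → ℝ)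
    (x : cube (d + 1)) : normMin k F ≤ |partialLast k F x| :=
  ciInf_le (f := fun x : cube (d + 1) => |partialLast k F x|)
    ⟨0, by rintro _ ⟨x, rfl⟩; exact abs_nonneg _⟩ x

theorem normMin_pos {k : ℕ} (hF : Continuous fun x : cube (d + 1) => partialLast k F x)
    (h0 : ∀ x ∈ cube (d + 1), partialLast k F x ≠ 0) : 0 < normMin k F := by
  obtain ⟨x, -, hx⟩ := isCompact_univ.exists_isMinOn univ_nonempty hF.abs.continuousOn
  exact (abs_pos.2 (h0 x x.2)).trans_le (le_ciInf fun y => hx (mem_univ y))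

theorem fourierTransform_pushforward (hF : ContinuousOn F (cube (d + 1)))
    (μ : Measure (cube (d + 1))) (ξ : ℝ) :
    fourierTransform (pushforward F μ) ξ = ∫ x : cube (d + 1), osc (ξ * F x) ∂μ := by
  have hm : Measurable fun x : cube (d + 1) => F x := hF.domRestrict.measurable
  rw [fourierTransform, pushforward, integral_map hm.aemeasurable
    (by fun_prop)]
  simp only [osc, mul_assoc]

end cube

/-! ### Decay for functions that are regular on the images of the maps of a system -/

namespace FibredSystem

variable {X Y : Type*} [MetricSpace X] [MeasurableSpace X] {μ : Measure X}
  {π : X → Y} {h : X → ℝ} {A : Type*} {ρ : NNReal} {τ : ℝ}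

theorem exists_nonempty_pow {A : Type u} (S : FibredSystem μ π h A ρ τ) (n : ℕ) :
    ∃ A' : Type u, Nonempty (FibredSystem μ π h A' (ρ ^ 2 ^ n) τ) := by
  induction n with
  | zero => exact ⟨A, ⟨by simpa using S⟩⟩
  | succ n ih =>
    obtain ⟨A', ⟨S'⟩⟩ := ih
    refine ⟨A' × A', ⟨?_⟩⟩
    rw [pow_succ, mul_two, pow_add]
    exact S'.sq

/-- A neighbourhood of the image has at least the mass `weight a` times that of its preimage, which
is a neighbourhood of `x`. -/
theorem map_mem_support [BorelSpace X] (S : FibredSystem μ π h A ρ τ) (a : A) {x : X}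
    (hx : x ∈ μ.support) : S.map a x ∈ μ.support := by
  rw [Measure.mem_support_iff_forall] at hx ⊢
  intro U hU
  obtain ⟨V, hVU, hV, hxV⟩ := mem_nhds_iff.1 hU
  refine lt_of_lt_of_le ?_ (measure_mono hVU)
  have h1 := S.lintegral_eq (V.indicator 1) (measurable_one.indicator hV.measurableSet)
  rw [lintegral_indicator_one hV.measurableSet] at h1
  rw [h1]
  refine lt_of_lt_of_le ?_ (ENNReal.le_tsum a)
  have h2 : ∀ x, V.indicator (1 : X → ℝ≥0∞) (S.map a x) = (S.map a ⁻¹' V).indicator 1 x :=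
    fun x => rfl
  simp only [h2]
  rw [lintegral_indicator_one (S.measurable_map a hV.measurableSet)]
  exact ENNReal.mul_pos (S.weight_ne a)
    (hx _ ((S.lipschitz a).continuous.continuousAt.preimage_mem_nhds (hV.mem_nhds hxV))).ne'

/-- Stationarity writes the integral as a mean over letters. Composing with a map scales the second
derivative by `ratio a ^ 2`, at a cost `|ratio a|^(-2θ)`, which is summable because `2θ ≤ τ`. The
exponent `η` is unchanged. -/
theorem exists_norm_integral_osc_le_of_maps [IsProbabilityMeasure μ]
    (S : FibredSystem μ π h A ρ τ) (hρ : ρ ≤ 1) {θ η C : ℝ} (hθτ : 2 * θ ≤ τ)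
    (hC : 0 < C) (hdec : FibreDecay μ π h θ η C) {G : X → ℝ} (hG : Measurable G)
    {f g : A → Y → ℝ → ℝ} {M₁ M₂ m : ℝ} (hM₁ : 0 ≤ M₁) (hM₂ : 0 ≤ M₂) (hm : 0 < m)
    (hfg : ∀ a y, FibreRegular (f a y) (g a y) M₁ M₂ (S.ratio a ^ 2 * m))
    (hGf : ∀ a x, G (S.map a x) = f a (π x) (h x)) :
    ∃ C' : ℝ, 0 < C' ∧ ∀ ξ : ℝ, ξ ≠ 0 → ‖∫ x, osc (ξ * G x) ∂μ‖ ≤ C' * |ξ| ^ (-η) := by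
  set W : ℝ≥0∞ := ∑' a, S.weight a * ENNReal.ofReal (|S.ratio a| ^ (-τ)) with hW
  have hpt : ∀ a, S.weight a * ENNReal.ofReal (1 + (S.ratio a ^ 2 * m) ^ (-θ))
      ≤ S.weight a + ENNReal.ofReal (m ^ (-θ))
        * (S.weight a * ENNReal.ofReal (|S.ratio a| ^ (-τ))) := by
    intro a
    have hr := abs_pos.2 (S.ratio_ne a)
    have hr1 : |S.ratio a| ≤ 1 := (S.abs_ratio_le a).trans (by exact_mod_cast hρ)
    have h1 : (S.ratio a ^ 2 * m) ^ (-θ) ≤ m ^ (-θ) * |S.ratio a| ^ (-τ) := by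
      rw [← sq_abs, Real.mul_rpow (by positivity) hm.le, mul_comm]
      gcongr
      rw [← Real.rpow_natCast, ← Real.rpow_mul hr.le]
      exact Real.rpow_le_rpow_of_exponent_ge hr hr1 (by push_cast; linarith)
    calc _ ≤ S.weight a * ENNReal.ofReal (1 + m ^ (-θ) * |S.ratio a| ^ (-τ)) := by gcongr
      _ = _ := by
        rw [ENNReal.ofReal_add zero_le_one (by positivity), ENNReal.ofReal_mul (by positivity),
          ENNReal.ofReal_one]
        ring
  set B : ℝ≥0∞ := 1 + ENNReal.ofReal (m ^ (-θ)) * W with hB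
  have hBtop : B ≠ ∞ := ENNReal.add_ne_top.2
    ⟨ENNReal.one_ne_top, ENNReal.mul_ne_top ENNReal.ofReal_ne_top S.moment⟩
  have hsum : ∑' a, S.weight a * ENNReal.ofReal (1 + (S.ratio a ^ 2 * m) ^ (-θ)) ≤ B := by
    refine (ENNReal.tsum_le_tsum hpt).trans (le_of_eq ?_)
    rw [ENNReal.tsum_add, ENNReal.tsum_mul_left, S.tsum_weight]
  have hB0 : 0 < B.toReal := ENNReal.toReal_pos (by simp [hB]) hBtop
  refine ⟨C * (1 + M₁ + M₂) * B.toReal, by positivity, fun ξ hξ => ?_⟩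
  have hξp := abs_pos.2 hξ
  rw [← ENNReal.ofReal_le_ofReal_iff (by positivity), ofReal_norm]
  refine (S.enorm_integral_le (continuous_osc.measurable.comp (hG.const_mul ξ))
    fun x => (norm_osc _).le).trans ?_
  have hterm : ∀ a, S.weight a * ‖∫ x, osc (ξ * G (S.map a x)) ∂μ‖ₑ ≤
      ENNReal.ofReal (C * (1 + M₁ + M₂) * |ξ| ^ (-η))
        * (S.weight a * ENNReal.ofReal (1 + (S.ratio a ^ 2 * m) ^ (-θ))) := by
    intro a
    have hr := S.ratio_ne a
    have h1 := hdec (fun x => G (S.map a x)) (f a) (g a) M₁ M₂ _ (hG.comp (S.measurable_map a))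
      hM₁ hM₂ (by positivity) (hfg a) (hGf a) ξ hξ
    rw [mul_left_comm, ← ENNReal.ofReal_mul (by positivity), ← ofReal_norm]
    gcongr
    exact h1.trans (le_of_eq (by ring))
  refine (ENNReal.tsum_le_tsum hterm).trans ?_
  rw [ENNReal.tsum_mul_left]
  calc _ ≤ ENNReal.ofReal (C * (1 + M₁ + M₂) * |ξ| ^ (-η)) * ENNReal.ofReal B.toReal := by
        rw [ENNReal.ofReal_toReal hBtop]; gcongr
    _ = _ := by rw [← ENNReal.ofReal_mul (by positivity)]; congr 1; ring

end FibredSystem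

/-! ### Fibre product systems -/

theorem dist_cubeSnoc_zero_one {d : ℕ} (y : cube d) : dist (cubeSnoc y 0) (cubeSnoc y 1) = 1 := by
  rw [Subtype.dist_eq, EuclideanSpace.dist_eq, Fin.sum_univ_castSucc]
  simp [cubeSnoc]

theorem abs_last_sub_le_dist {d : ℕ} (x y : cube (d + 1)) :
    |(cubeLast x : ℝ) - cubeLast y| ≤ dist x y := by
  rw [Subtype.dist_eq, dist_eq_norm]
  exact PiLp.norm_apply_le (x.1 - y.1) (Fin.last d)

namespace FibreProductCIFS

variable {d : ℕ} {J : Type*} {L : J → Type*} (S : FibreProductCIFS d J L)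

/-- The end points of a vertical fibre are at distance `1`, and their images differ in height by the
ratio. -/
theorem abs_ratio_le {K : NNReal} (hK : ∀ a, ContractingWith K (S.maps a)) (a : Σ j, L j) :
    |S.ratio a.1 a.2| ≤ K := by
  obtain ⟨y⟩ : Nonempty (cube d) := inferInstance
  have h1 := (hK a).2.dist_le_mul (cubeSnoc y 0) (cubeSnoc y 1)
  rw [dist_cubeSnoc_zero_one, mul_one] at h1
  refine le_trans ?_ ((abs_last_sub_le_dist _ _).trans h1)
  simp [maps, prodMaps, S.fibre_eq]

/-- A stationary measure of a fibre product system as a stationary measure of a system of maps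
that are affine in the last coordinate. -/
noncomputable def fibredSystem {K : NNReal} (hK : ∀ a, ContractingWith K (S.maps a))
    {p : (Σ j, L j) → ℝ} (hp_pos : ∀ a, 0 < p a) (hp_sum : HasSum p 1) {τ : ℝ}
    (hmoment : Summable fun a : (Σ j, L j) => p a * |S.ratio a.1 a.2| ^ (-τ))
    {μ : Measure (cube (d + 1))} (hμ : IsStationary S.maps p μ) :
    FibredSystem μ cubeInit (fun x => (cubeLast x : ℝ)) (Σ j, L j) K τ where
  map := S.maps
  base a := S.base a.1
  ratio a := S.ratio a.1 a.2
  trans a := S.trans a.1 a.2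
  weight a := ENNReal.ofReal (p a)
  lipschitz a := (hK a).2
  measurable_map a := (hK a).2.continuous.measurable
  proj_map a x := by simp [maps, prodMaps]
  height_map a x := by simp [maps, prodMaps, S.fibre_eq]
  ratio_ne a := abs_pos.1 (S.abs_ratio_mem _ _).1
  abs_ratio_le := S.abs_ratio_le hK
  weight_ne a := (ENNReal.ofReal_pos.2 (hp_pos a)).ne'
  tsum_weight := by
    rw [← ENNReal.ofReal_tsum_of_nonneg (fun a => (hp_pos a).le) hp_sum.summable, hp_sum.tsum_eq,
      ENNReal.ofReal_one]
  moment := by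
    have h : ∀ a : Σ j, L j, ENNReal.ofReal (p a) * ENNReal.ofReal (|S.ratio a.1 a.2| ^ (-τ))
        = ENNReal.ofReal (p a * |S.ratio a.1 a.2| ^ (-τ)) := fun a =>
      (ENNReal.ofReal_mul (hp_pos a).le).symm
    simp only [h]
    rw [← ENNReal.ofReal_tsum_of_nonneg (fun a => mul_nonneg (hp_pos a).le (by positivity)) hmoment]
    exact ENNReal.ofReal_ne_top
  lintegral_eq g hg := by
    conv_lhs => rw [hμ]
    rw [lintegral_sum_measure]
    refine tsum_congr fun a => ?_
    rw [lintegral_smul_measure, lintegral_map hg (hK a).2.continuous.measurable, smul_eq_mul]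

theorem abs_wordMap_sub_le {j : J} {K : NNReal} (hK : ∀ l, |S.ratio j l| ≤ K) {z : ℝ}
    (hz : ∀ l, S.ratio j l * z + S.trans j l = z) (w : ℕ → L j) (n : ℕ) (x : unitInterval) :
    |((wordMap (S.fibre j) w n x : unitInterval) : ℝ) - z| ≤ K ^ n * (1 + |z|) := by
  have key : |((wordMap (S.fibre j) w n x : unitInterval) : ℝ) - z| ≤ K ^ n * |(x : ℝ) - z| := by
    induction n generalizing x with
    | zero => simp [wordMap]
    | succ n ih =>
      refine (ih (S.fibre j (w n) x)).trans ?_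
      have h1 : (S.fibre j (w n) x : ℝ) - z = S.ratio j (w n) * (x - z) := by
        conv_lhs => rw [← hz (w n), S.fibre_eq]
        ring
      rw [h1, abs_mul, pow_succ, mul_assoc]
      gcongr
      exact hK _
  refine key.trans ?_
  gcongr
  have := abs_sub (x : ℝ) z
  rw [abs_of_nonneg x.2.1] at this
  linarith [x.2.2]

/-- Two maps of some fibre system do not commute. -/
theorem exists_not_commute : ∃ (j : J) (l l' : L j),
    S.ratio j l * S.trans j l' + S.trans j l ≠ S.ratio j l' * S.trans j l + S.trans j l' := by
  obtain ⟨j, x, hx, y, hy, hxy⟩ := S.exists_nontrivial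
  by_contra! hcon
  obtain ⟨-, K, hK⟩ := S.fibre_isCIFS j
  have hKr : ∀ l, |S.ratio j l| ≤ K := by
    intro l
    have h1 := (hK l).2.dist_le_mul 1 0
    rw [Subtype.dist_eq, Subtype.dist_eq, S.fibre_eq, S.fibre_eq] at h1
    simpa [Real.dist_eq] using h1
  have hK1 : K < 1 := by
    obtain ⟨w, -⟩ := mem_iUnion.1 hx
    exact (hK (w 0)).1
  obtain ⟨l₀⟩ : Nonempty (L j) := by
    obtain ⟨w, -⟩ := mem_iUnion.1 hx
    exact ⟨w 0⟩
  have hne : ∀ l, 1 - S.ratio j l ≠ 0 := fun l => by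
    have := (le_abs_self (S.ratio j l)).trans_lt (S.abs_ratio_mem j l).2
    linarith
  -- A map commuting with the one of `l₀` fixes its unique fixed point. All words then contract to
  -- that point, contradicting nontriviality.
  have hz : ∀ l, S.ratio j l * (S.trans j l₀ / (1 - S.ratio j l₀)) + S.trans j l
      = S.trans j l₀ / (1 - S.ratio j l₀) := by
    intro l
    have h1 := hne l₀
    have h2 := hcon j l l₀
    field_simp
    linarith
  have hconst : ∀ x ∈ attractor (S.fibre j), (x : ℝ) = S.trans j l₀ / (1 - S.ratio j l₀) := by
    intro x hx
    obtain ⟨w, hw⟩ := mem_iUnion.1 hx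
    have hb : ∀ n : ℕ, |(x : ℝ) - S.trans j l₀ / (1 - S.ratio j l₀)|
        ≤ K ^ (n + 1) * (1 + |S.trans j l₀ / (1 - S.ratio j l₀)|) := by
      intro n
      obtain ⟨x', rfl⟩ := mem_iInter.1 hw n
      exact S.abs_wordMap_sub_le hKr hz w (n + 1) x'
    have hlim := (((tendsto_pow_atTop_nhds_zero_of_lt_one K.2
      (show (K : ℝ) < 1 from mod_cast hK1)).comp (Filter.tendsto_add_atTop_nat 1)).mul_const
        (1 + |S.trans j l₀ / (1 - S.ratio j l₀)|))
    rw [zero_mul] at hlim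
    have h0 := ge_of_tendsto' hlim hb
    exact sub_eq_zero.1 (abs_eq_zero.1 (le_antisymm h0 (abs_nonneg _)))
  exact hxy (Subtype.ext ((hconst x hx).trans (hconst y hy).symm))

end FibreProductCIFS

/-- If the second derivative does not vanish on the support of the measure, it is bounded away
from zero on the images of the maps of a sufficiently contracting system. -/
theorem FibredSystem.exists_le_abs_partialLast {d : ℕ} {μ : Measure (cube (d + 1))}
    [IsProbabilityMeasure μ] {Y : Type*} (π : cube (d + 1) → Y) (h : cube (d + 1) → ℝ)
    {ρ : NNReal} (τ : ℝ) (hρ : ρ < 1)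
    {φ : cube (d + 1) → ℝ} (hφ : Continuous φ) (h0 : ∀ x ∈ μ.support, φ x ≠ 0) :
    ∃ m : ℝ, 0 < m ∧ ∃ n : ℕ, ∀ (A' : Type u) (T : FibredSystem μ π h A' (ρ ^ 2 ^ n) τ) (a : A')
      (x : cube (d + 1)), m ≤ |φ (T.map a x)| := by
  have hne : μ.support.Nonempty := Measure.nonempty_support (IsProbabilityMeasure.ne_zero μ)
  obtain ⟨x₀, hx₀, hmin⟩ := (Measure.isClosed_support (μ := μ)).isCompact.exists_isMinOn hne
    hφ.abs.continuousOn
  set m := |φ x₀| with hm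
  have hm0 : 0 < m := abs_pos.2 (h0 x₀ hx₀)
  obtain ⟨δ, hδ, hunif⟩ := Metric.uniformContinuous_iff.1
    (CompactSpace.uniformContinuous_of_continuous hφ) (m / 2) (by positivity)
  set D := Metric.diam (univ : Set (cube (d + 1))) with hD
  have hD0 : 0 ≤ D := Metric.diam_nonneg
  obtain ⟨n, hn⟩ := exists_pow_lt_of_lt_one (show 0 < δ / (D + 1) by positivity)
    (show (ρ : ℝ) < 1 from mod_cast hρ)
  refine ⟨m / 2, by positivity, n, fun A' T a x => ?_⟩
  -- The image of the cube contains a point of the support and has diameter below `δ`, so the value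
  -- varies by less than `m / 2` on it.
  have hmem := T.map_mem_support a hx₀
  have hdist : dist (T.map a x) (T.map a x₀) < δ := by
    refine ((T.lipschitz a).dist_le_mul x x₀).trans_lt ?_
    have h1 : dist x x₀ ≤ D := Metric.dist_le_diam_of_mem
      (isCompact_univ.isBounded) (mem_univ x) (mem_univ x₀)
    have h2 : (ρ : ℝ) ^ 2 ^ n ≤ ρ ^ n :=
      pow_le_pow_of_le_one ρ.2 (by exact_mod_cast hρ.le) Nat.lt_two_pow_self.le
    rw [lt_div_iff₀ (by positivity)] at hn
    push_cast
    calc (ρ : ℝ) ^ 2 ^ n * dist x x₀ ≤ ρ ^ n * (D + 1) := by gcongr; linarith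
      _ < δ := hn
  have h3 := hunif hdist
  rw [Real.dist_eq] at h3
  have h4 : m ≤ |φ (T.map a x₀)| := hmin hmem
  have h5 := abs_sub_abs_le_abs_sub (φ (T.map a x₀)) (φ (T.map a x))
  rw [abs_sub_comm] at h5
  linarith

end FibreIFS

/-! ### Assembly of the two statements -/

open FibreIFS in
theorem theoremt {d : ℕ} {J : Type*} {L : J → Type*}
    (S : FibreIFS.FibreProductCIFS d J L)
    (p : (Σ j, L j) → ℝ) (hp_pos : ∀ a, 0 < p a) (hp_sum : HasSum p 1)
    (τ : ℝ) (hτ : 0 < τ)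
    (hmoment : Summable fun a : (Σ j, L j) => p a * |S.ratio a.1 a.2| ^ (-τ))
    (μ : Measure (FibreIFS.cube (d + 1))) [IsProbabilityMeasure μ]
    (hμ : FibreIFS.IsStationary S.maps p μ) :
    ∃ η κ C : ℝ, 0 < η ∧ 0 < κ ∧ 0 < C ∧
      (∀ F : EuclideanSpace ℝ (Fin (d + 1)) → ℝ,
        ContDiffOn ℝ 2 F (FibreIFS.cube (d + 1)) →
        (∀ x ∈ FibreIFS.cube (d + 1), FibreIFS.partialLast 2 F x ≠ 0) →
        ∀ ξ : ℝ, ξ ≠ 0 →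
          ‖FibreIFS.fourierTransform (FibreIFS.pushforward F μ) ξ‖ ≤
            C * (1 + FibreIFS.normSup 1 F + FibreIFS.normSup 1 F ^ (-κ)
                  + FibreIFS.normSup 2 F)
              * (1 + FibreIFS.normMin 2 F ^ (-κ)) * |ξ| ^ (-η)) ∧
      (∀ F : EuclideanSpace ℝ (Fin (d + 1)) → ℝ,
        ContDiffOn ℝ 2 F (FibreIFS.cube (d + 1)) →
        (∀ x ∈ μ.support, FibreIFS.partialLast 2 F x ≠ 0) →
        ∃ C' : ℝ, 0 < C' ∧ ∀ ξ : ℝ, ξ ≠ 0 →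
          ‖FibreIFS.fourierTransform (FibreIFS.pushforward F μ) ξ‖ ≤ C' * |ξ| ^ (-η)) := by
  obtain ⟨-, K, hK⟩ := S.prod_isCIFS
  obtain ⟨j, l, l', hll⟩ := S.exists_not_commute
  have hK1 : K < 1 := (hK ⟨j, l⟩).1
  set T := S.fibredSystem hK hp_pos hp_sum hmoment hμ with hT
  have htw : T.sq.Twins (⟨j, l⟩, ⟨j, l'⟩) (⟨j, l'⟩, ⟨j, l⟩) := FibredSystem.twins_sq_swap rfl hll
  obtain ⟨θ, η, C, hθ, hθτ, hη, hC, hdec⟩ := htw.exists_fibreDecay (fun x => (cubeLast x).2) hτ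
    (mul_lt_one_of_nonneg_of_lt_one_left zero_le hK1 hK1.le)
  have hM₁ : ∀ F : EuclideanSpace ℝ (Fin (d + 1)) → ℝ, ContDiffOn ℝ 2 F (cube (d + 1)) →
      ∀ (y : cube d), ∀ s ∈ Icc (0 : ℝ) 1,
        |iteratedDerivWithin 1 (onFibre F y) (Icc 0 1) s| ≤ normSup 1 F := fun F hF y s hs => by
    rw [← partialLast_cubeSnoc 1 F y ⟨s, hs⟩]
    exact abs_partialLast_le_normSup (continuous_partialLast_one hF) _
  have hM₂ : ∀ F : EuclideanSpace ℝ (Fin (d + 1)) → ℝ, ContDiffOn ℝ 2 F (cube (d + 1)) →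
      ∀ (y : cube d), ∀ s ∈ Icc (0 : ℝ) 1,
        |iteratedDerivWithin 2 (onFibre F y) (Icc 0 1) s| ≤ normSup 2 F := fun F hF y s hs => by
    rw [← partialLast_cubeSnoc 2 F y ⟨s, hs⟩]
    exact abs_partialLast_le_normSup (continuous_partialLast_two hF) _
  refine ⟨η, θ, C, hη, hθ, hC, fun F hF h0 ξ hξ => ?_, fun F hF h0 => ?_⟩
  · rw [fourierTransform_pushforward hF.continuousOn]
    have hmin := normMin_pos (continuous_partialLast_two hF) h0
    -- The identity parametrisation, ratio `1` and translation `0`, of the whole fibre.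
    have hreg : ∀ y : cube d, FibreRegular (fun s => onFibre F y (1 * s + 0))
        (fun s => 1 * iteratedDerivWithin 1 (onFibre F y) (Icc 0 1) (1 * s + 0))
        (normSup 1 F) (normSup 2 F) (1 ^ 2 * normMin 2 F) := fun y =>
      fibreRegular_comp_affine (contDiffOn_onFibre hF y) (hM₁ F hF y) (hM₂ F hF y) one_ne_zero
        (by simp) (by simp) fun s hs => by
          rw [one_mul, add_zero, ← partialLast_cubeSnoc 2 F y ⟨s, hs⟩]
          exact normMin_le_abs_partialLast _ _ _
    simp only [one_mul, add_zero, one_pow] at hreg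
    refine (hdec (fun x => F x) (onFibre F) _ _ _ _ hF.continuousOn.domRestrict.measurable
      (normSup_nonneg 1 F) (normSup_nonneg 2 F) hmin hreg (apply_eq_onFibre F) ξ hξ).trans ?_
    have h1 : 0 ≤ normSup 1 F ^ (-θ) := Real.rpow_nonneg (normSup_nonneg 1 F) _
    -- The bound obtained has no negative power of `normSup 1 F`; this nonnegative term is simply
    -- added.
    have h2 : 1 + normSup 1 F + normSup 2 F
        ≤ 1 + normSup 1 F + normSup 1 F ^ (-θ) + normSup 2 F := by linarith
    exact mul_le_mul_of_nonneg_right (mul_le_mul_of_nonneg_right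
      (mul_le_mul_of_nonneg_left h2 hC.le) (by positivity)) (by positivity)
  · simp only [fourierTransform_pushforward hF.continuousOn]
    obtain ⟨m, hm, n, hmn⟩ := FibredSystem.exists_le_abs_partialLast cubeInit
      (fun x => (cubeLast x : ℝ)) τ hK1 (continuous_partialLast_two hF)
      fun x hx => h0 x hx
    -- The iterate is used only to split the integral; the decay `hdec` concerns `μ` itself, so `η`
    -- is the same as in the first statement.
    obtain ⟨A', ⟨T'⟩⟩ := T.exists_nonempty_pow n
    have hρ1 : K ^ 2 ^ n ≤ 1 := pow_le_one₀ zero_le hK1.le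
    have hheight : ∀ (a : A') (y : cube d) (s : ℝ) (hs : s ∈ Icc (0 : ℝ) 1),
        T'.map a (cubeSnoc y ⟨s, hs⟩) = cubeSnoc (T'.base a y)
          (cubeLast (T'.map a (cubeSnoc y ⟨s, hs⟩))) ∧
        (cubeLast (T'.map a (cubeSnoc y ⟨s, hs⟩)) : ℝ) = T'.ratio a * s + T'.trans a := by
      intro a y s hs
      have h1 := T'.proj_map a (cubeSnoc y ⟨s, hs⟩)
      have h2 := T'.height_map a (cubeSnoc y ⟨s, hs⟩)
      simp only [cubeInit_cubeSnoc, cubeLast_cubeSnoc] at h1 h2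
      refine ⟨?_, h2⟩
      rw [← h1, cubeSnoc_init_last]
    refine T'.exists_norm_integral_osc_le_of_maps hρ1 hθτ hC hdec
      (f := fun a y s => onFibre F (T'.base a y) (T'.ratio a * s + T'.trans a))
      (g := fun a y s => T'.ratio a * iteratedDerivWithin 1 (onFibre F (T'.base a y)) (Icc 0 1)
        (T'.ratio a * s + T'.trans a))
      hF.continuousOn.domRestrict.measurable (normSup_nonneg 1 F) (normSup_nonneg 2 F) hm ?_ ?_
    · intro a y
      refine fibreRegular_comp_affine (contDiffOn_onFibre hF _) (hM₁ F hF _) (hM₂ F hF _)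
        (T'.ratio_ne a) ((T'.abs_ratio_le a).trans (by exact_mod_cast hρ1)) (fun s hs => ?_)
        fun s hs => ?_
      · rw [← (hheight a y s hs).2]; exact (cubeLast _).2
      · rw [← (hheight a y s hs).2, ← partialLast_cubeSnoc, ← (hheight a y s hs).1]
        exact hmn A' T' a _
    · intro a x
      have h2 := T'.height_map a x
      rw [apply_eq_onFibre F (T'.map a x), T'.proj_map, h2]
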